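/- Let $n\ge 1$ be an integer and $p\ge 1$ a real number. For $u:\mathbb R^n\to\mathbb R\cup\{+\infty\}$ write $u^*(y)=\sup_{x}(\langle x,y\rangle-u(x))$. Let $\mathcal L_0$ be the set of proper convex functions $u:\mathbb R^n\to[0,+\infty]$ with $u(x)\to+\infty$ as $|x|\to\infty$, $u^{**}=u$ and $u(0)=0$, and let $\mathcal A_0=\{e^{-u}:u\in\mathcal L_0\}$. For a log-concave function $f=e^{-u}$ put $h_f=u^*$, $f^\circ=e^{-u^*}$ and $J(f)=\int_{\mathbb R^n}f\,dx$. For $f,g\in\mathcal A_0$ and $t>0$ let $f\oplus_p t\cdot_p g=\exp\big(-\big[(h_f^p+t\,h_g^p)^{1/p}\big]^*\big)$ and $$\delta J_p(f,g)=\lim_{t\to0^+}\frac{J(f\oplus_p t\cdot_p g)-J(f)}{t},$$ whenever this limit exists in $\mathbb R$. Put $J(f^\diamond)=\int_{\mathbb R^n}(nf+f\log f)\,dx$ (with $0\log 0=0$) and, if $J(f^\diamond)>0$, $\overline\delta J_p(f,g)=\big(p\,\delta J_p(f,g)/J(f^\diamond)\big)^{1/p}$. The $L_p$ surface area measure $\mu_p(f,\cdot)$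 of $f=e^{-u}$ is the image under $\nabla u$ of the measure $h_f(\nabla u(x))^{1-p}f(x)\,dx$ on $\{u<\infty\}$ (for $p>1$, with $0^{1-p}=+\infty$). For $\phi\in GL(n)$ let $\gamma_\phi(x)=e^{-\|\phi x\|^2/2}$, and let $c_n=(2\pi)^{n/2}$. Let $f\in\mathcal A_0$ be such that the support of $f$ has non-empty interior, $J(f^\diamond)>0$, and $\delta J_p(f,\gamma_\phi)$ exists as a finite limit for every $\phi\in GL(n)$. Consider the problem $\overline S_p$: minimize $\overline\delta J_p(f,\gamma_\phi)$ over all Gaussian functions $\gamma_\phi$, $\phi\in GL(n)$, with $J(\gamma_\phi)/c_n\ge 1$. Then $\overline S_p$ has a solution, and the Gaussian function solving it is unique. Moreover, for every $\phi\in GL(n)$, the Gaussian function $\gamma_\phi$ solves $\overline S_p$ if and only if $J(\gamma_\phi)=c_n$ and, for all $y\in\mathbb R^n$, $$\delta J_p(f,\gamma_\phi)\,h_{\gamma_\phi^\circ}(y)=\frac{n}{4p}\int_{\mathbb R^n}|\langle x,y\rangle|^2\,h_{\gamma_\phi}(x)^{p-1}\,d\mu_p(f,x).$$ -/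

import Mathlib

open Filter Topology MeasureTheory

noncomputable section

namespace LogConcave

/-- `ℝⁿ` with its Euclidean structure. -/
abbrev E (n : ℕ) := EuclideanSpace ℝ (Fin n)

variable {n : ℕ}

/-- Fenchel conjugate `u^*(y) = sup_x (⟨x, y⟩ - u x)`. -/
def fenchel (u : E n → EReal) : E n → EReal :=
  fun y => ⨆ x : E n, ((inner ℝ x y : ℝ) : EReal) - u x

/-- The class `𝓛`: proper convex functions `u : ℝⁿ → ℝ ∪ {+∞}` with `u x → +∞` as `|x| → ∞`. -/
structure IsL (u : E n → EReal) : Prop where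
  ne_bot : ∀ x, u x ≠ ⊥
  proper : ∃ x, u x ≠ ⊤
  convex : ∀ x y : E n, ∀ t : ℝ, 0 < t → t < 1 →
    u ((1 - t) • x + t • y) ≤ ((1 - t : ℝ) : EReal) * u x + (t : EReal) * u y
  coercive : Tendsto u (Bornology.cobounded (E n)) (𝓝 ⊤)

/-- The class `𝓛₀`: those `u ∈ 𝓛` with `u ≥ 0`, `u^{**} = u` and `u 0 = 0`. -/
structure IsL0 (u : E n → EReal) : Prop extends IsL u where
  nonneg : ∀ x, 0 ≤ u x
  biconj : fenchel (fenchel u) = u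
  zero : u 0 = 0

/-- The function `e^{-u}`, with `e^{-∞} = 0`. -/
def expNeg (u : E n → EReal) : E n → ℝ := fun x => (EReal.exp (-u x)).toReal

/-- The class `𝓐₀ = {e^{-u} : u ∈ 𝓛₀}`. -/
def classA0 (n : ℕ) : Set (E n → ℝ) := {f | ∃ u : E n → EReal, IsL0 u ∧ f = expNeg u}

/-- The function `u = -log f`, with `-log 0 = +∞`. -/
def negLog (f : E n → ℝ) : E n → EReal := fun x => -ENNReal.log (ENNReal.ofReal (f x))

/-- Support function `h_f = (-log f)^*`. -/
def supportFn (f : E n → ℝ) : E n → EReal := fenchel (negLog f)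

/-- Polar function `f° = e^{-(-log f)^*}`. -/
def polar (f : E n → ℝ) : E n → ℝ := expNeg (supportFn f)

/-- The `L_p` Asplund combination `α ·_p f ⊕_p β ·_p g = exp(-[(α h_f^p + β h_g^p)^{1/p}]^*)`, for
`f, g ∈ 𝓐₀` (so that `h_f, h_g ≥ 0`) and `α, β ≥ 0`; here `0 · ∞ = 0`. -/
def lpAsplund (p α : ℝ) (f : E n → ℝ) (β : ℝ) (g : E n → ℝ) : E n → ℝ :=
  expNeg (fenchel fun y =>
    (((ENNReal.ofReal α * (supportFn f y).toENNReal ^ p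
        + ENNReal.ofReal β * (supportFn g y).toENNReal ^ p) ^ (1 / p) : ENNReal) : EReal))

/-- Total mass `J(f) = ∫ f dx`. -/
def totalMass (f : E n → ℝ) : ℝ := ∫ x, f x

/-- `J(f^⋄) = J(n f + f log f)`, with `0 log 0 = 0`. -/
def diamondMass (f : E n → ℝ) : ℝ := totalMass fun x => n * f x + f x * Real.log (f x)

/-- The difference quotient `(J(f ⊕_p t ·_p g) - J(f)) / t`. -/
def variationQuotient (p : ℝ) (f g : E n → ℝ) (t : ℝ) : ℝ :=
  (totalMass (lpAsplund p 1 f t g) - totalMass f) / t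

/-- The first variation of the total mass at `f` along `g` exists (as a real number). -/
def HasFirstVariation (p : ℝ) (f g : E n → ℝ) : Prop :=
  ∃ d : ℝ, Tendsto (variationQuotient p f g) (𝓝[>] 0) (𝓝 d)

/-- The first variation `δJ_p(f, g) = lim_{t → 0⁺} (J(f ⊕_p t ·_p g) - J(f)) / t`,
meaningful when `HasFirstVariation p f g`. -/
def deltaJ (p : ℝ) (f g : E n → ℝ) : ℝ := limUnder (𝓝[>] 0) (variationQuotient p f g)

/-- The normalized first variation `(p δJ_p(f, g) / J(f^⋄))^{1/p}`. -/
def normDeltaJ (p : ℝ) (f g : E n → ℝ) : ℝ :=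
  (p * deltaJ p f g / diamondMass f) ^ (1 / p)

/-- The `L_p` surface area measure `μ_p(f, ·)`: with `u = -log f`, the image under `∇u` of the
measure `h_f(∇u(x))^{1-p} f(x) dx` on `dom u`. A convex function is differentiable at almost every
point of its domain, so the value of `gradient` elsewhere is irrelevant. For `p > 1` the
factor `h_f(∇u(x))^{1-p}` is `+∞` where `h_f(∇u(x)) = 0`. -/
def surfaceMeasure (p : ℝ) (f : E n → ℝ) : Measure (E n) :=
  ((volume.restrict {x | negLog f x ≠ ⊤}).withDensity fun x =>
      (supportFn f (gradient (fun z => (negLog f z).toReal) x)).toENNReal ^ (1 - p)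
        * ENNReal.ofReal (f x)).map
    (gradient fun z => (negLog f z).toReal)

/-- The Gaussian function `γ_φ(x) = exp(-‖φ x‖² / 2)`, `φ ∈ GL(n)`. -/
def gaussian (φ : E n ≃L[ℝ] E n) : E n → ℝ := fun x => Real.exp (-(‖φ x‖ ^ 2 / 2))

/-- `c_n = (2π)^{n/2}`. -/
def gaussConst (n : ℕ) : ℝ := (2 * Real.pi) ^ ((n : ℝ) / 2)

/-- `g` is a solution of the dual problem: among the Gaussian functions `γ_ψ`, `ψ ∈ GL(n)`, with
`J(γ_ψ) / c_n ≥ 1`, it minimizes the normalized first variation of `J` at `f`. -/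
def SolvesDual (p : ℝ) (f g : E n → ℝ) : Prop :=
  (∃ φ : E n ≃L[ℝ] E n, g = gaussian φ) ∧ 1 ≤ totalMass g / gaussConst n ∧
    ∀ ψ : E n ≃L[ℝ] E n, 1 ≤ totalMass (gaussian ψ) / gaussConst n →
      normDeltaJ p f g ≤ normDeltaJ p f (gaussian ψ)

end LogConcave

end

open Filter Topology MeasureTheory

noncomputable section

namespace LogConcave

open scoped ENNReal Pointwise
open Set

variable {n : ℕ}

/-! Put A = φ^{-T}. The support function of γ_φ is |Ay|²/2 and the constraint reads |det A| ≥ 1. The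
integral formula p δJ_p(f, γ_φ) = ∫ (|Ay|²/2)^p dμ_p(f, y) =: Q(A) (`quadMoment_surfaceMeasure`)
turns the problem into a finite-dimensional one: minimize Q over |det A| ≥ 1. Q is continuous,
homogeneous of degree 2p and, since μ_p(f, ·) is not carried by a hyperplane, positive off zero.
Hence a minimizer exists, and rescaling shows that it has |det A| = 1. The variations (I + c w⊗w)A
give the stated equation. Conversely, the tangent inequality for s ↦ s^p, the equation, and the
arithmetic–geometric mean inequality for the eigenvalues of P†P, P = φψ^{-1}, give Q(φ^{-T}) ≤
Q(ψ^{-T}), with equality only if P is an isometry, that is, if the Gaussians agree.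

The analytic weight lies in the integral formula, proved for nonsmooth f that may jump at the
boundary of its support. With h = h_f and F_t = f ⊕_p t·γ_φ, the bound ≥
(`DualData.lintegral_variationDensity_le`) is Fatou's lemma with pointwise lower bounds for F_t. For
≤, h_{F_t} is cut off at h + tN|y|, which amounts to a sup-convolution of f with a ball of radius
tN. Because |Ay|² grows faster than N|y|, the cut-off family is dominated by a rescaled F_{Kt} times
e^{ct}, for every K > 0. As δJ_p is finite, the integral of F_{Kt} exceeds J(f) to first order by
O(K), so Fatou applied to the difference bounds the slope of the cut-off mass by the integral plus
O(K) (`DualData.slope_le`). Prékopa–Leindler makes the logarithm of the cut-off mass concave in t,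
so this infinitesimal bound becomes J(F_t) ≤ J(f) exp(tI/J(f)), with I the integral, after K → 0 and
N → ∞ (`DualData.integral_lpSum_le`).

The same exponential bound gives nondegeneracy. If ∇(-log f) were orthogonal to v almost everywhere,
stretching A along v would not change I, yet the perturbed functions would come to dominate a fixed
power of f translated arbitrarily far along v, with bounded total mass. -/

/-! ### The Prékopa–Leindler inequality. -/

/-- One-dimensional Brunn–Minkowski inequality for compact sets. -/
theorem volume_add_le_of_isCompact {K L C : Set ℝ} (hK : IsCompact K) (hL : IsCompact L)
    (hKn : K.Nonempty) (hLn : L.Nonempty) (hC : ∀ x ∈ K, ∀ y ∈ L, x + y ∈ C) :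
    volume K + volume L ≤ volume C := by
  set b := sSup K
  set a := sInf L
  have hb : b ∈ K := hK.sSup_mem hKn
  have ha : a ∈ L := hL.sInf_mem hLn
  have h1 : volume (K + {a}) = volume K := by
    rw [add_singleton, image_add_right, measure_preimage_add_right]
  have h2 : volume ({b} + L) = volume L := by
    rw [singleton_add, image_add_left, measure_preimage_add]
  -- With b = max K and a = min L, the two translates lie on either side of a + b and share only
  -- that point, so their lengths add up.
  have hsub : (K + {a}) ∪ ({b} + L) ⊆ C := by
    rintro z (⟨x, hx, y, rfl, rfl⟩ | ⟨x, rfl, y, hy, rfl⟩)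
    · exact hC _ hx _ ha
    · exact hC _ hb _ hy
  have hinter : (K + {a}) ∩ ({b} + L) ⊆ {b + a} := by
    rintro z ⟨⟨x, hx, y, hy, rfl⟩, ⟨x', hx', y', hy', h⟩⟩
    rw [mem_singleton_iff] at hy hx'
    subst hy hx'
    have h3 : x ≤ b := le_csSup hK.bddAbove hx
    have h4 : a ≤ y' := csInf_le hL.bddBelow hy'
    simp only [] at h
    rw [mem_singleton_iff]
    linarith
  have hmeas : MeasurableSet ({b} + L) := (isCompact_singleton.add hL).measurableSet
  have h0 : volume ((K + {a}) ∩ ({b} + L)) = 0 :=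
    measure_mono_null hinter (by simp)
  calc volume K + volume L = volume (K + {a}) + volume ({b} + L) := by rw [h1, h2]
    _ = volume ((K + {a}) ∪ ({b} + L)) + volume ((K + {a}) ∩ ({b} + L)) :=
        (measure_union_add_inter _ hmeas).symm
    _ ≤ volume C := by rw [h0, add_zero]; exact measure_mono hsub

/-- One-dimensional Brunn–Minkowski inequality with weights. -/
theorem weighted_volume_add_le {α β : ℝ} (hα : 0 < α) (hβ : 0 < β) {A B C : Set ℝ}
    (hA : MeasurableSet A) (hB : MeasurableSet B) (hAn : A.Nonempty) (hBn : B.Nonempty)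
    (hC : ∀ x ∈ A, ∀ y ∈ B, α * x + β * y ∈ C) :
    ENNReal.ofReal α * volume A + ENNReal.ofReal β * volume B ≤ volume C := by
  -- Inner regularity reduces to compact subsets; no measurability of C is needed.
  have key : ∀ K ⊆ A, IsCompact K → K.Nonempty → ∀ L ⊆ B, IsCompact L → L.Nonempty →
      ENNReal.ofReal α * volume K + ENNReal.ofReal β * volume L ≤ volume C := by
    intro K hKA hK hKn L hLB hL hLn
    have := volume_add_le_of_isCompact (C := C) (hK.smul α) (hL.smul β) hKn.smul_set hLn.smul_set
      (by
        rintro _ ⟨x, hx, rfl⟩ _ ⟨y, hy, rfl⟩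
        exact hC x (hKA hx) y (hLB hy))
    simpa [Measure.addHaar_smul, abs_of_pos hα, abs_of_pos hβ] using this
  have cpt : ∀ {S : Set ℝ}, MeasurableSet S → S.Nonempty → volume S =
      ⨆ K : {K : Set ℝ // K ⊆ S ∧ IsCompact K ∧ K.Nonempty}, volume (K : Set ℝ) := by
    intro S hS hSn
    apply le_antisymm
    · refine le_of_forall_lt fun r hr => ?_
      obtain ⟨K, hKS, hK, hrK⟩ := hS.exists_lt_isCompact hr
      have hKn : K.Nonempty := by
        rw [nonempty_iff_ne_empty]; rintro rfl; simp at hrK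
      exact hrK.trans_le (le_iSup (fun K : {K : Set ℝ // K ⊆ S ∧ IsCompact K ∧ K.Nonempty} =>
        volume (K : Set ℝ)) ⟨K, hKS, hK, hKn⟩)
    · exact iSup_le fun K => measure_mono K.2.1
  obtain ⟨xA, hxA⟩ := hAn
  obtain ⟨xB, hxB⟩ := hBn
  have : Nonempty {K : Set ℝ // K ⊆ A ∧ IsCompact K ∧ K.Nonempty} :=
    ⟨⟨{xA}, by simpa using hxA, isCompact_singleton, singleton_nonempty _⟩⟩
  have : Nonempty {K : Set ℝ // K ⊆ B ∧ IsCompact K ∧ K.Nonempty} :=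
    ⟨⟨{xB}, by simpa using hxB, isCompact_singleton, singleton_nonempty _⟩⟩
  rw [cpt hA ⟨xA, hxA⟩, cpt hB ⟨xB, hxB⟩, ENNReal.mul_iSup, ENNReal.mul_iSup]
  exact ENNReal.iSup_add_iSup_le fun K L => key K K.2.1 K.2.2.1 K.2.2.2 L L.2.1 L.2.2.1 L.2.2.2

/-- Weighted arithmetic–geometric mean inequality in `ℝ≥0∞`. -/
theorem ennreal_geom_mean_le_arith_mean {α β : ℝ} (hα : 0 < α) (hβ : 0 < β) (hαβ : α + β = 1)
    (a b : ℝ≥0∞) : a ^ α * b ^ β ≤ ENNReal.ofReal α * a + ENNReal.ofReal β * b := by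
  rcases eq_or_ne a ∞ with rfl | ha
  · simp [ENNReal.mul_top, hα]
  rcases eq_or_ne b ∞ with rfl | hb
  · simp [ENNReal.mul_top, hβ]
  lift a to NNReal using ha
  lift b to NNReal using hb
  have h := NNReal.geom_mean_le_arith_mean2_weighted α.toNNReal β.toNNReal a b
    (by rw [← Real.toNNReal_add hα.le hβ.le, hαβ, Real.toNNReal_one])
  rw [Real.coe_toNNReal _ hα.le, Real.coe_toNNReal _ hβ.le] at h
  rw [← ENNReal.coe_rpow_of_nonneg _ hα.le, ← ENNReal.coe_rpow_of_nonneg _ hβ.le]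
  rw [ENNReal.ofReal, ENNReal.ofReal]
  exact_mod_cast h

/-- The layer-cake formula on `(0, 1)` for functions bounded by one. -/
theorem lintegral_eq_lintegral_meas_lt_of_le_one {f : ℝ → ℝ≥0∞} (hf : Measurable f)
    (h1 : ∀ x, f x ≤ 1) :
    ∫⁻ x, f x = ∫⁻ s in Ioo (0 : ℝ) 1, volume {x | ENNReal.ofReal s < f x} := by
  have e : ∀ x, ENNReal.ofReal (f x).toReal = f x := fun x =>
    ENNReal.ofReal_toReal ((h1 x).trans_lt ENNReal.one_lt_top).ne
  have hs : ∀ s : ℝ, 0 < s → ∀ x, s < (f x).toReal ↔ ENNReal.ofReal s < f x := fun s hs x => by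
    rw [ENNReal.ofReal_lt_iff_lt_toReal hs.le ((h1 x).trans_lt ENNReal.one_lt_top).ne]
  calc ∫⁻ x, f x = ∫⁻ x, ENNReal.ofReal (f x).toReal := by simp_rw [e]
    _ = ∫⁻ s in Ioi (0 : ℝ), volume {x | s < (f x).toReal} :=
        lintegral_eq_lintegral_meas_lt _ (ae_of_all _ fun x => ENNReal.toReal_nonneg)
          hf.ennreal_toReal.aemeasurable
    _ = ∫⁻ s in Ioi (0 : ℝ), volume {x | ENNReal.ofReal s < f x} :=
        setLIntegral_congr_fun measurableSet_Ioi fun s h => by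
          simp only [hs s h]
    _ = ∫⁻ s in Ioo (0 : ℝ) 1, volume {x | ENNReal.ofReal s < f x} := by
        rw [← lintegral_inter_add_sdiff _ (Ioi (0 : ℝ)) (measurableSet_Ioo (a := (0 : ℝ)) (b := 1)),
          inter_eq_self_of_subset_right (Ioo_subset_Ioi_self)]
        conv_rhs => rw [← add_zero (∫⁻ s in Ioo (0 : ℝ) 1, _)]
        congr 1
        rw [setLIntegral_congr_fun (g := fun _ => 0)
          (measurableSet_Ioi.diff measurableSet_Ioo), lintegral_zero]
        rintro s ⟨h0, h2⟩
        have : {x | ENNReal.ofReal s < f x} = ∅ := by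
          ext x
          simp only [mem_ofPred_eq, mem_empty_iff_false, iff_false, not_lt]
          refine (h1 x).trans ?_
          rw [ENNReal.one_le_ofReal]
          by_contra hlt
          exact h2 ⟨h0, not_le.1 hlt⟩
        simp only [this, measure_empty]

/-- Prékopa–Leindler on the line for functions with supremum one. -/
theorem prekopa_leindler_real_normalized {α β : ℝ} (hα : 0 < α) (hβ : 0 < β) (hαβ : α + β = 1)
    {f g h : ℝ → ℝ≥0∞} (hf : Measurable f) (hg : Measurable g) (hh : Measurable h)
    (hf1 : ⨆ x, f x = 1) (hg1 : ⨆ x, g x = 1)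
    (hfgh : ∀ x y, f x ^ α * g y ^ β ≤ h (α * x + β * y)) :
    ENNReal.ofReal α * (∫⁻ x, f x) + ENNReal.ofReal β * ∫⁻ x, g x ≤ ∫⁻ x, h x := by
  have hfl : ∀ x, f x ≤ 1 := fun x => hf1 ▸ le_iSup f x
  have hgl : ∀ x, g x ≤ 1 := fun x => hg1 ▸ le_iSup g x
  have hmf : Measurable fun s : ℝ => volume {x | ENNReal.ofReal s < f x} :=
    Antitone.measurable fun s t hst => measure_mono fun x hx =>
      (ENNReal.ofReal_le_ofReal hst).trans_lt hx
  calc ENNReal.ofReal α * (∫⁻ x, f x) + ENNReal.ofReal β * ∫⁻ x, g x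
      = ∫⁻ s in Ioo (0 : ℝ) 1, (ENNReal.ofReal α * volume {x | ENNReal.ofReal s < f x}
          + ENNReal.ofReal β * volume {x | ENNReal.ofReal s < g x}) := by
        rw [lintegral_add_left (hmf.const_mul _), lintegral_const_mul' _ _ ENNReal.ofReal_ne_top,
          lintegral_const_mul' _ _ ENNReal.ofReal_ne_top,
          lintegral_eq_lintegral_meas_lt_of_le_one hf hfl,
          lintegral_eq_lintegral_meas_lt_of_le_one hg hgl]
    _ ≤ ∫⁻ s in Ioo (0 : ℝ) 1, volume {x | ENNReal.ofReal s < min (h x) 1} := by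
        refine setLIntegral_mono' measurableSet_Ioo fun s hs => ?_
        have hs1 : ENNReal.ofReal s < 1 := by simpa using hs.2
        have hs0 : ENNReal.ofReal s ≠ 0 := by simpa using hs.1
        -- Brunn–Minkowski fails for an empty summand. The normalization to supremum one makes both
        -- superlevel sets nonempty at every level below one.
        refine weighted_volume_add_le hα hβ (measurableSet_lt measurable_const hf)
          (measurableSet_lt measurable_const hg) ?_ ?_ ?_
        · rw [← hf1] at hs1; exact lt_iSup_iff.1 hs1
        · rw [← hg1] at hs1; exact lt_iSup_iff.1 hs1
        · intro x hx y hy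
          refine lt_min (lt_of_lt_of_le ?_ (hfgh x y)) hs1
          calc ENNReal.ofReal s = ENNReal.ofReal s ^ α * ENNReal.ofReal s ^ β := by
                rw [← ENNReal.rpow_add _ _ hs0 ENNReal.ofReal_ne_top, hαβ, ENNReal.rpow_one]
            _ < f x ^ α * g y ^ β := ENNReal.mul_lt_mul
                (ENNReal.rpow_lt_rpow hx hα) (ENNReal.rpow_lt_rpow hy hβ)
    _ = ∫⁻ x, min (h x) 1 :=
        (lintegral_eq_lintegral_meas_lt_of_le_one (hh.min measurable_const)
          fun x => min_le_right _ _).symm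
    _ ≤ ∫⁻ x, h x := lintegral_mono fun x => min_le_left _ _

/-- The Prékopa–Leindler inequality holds on `V`. -/
def HasPrekopaLeindler (V : Type*) [AddCommMonoid V] [Module ℝ V] [MeasureSpace V] : Prop :=
  ∀ ⦃α β : ℝ⦄, 0 < α → 0 < β → α + β = 1 → ∀ ⦃f g h : V → ℝ≥0∞⦄,
    Measurable f → Measurable g → Measurable h →
    (∀ x y, f x ^ α * g y ^ β ≤ h (α • x + β • y)) →
    (∫⁻ x, f x) ^ α * (∫⁻ x, g x) ^ β ≤ ∫⁻ x, h x

/-- For bounded functions, dividing by the suprema reduces to the normalized additive inequality,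
which the arithmetic–geometric mean inequality makes multiplicative. Truncation at N and monotone
convergence give the general case. -/
theorem hasPrekopaLeindler_real : HasPrekopaLeindler ℝ := by
  intro α β hα hβ hαβ f g h hf hg hh hfgh
  -- bounded functions
  have bdd : ∀ {f g : ℝ → ℝ≥0∞}, Measurable f → Measurable g →
      (∀ x y, f x ^ α * g y ^ β ≤ h (α • x + β • y)) → (⨆ x, f x) ≠ ∞ → (⨆ x, g x) ≠ ∞ →
      (∫⁻ x, f x) ^ α * (∫⁻ x, g x) ^ β ≤ ∫⁻ x, h x := by
    intro f g hf hg hfgh hft hgt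
    set a := ⨆ x, f x with ha
    set b := ⨆ x, g x with hb
    rcases eq_or_ne a 0 with ha0 | ha0
    · have : ∀ x, f x = 0 := fun x => by
        have := le_iSup f x; rw [← ha, ha0] at this; exact le_antisymm this bot_le
      simp [this, hα]
    rcases eq_or_ne b 0 with hb0 | hb0
    · have : ∀ x, g x = 0 := fun x => by
        have := le_iSup g x; rw [← hb, hb0] at this; exact le_antisymm this bot_le
      simp [this, hβ]
    set m := a ^ α * b ^ β with hm
    have hm0 : m ≠ 0 := mul_ne_zero (by simp [ha0, hft]) (by simp [hb0, hgt])
    have hmt : m ≠ ∞ := ENNReal.mul_ne_top (ENNReal.rpow_ne_top_of_nonneg hα.le hft)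
      (ENNReal.rpow_ne_top_of_nonneg hβ.le hgt)
    have hprod : ∀ u v : ℝ≥0∞, (a⁻¹ * u) ^ α * (b⁻¹ * v) ^ β = m⁻¹ * (u ^ α * v ^ β) := by
      intro u v
      rw [ENNReal.mul_rpow_of_nonneg _ _ hα.le, ENNReal.mul_rpow_of_nonneg _ _ hβ.le, hm,
        ENNReal.mul_inv (Or.inr (ENNReal.rpow_ne_top_of_nonneg hβ.le hgt))
          (Or.inr (by simp [hb0, hgt])), ENNReal.inv_rpow, ENNReal.inv_rpow]
      ring
    have h1 := prekopa_leindler_real_normalized hα hβ hαβ (f := fun x => a⁻¹ * f x)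
      (g := fun x => b⁻¹ * g x) (h := fun x => m⁻¹ * h x) (hf.const_mul _) (hg.const_mul _)
      (hh.const_mul _) (by rw [← ENNReal.mul_iSup, ← ha, ENNReal.inv_mul_cancel ha0 hft])
      (by rw [← ENNReal.mul_iSup, ← hb, ENNReal.inv_mul_cancel hb0 hgt])
      (fun x y => by rw [hprod]; gcongr; exact hfgh x y)
    have h2 := (ennreal_geom_mean_le_arith_mean hα hβ hαβ _ _).trans h1
    rw [lintegral_const_mul _ hf, lintegral_const_mul _ hg, lintegral_const_mul _ hh, hprod] at h2
    exact (ENNReal.mul_le_mul_iff_right (ENNReal.inv_ne_zero.2 hmt)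
      (ENNReal.inv_ne_top.2 hm0)).1 h2
  have lim : ∀ {f : ℝ → ℝ≥0∞}, Measurable f →
      Tendsto (fun N : ℕ => ∫⁻ x, min (f x) N) atTop (𝓝 (∫⁻ x, f x)) := by
    intro f hf
    refine lintegral_tendsto_of_tendsto_of_monotone
      (fun N => (hf.min measurable_const).aemeasurable) (ae_of_all _ fun x => ?_)
      (ae_of_all _ fun x => ?_)
    · intro N M hNM
      exact min_le_min le_rfl (by exact_mod_cast hNM)
    · have := ((continuous_const (y := f x)).min continuous_id).tendsto (∞ : ℝ≥0∞) |>.comp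
        ENNReal.tendsto_nat_nhds_top
      simpa [Function.comp_def] using this
  have hmin : ∀ N : ℕ, (∫⁻ x, min (f x) N) ^ α * (∫⁻ x, min (g x) N) ^ β ≤ ∫⁻ x, h x := by
    intro N
    refine bdd (hf.min measurable_const) (hg.min measurable_const) (fun x y => ?_) ?_ ?_
    · refine le_trans ?_ (hfgh x y)
      gcongr <;> exact min_le_left _ _
    · exact ((iSup_le fun x => min_le_right _ _).trans_lt (ENNReal.natCast_lt_top N)).ne
    · exact ((iSup_le fun x => min_le_right _ _).trans_lt (ENNReal.natCast_lt_top N)).ne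
  -- Multiplication in `ℝ≥0∞` is discontinuous at 0 · ∞, so vanishing integrals are split off before
  -- the limit.
  rcases eq_or_ne (∫⁻ x, f x) 0 with hf0 | hf0
  · simp [hf0, hα]
  rcases eq_or_ne (∫⁻ x, g x) 0 with hg0 | hg0
  · simp [hg0, hβ]
  refine le_of_tendsto' (ENNReal.Tendsto.mul
    ((ENNReal.continuous_rpow_const (y := α)).tendsto _ |>.comp (lim hf)) (Or.inl ?_)
    ((ENNReal.continuous_rpow_const (y := β)).tendsto _ |>.comp (lim hg)) (Or.inl ?_)) hmin
  · simp [ENNReal.rpow_eq_zero_iff, hf0, hα.not_gt]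
  · simp [ENNReal.rpow_eq_zero_iff, hg0, hβ.not_gt]

/-- Tensorization: the inequality on `W`, applied to slices, is exactly the hypothesis on `V` for
the partial integrals. -/
theorem HasPrekopaLeindler.prod {V W : Type*} [AddCommMonoid V] [Module ℝ V] [MeasureSpace V]
    [AddCommMonoid W] [Module ℝ W] [MeasureSpace W] [SFinite (volume : Measure W)]
    [SFinite (volume : Measure V)]
    (hV : HasPrekopaLeindler V) (hW : HasPrekopaLeindler W) : HasPrekopaLeindler (V × W) := by
  intro α β hα hβ hαβ f g h hf hg hh hfgh
  rw [Measure.volume_eq_prod, lintegral_prod _ hf.aemeasurable, lintegral_prod _ hg.aemeasurable,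
    lintegral_prod _ hh.aemeasurable]
  refine hV hα hβ hαβ hf.lintegral_prod_right' hg.lintegral_prod_right' hh.lintegral_prod_right'
    fun x y => ?_
  exact hW hα hβ hαβ (hf.comp measurable_prodMk_left) (hg.comp measurable_prodMk_left)
    (hh.comp measurable_prodMk_left) fun x' y' => hfgh (x, x') (y, y')

theorem HasPrekopaLeindler.of_measurePreserving {V W : Type*} [AddCommMonoid V] [Module ℝ V]
    [MeasureSpace V] [AddCommMonoid W] [Module ℝ W] [MeasureSpace W]
    (hV : HasPrekopaLeindler V) (e : V → W) (he : MeasurePreserving e)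
    (hadd : ∀ x y, e (x + y) = e x + e y) (hsmul : ∀ (c : ℝ) x, e (c • x) = c • e x) :
    HasPrekopaLeindler W := by
  intro α β hα hβ hαβ f g h hf hg hh hfgh
  rw [← he.lintegral_comp hf, ← he.lintegral_comp hg, ← he.lintegral_comp hh]
  refine hV hα hβ hαβ (hf.comp he.measurable) (hg.comp he.measurable) (hh.comp he.measurable)
    fun x y => ?_
  rw [hadd, hsmul, hsmul]
  exact hfgh _ _

theorem hasPrekopaLeindler_pi : ∀ n : ℕ, HasPrekopaLeindler (Fin n → ℝ)
  | 0 => by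
    intro α β hα hβ hαβ f g h hf hg hh hfgh
    have := hfgh 0 0
    simpa [Measure.volume_pi_eq_dirac (0 : Fin 0 → ℝ), lintegral_dirac] using this
  | n + 1 => (hasPrekopaLeindler_real.prod (hasPrekopaLeindler_pi n)).of_measurePreserving
      (MeasurableEquiv.piFinSuccAbove (fun _ : Fin (n + 1) => ℝ) 0).symm
      ((volume_preserving_piFinSuccAbove (fun _ : Fin (n + 1) => ℝ) 0).symm _)
      (fun x y => by
        ext i; refine Fin.cases ?_ (fun j => ?_) i <;> simp [MeasurableEquiv.piFinSuccAbove])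
      (fun c x => by
        ext i; refine Fin.cases ?_ (fun j => ?_) i <;> simp [MeasurableEquiv.piFinSuccAbove])

/-- The Prékopa–Leindler inequality in Euclidean space. -/
theorem hasPrekopaLeindler_euclideanSpace (n : ℕ) : HasPrekopaLeindler (E n) :=
  (hasPrekopaLeindler_pi n).of_measurePreserving _ (PiLp.volume_preserving_toLp (Fin n))
    (fun _ _ => rfl) (fun _ _ => rfl)

/-! ### Envelopes exp(-H^*) and log-concavity of their total mass. -/

/-- The function `exp(-H^*)`, where `H` is read as `+∞` off `S`. -/
def env (S : Set (E n)) (H : E n → ℝ) (x : E n) : ℝ :=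
  ⨅ y : S, Real.exp (H y - inner ℝ x (y : E n))

theorem bddBelow_env (S : Set (E n)) (H : E n → ℝ) (x : E n) :
    BddBelow (range fun y : S => Real.exp (H y - inner ℝ x (y : E n))) :=
  ⟨0, by rintro _ ⟨y, rfl⟩; positivity⟩

theorem env_nonneg (S : Set (E n)) (H : E n → ℝ) (x : E n) : 0 ≤ env S H x :=
  Real.iInf_nonneg fun _ => by positivity

theorem env_le {S : Set (E n)} (H : E n → ℝ) (x : E n) {y : E n} (hy : y ∈ S) :
    env S H x ≤ Real.exp (H y - inner ℝ x y) :=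
  ciInf_le (bddBelow_env S H x) ⟨y, hy⟩

theorem le_env {S : Set (E n)} (hS : S.Nonempty) {H : E n → ℝ} {x : E n} {r : ℝ}
    (h : ∀ y ∈ S, r ≤ Real.exp (H y - inner ℝ x y)) : r ≤ env S H x := by
  have := hS.to_subtype
  exact le_ciInf fun y => h y y.2

theorem env_mono {S : Set (E n)} (hS : S.Nonempty) {H H' : E n → ℝ} (h : ∀ y ∈ S, H y ≤ H' y)
    (x : E n) : env S H x ≤ env S H' x :=
  le_env hS fun y hy => (env_le H x hy).trans (Real.exp_le_exp.2 (by linarith [h y hy]))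

theorem env_le_one {S : Set (E n)} (h0 : (0 : E n) ∈ S) {H : E n → ℝ} (hH : H 0 = 0) (x : E n) :
    env S H x ≤ 1 := by
  simpa [hH] using env_le H x h0

/-- An infimum of continuous functions, even an uncountable one, is upper semicontinuous. -/
theorem measurable_env {S : Set (E n)} (hS : S.Nonempty) (H : E n → ℝ) : Measurable (env S H) := by
  have := hS.to_subtype
  refine UpperSemicontinuous.measurable ?_
  refine upperSemicontinuous_ciInf (fun x => bddBelow_env S H x) fun y => ?_
  refine Continuous.upperSemicontinuous ?_
  fun_prop

/-- Exponential decay is integrable. -/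
theorem integrable_exp_neg_mul_norm {δ : ℝ} (hδ : 0 < δ) :
    Integrable fun x : E n => Real.exp (-(δ * ‖x‖)) := by
  -- The majorant is a multiple of (1 + ‖x‖)^{-(n+1)}, obtained from e^s ≥ s^{n+1}/(n+1)! at s = δ(1
  -- + ‖x‖).
  have hi := (integrable_one_add_norm (E := E n) (μ := volume) (r := ((n + 1 : ℕ) : ℝ))
    (by simp)).const_mul (Real.exp δ * (n + 1).factorial / δ ^ (n + 1))
  refine hi.mono' (by fun_prop) (ae_of_all _ fun x => ?_)
  have h1 : 0 < 1 + ‖x‖ := by positivity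
  rw [Real.norm_of_nonneg (by positivity), Real.rpow_neg h1.le, Real.rpow_natCast]
  have h2 := Real.pow_div_factorial_le_exp (δ * (1 + ‖x‖)) (by positivity) (n + 1)
  have h3 : Real.exp (-(δ * ‖x‖)) = Real.exp δ / Real.exp (δ * (1 + ‖x‖)) := by
    rw [← Real.exp_sub]; congr 1; ring
  rw [h3, div_le_iff₀ (by positivity)]
  rw [mul_pow, div_le_iff₀ (by positivity)] at h2
  calc Real.exp δ = Real.exp δ / δ ^ (n + 1) * ((1 + ‖x‖) ^ (n + 1))⁻¹
        * (δ ^ (n + 1) * (1 + ‖x‖) ^ (n + 1)) := by field_simp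
    _ ≤ Real.exp δ / δ ^ (n + 1) * ((1 + ‖x‖) ^ (n + 1))⁻¹
        * (Real.exp (δ * (1 + ‖x‖)) * (n + 1).factorial) := by gcongr
    _ = _ := by ring

/-- Testing the infimum at the point of norm δ in the direction of x already gives exponential
decay, so integrability needs only a bound on H near the origin. -/
theorem env_le_exp_neg_norm {S : Set (E n)} {H : E n → ℝ} {δ M : ℝ} (hδ : 0 ≤ δ)
    (hb : ∀ y, ‖y‖ ≤ δ → y ∈ S ∧ H y ≤ M) (x : E n) :
    env S H x ≤ Real.exp M * Real.exp (-(δ * ‖x‖)) := by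
  rcases eq_or_ne x 0 with rfl | hx
  · obtain ⟨h1, h2⟩ := hb 0 (by simpa)
    refine (env_le H 0 h1).trans ?_
    simpa using h2
  have hx' : 0 < ‖x‖ := norm_pos_iff.2 hx
  obtain ⟨h1, h2⟩ := hb ((δ / ‖x‖) • x) (by
    rw [norm_smul, Real.norm_of_nonneg (by positivity)]; field_simp; rfl)
  refine (env_le H x h1).trans ?_
  rw [← Real.exp_add, inner_smul_right, real_inner_self_eq_norm_sq]
  refine Real.exp_le_exp.2 ?_
  have : δ / ‖x‖ * ‖x‖ ^ 2 = δ * ‖x‖ := by field_simp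
  linarith

theorem integrable_env {S : Set (E n)} (hS : S.Nonempty) {H : E n → ℝ} {δ M : ℝ} (hδ : 0 < δ)
    (hb : ∀ y, ‖y‖ ≤ δ → y ∈ S ∧ H y ≤ M) : Integrable (env S H) := by
  refine ((integrable_exp_neg_mul_norm hδ).const_mul (Real.exp M)).mono'
    (measurable_env hS H).aestronglyMeasurable (ae_of_all _ fun x => ?_)
  rw [Real.norm_of_nonneg (env_nonneg S H x)]
  exact env_le_exp_neg_norm hδ.le hb x

/-- Both infima are tested at the same dual point w, so pointwise concavity of H in a parameter
becomes the hypothesis of Prékopa–Leindler. -/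
theorem env_rpow_mul_env_rpow_le {S : Set (E n)} (hS : S.Nonempty) {α β : ℝ} (hα : 0 ≤ α)
    (hβ : 0 ≤ β) {H₀ H₁ H : E n → ℝ} (hH : ∀ y ∈ S, α * H₀ y + β * H₁ y ≤ H y) (x y : E n) :
    env S H₀ x ^ α * env S H₁ y ^ β ≤ env S H (α • x + β • y) := by
  refine le_env hS fun w hw => ?_
  calc env S H₀ x ^ α * env S H₁ y ^ β
      ≤ Real.exp (H₀ w - inner ℝ x w) ^ α * Real.exp (H₁ w - inner ℝ y w) ^ β := by
        gcongr
        · exact Real.rpow_nonneg (env_nonneg _ _ _) _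
        · exact env_nonneg _ _ _
        · exact env_le _ _ hw
        · exact env_nonneg _ _ _
        · exact env_le _ _ hw
    _ = Real.exp (α * H₀ w + β * H₁ w - inner ℝ (α • x + β • y) w) := by
        rw [← Real.exp_mul, ← Real.exp_mul, ← Real.exp_add, inner_add_left, inner_smul_left,
          inner_smul_left]
        congr 1
        simp only [conj_trivial]
        ring
    _ ≤ _ := Real.exp_le_exp.2 (by linarith [hH w hw])

/-- Log-concavity of the total mass along families that are concave in the parameter. -/
theorem log_integral_env_concave {S : Set (E n)} (hS : S.Nonempty) {α β : ℝ} (hα : 0 < α)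
    (hβ : 0 < β) (hαβ : α + β = 1) {H₀ H₁ H : E n → ℝ}
    (hH : ∀ y ∈ S, α * H₀ y + β * H₁ y ≤ H y)
    (hi₀ : Integrable (env S H₀)) (hi₁ : Integrable (env S H₁)) (hi : Integrable (env S H))
    (hp₀ : 0 < ∫ x, env S H₀ x) (hp₁ : 0 < ∫ x, env S H₁ x) :
    α * Real.log (∫ x, env S H₀ x) + β * Real.log (∫ x, env S H₁ x)
      ≤ Real.log (∫ x, env S H x) := by
  have h := hasPrekopaLeindler_euclideanSpace n hα hβ hαβ
    (measurable_env hS H₀).ennreal_ofReal (measurable_env hS H₁).ennreal_ofReal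
    (measurable_env hS H).ennreal_ofReal (fun x y => by
      rw [ENNReal.ofReal_rpow_of_nonneg (env_nonneg _ _ _) hα.le,
        ENNReal.ofReal_rpow_of_nonneg (env_nonneg _ _ _) hβ.le,
        ← ENNReal.ofReal_mul (Real.rpow_nonneg (env_nonneg _ _ _) _)]
      exact ENNReal.ofReal_le_ofReal (env_rpow_mul_env_rpow_le hS hα.le hβ.le hH x y))
  rw [← ofReal_integral_eq_lintegral_ofReal hi₀ (ae_of_all _ (env_nonneg _ _)),
    ← ofReal_integral_eq_lintegral_ofReal hi₁ (ae_of_all _ (env_nonneg _ _)),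
    ← ofReal_integral_eq_lintegral_ofReal hi (ae_of_all _ (env_nonneg _ _)),
    ENNReal.ofReal_rpow_of_nonneg hp₀.le hα.le, ENNReal.ofReal_rpow_of_nonneg hp₁.le hβ.le,
    ← ENNReal.ofReal_mul (by positivity),
    ENNReal.ofReal_le_ofReal_iff (integral_nonneg (env_nonneg _ _))] at h
  have := Real.log_le_log (by positivity) h
  rwa [Real.log_mul (by positivity) (by positivity), Real.log_rpow hp₀, Real.log_rpow hp₁] at this

/-! ### Perturbation by a quadratic form: the lower bound for the first variation. -/

/-- The function `(η^p + t k^p)^{1/p}`. -/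
def lpSum (p t : ℝ) (η k : E n → ℝ) (y : E n) : ℝ := (η y ^ p + t * k y ^ p) ^ (1 / p)

/-- The quadratic form `‖A y‖² / 2`. -/
def halfSq (A : E n →L[ℝ] E n) (y : E n) : ℝ := ‖A y‖ ^ 2 / 2

theorem halfSq_nonneg (A : E n →L[ℝ] E n) (y : E n) : 0 ≤ halfSq A y := by
  unfold halfSq; positivity

/-- The gradient of `-log f`. -/
def gradNegLog (f : E n → ℝ) (x : E n) : E n := gradient (fun z => -Real.log (f z)) x

theorem lpSum_zero {p : ℝ} (hp : 1 ≤ p) {η k : E n → ℝ} {y : E n} (hη : 0 ≤ η y) :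
    lpSum p 0 η k y = η y := by
  rw [lpSum, zero_mul, add_zero, ← Real.rpow_mul hη, mul_one_div_cancel (by linarith),
    Real.rpow_one]

/-- Jensen's inequality for s ↦ s^p at a and b/l, with weights proportional to 1 and t l^p; equality
holds at b = l a. These linear minorants of the L_p sum replace L_p addition by a dilation and an
ordinary sum, with l free to be optimized. -/
theorem weighted_sum_le_lp {p a b t l : ℝ} (hp : 1 ≤ p) (ha : 0 ≤ a) (hb : 0 ≤ b) (ht : 0 ≤ t)
    (hl : 0 < l) :
    (1 + t * l ^ p) ^ (1 / p - 1) * (a + t * l ^ (p - 1) * b) ≤ (a ^ p + t * b ^ p) ^ (1 / p) := by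
  have hp0 : 0 < p := by linarith
  set w := t * l ^ p with hw
  have hw0 : 0 ≤ w := by positivity
  have h1 : t * l ^ (p - 1) * b = w * (b / l) := by
    rw [hw, Real.rpow_sub_one hl.ne']; field_simp
  have h2 : t * b ^ p = w * (b / l) ^ p := by
    rw [hw, Real.div_rpow hb hl.le]; field_simp
  rw [h1, h2]
  set b' := b / l
  have hb' : 0 ≤ b' := by positivity
  have hc := (convexOn_rpow hp).2 (mem_Ici.2 ha) (mem_Ici.2 hb')
    (show 0 ≤ 1 / (1 + w) by positivity) (show 0 ≤ w / (1 + w) by positivity) (by field_simp)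
  simp only [smul_eq_mul] at hc
  have e1 : 1 / (1 + w) * a + w / (1 + w) * b' = (a + w * b') / (1 + w) := by ring
  have e2 : 1 / (1 + w) * a ^ p + w / (1 + w) * b' ^ p = (a ^ p + w * b' ^ p) / (1 + w) := by ring
  rw [e1, e2, Real.div_rpow (by positivity) (by positivity), div_le_div_iff₀ (by positivity)
    (by positivity)] at hc
  have hiff : ∀ u v : ℝ, 0 ≤ u → 0 ≤ v → (u ≤ v ^ (1 / p) ↔ u ^ p ≤ v) := fun u v hu hv => by
    rw [one_div]; exact Real.le_rpow_inv_iff_of_pos hu hv hp0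
  rw [hiff _ _ (by positivity) (by positivity), Real.mul_rpow (by positivity) (by positivity), ← Real.rpow_mul (by positivity)]
  have e3 : (1 / p - 1) * p = 1 - p := by field_simp
  rw [e3, Real.rpow_sub (by positivity), Real.rpow_one, div_mul_eq_mul_div, div_le_iff₀
    (by positivity)]
  linarith

/-- Convex-analytic data of a log-concave function: `f = exp(-η^*)`, with `η ≥ 0` finite exactly on
`S`, and `η = (-log f)^*` at the gradients of `-log f`. -/
structure DualData (f : E n → ℝ) (S : Set (E n)) (η : E n → ℝ) : Prop where
  zero_mem : (0 : E n) ∈ S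
  zero : η 0 = 0
  nonneg : ∀ y, 0 ≤ η y
  eq : f = env S η
  ball : ∃ δ > 0, ∃ M, ∀ y, ‖y‖ ≤ δ → y ∈ S ∧ η y ≤ M
  grad : ∀ᵐ x, 0 < f x → DifferentiableAt ℝ (fun z => -Real.log (f z)) x ∧
    (∀ᶠ z in 𝓝 x, 0 < f z) ∧ gradNegLog f x ∈ S ∧
    η (gradNegLog f x) = inner ℝ x (gradNegLog f x) + Real.log (f x)
  measurable : Measurable η
  pos : 0 < ∫ x, f x

/-- The integrand `(1/p) h_g^p h_f^{1-p} f` of the first variation, at the gradient of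
`-log f`. -/
def variationDensity (p : ℝ) (f η k : E n → ℝ) (x : E n) : ℝ≥0∞ :=
  ENNReal.ofReal (1 / p) * (ENNReal.ofReal (k (gradNegLog f x)) ^ p
    * (ENNReal.ofReal (η (gradNegLog f x)) ^ (1 - p) * ENNReal.ofReal (f x)))

namespace DualData

variable {f : E n → ℝ} {S : Set (E n)} {η : E n → ℝ}

theorem nonempty (D : DualData f S η) : S.Nonempty := ⟨0, D.zero_mem⟩

theorem f_nonneg (D : DualData f S η) (x : E n) : 0 ≤ f x := D.eq ▸ env_nonneg _ _ _

theorem measurable_f (D : DualData f S η) : Measurable f := D.eq ▸ measurable_env D.nonempty _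

theorem integrable_lpSum (D : DualData f S η) {p : ℝ} (hp : 1 ≤ p) (A : E n →L[ℝ] E n) {t : ℝ}
    (ht : 0 ≤ t) : Integrable (env S (lpSum p t η (halfSq A))) := by
  obtain ⟨δ, hδ, M, hM⟩ := D.ball
  refine integrable_env D.nonempty (δ := δ)
    (M := (M ^ p + t * ((‖A‖ * δ) ^ 2 / 2) ^ p) ^ (1 / p)) hδ fun y hy => ⟨(hM y hy).1, ?_⟩
  have h1 := D.nonneg y
  have h2 := (hM y hy).2
  have h3 : 0 ≤ M := h1.trans h2
  have h4 := halfSq_nonneg A y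
  have h5 : halfSq A y ≤ (‖A‖ * δ) ^ 2 / 2 := by
    unfold halfSq
    gcongr
    exact (A.le_opNorm y).trans (by gcongr)
  unfold lpSum
  gcongr

theorem integrable_f (D : DualData f S η) : Integrable f := by
  obtain ⟨δ, hδ, M, hM⟩ := D.ball
  rw [D.eq]
  exact integrable_env D.nonempty hδ hM

theorem le_env_lpSum (D : DualData f S η) {p : ℝ} (hp : 1 ≤ p) (A : E n →L[ℝ] E n) {t : ℝ}
    (ht : 0 ≤ t) (x : E n) : f x ≤ env S (lpSum p t η (halfSq A)) x := by
  rw [D.eq]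
  refine env_mono D.nonempty (fun y _ => ?_) x
  rw [← lpSum_zero (p := p) (k := halfSq A) hp (D.nonneg y)]
  have h1 := D.nonneg y
  have h4 := halfSq_nonneg A y
  unfold lpSum
  gcongr

/-- Comparison of the perturbed function with translates of `f`. -/
theorem rpow_le_env_lpSum (D : DualData f S η) {p : ℝ} (hp : 1 ≤ p) (A : E n →L[ℝ] E n) {t l : ℝ}
    (ht : 0 ≤ t) (hl : 0 < l) (x y₀ : E n) :
    (f (x - (t * l ^ (p - 1)) • A.adjoint (A y₀)) *
        Real.exp (-(t * l ^ (p - 1) * halfSq A y₀))) ^ ((1 + t * l ^ p) ^ (1 / p - 1))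
      ≤ env S (lpSum p t η (halfSq A)) ((1 + t * l ^ p) ^ (1 / p - 1) • x) := by
  set c := (1 + t * l ^ p) ^ (1 / p - 1) with hc
  set s := t * l ^ (p - 1) with hs
  have hc0 : 0 < c := by positivity
  have hs0 : 0 ≤ s := by positivity
  refine le_env D.nonempty fun y hy => ?_
  have h1 : c * (η y + s * halfSq A y) ≤ lpSum p t η (halfSq A) y :=
    weighted_sum_le_lp hp (D.nonneg y) (halfSq_nonneg A y) ht hl
  -- The quadratic form lies above its tangent plane at y₀. An affine perturbation of η only
  -- translates f and multiplies it by a constant.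
  have h2 : inner ℝ (A.adjoint (A y₀)) y - halfSq A y₀ ≤ halfSq A y := by
    rw [ContinuousLinearMap.adjoint_inner_left]
    unfold halfSq
    have := norm_sub_sq_real (A y₀) (A y)
    nlinarith [sq_nonneg (‖A y₀ - A y‖)]
  have h3 : f (x - s • A.adjoint (A y₀))
      ≤ Real.exp (η y - inner ℝ (x - s • A.adjoint (A y₀)) y) := by
    conv_lhs => rw [D.eq]
    exact env_le η _ hy
  calc (f (x - s • A.adjoint (A y₀)) * Real.exp (-(s * halfSq A y₀))) ^ c
      ≤ (Real.exp (η y - inner ℝ (x - s • A.adjoint (A y₀)) y)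
          * Real.exp (-(s * halfSq A y₀))) ^ c := by
        have := D.f_nonneg (x - s • A.adjoint (A y₀))
        gcongr
    _ = Real.exp (c * (η y + s * (inner ℝ (A.adjoint (A y₀)) y - halfSq A y₀) - inner ℝ x y)) := by
        rw [← Real.exp_add, ← Real.exp_mul, inner_sub_left, inner_smul_left]
        congr 1
        simp only [conj_trivial]
        ring
    _ ≤ _ := by
        refine Real.exp_le_exp.2 ?_
        rw [inner_smul_left]
        simp only [conj_trivial]
        have := mul_le_mul_of_nonneg_left h2 (mul_nonneg hc0.le hs0)
        nlinarith

/-- A lower bound for the perturbed function that is differentiable in the parameter. -/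
theorem exists_hasDerivAt_le_env (D : DualData f S η) {p : ℝ} (hp : 1 ≤ p) (A : E n →L[ℝ] E n)
    {l : ℝ} (hl : 0 < l) {x : E n} (hx : 0 < f x)
    (hd : DifferentiableAt ℝ (fun z => -Real.log (f z)) x) (hnear : ∀ᶠ z in 𝓝 x, 0 < f z)
    (hη : η (gradNegLog f x) = inner ℝ x (gradNegLog f x) + Real.log (f x)) :
    ∃ ρ : ℝ → ℝ, (∀ᶠ t in 𝓝[>] 0, ρ t ≤ env S (lpSum p t η (halfSq A)) x) ∧ ρ 0 = f x ∧
      HasDerivAt ρ (f x * (l ^ (p - 1) * halfSq A (gradNegLog f x)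
        - (1 - 1 / p) * l ^ p * η (gradNegLog f x))) 0 := by
  set y₀ := gradNegLog f x with hy₀
  set z := A.adjoint (A y₀) with hz
  set c : ℝ → ℝ := fun t => (1 + t * l ^ p) ^ (1 / p - 1) with hc
  set U : E n → ℝ := fun z => -Real.log (f z) with hU
  have hc0 : c 0 = 1 := by simp [hc]
  have hdc : HasDerivAt c ((1 / p - 1) * l ^ p) 0 := by
    have h1 : HasDerivAt (fun t : ℝ => 1 + t * l ^ p) (l ^ p) 0 := by
      simpa using ((hasDerivAt_id (0 : ℝ)).mul_const (l ^ p)).const_add 1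
    refine (h1.rpow_const (p := 1 / p - 1) (Or.inl (by simp))).congr_deriv ?_
    simp
    ring
  -- The factor (c t)⁻¹ undoes the dilation in `rpow_le_env_lpSum`, so that the perturbed function
  -- is evaluated at x itself; z is the translation for the tangent plane at the gradient of -log f.
  set γ : ℝ → E n := fun t => (c t)⁻¹ • x - (t * l ^ (p - 1)) • z with hγ
  have hγ0 : γ 0 = x := by simp [hγ, hc0]
  have hdγ : HasDerivAt γ (((1 - 1 / p) * l ^ p) • x - l ^ (p - 1) • z) 0 := by
    have h1 : HasDerivAt (fun t => (c t)⁻¹) ((1 - 1 / p) * l ^ p) 0 := by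
      refine (hdc.inv (by simp [hc0])).congr_deriv ?_
      rw [hc0]; ring
    have h2 : HasDerivAt (fun t : ℝ => t * l ^ (p - 1)) (l ^ (p - 1)) 0 := by
      simpa using (hasDerivAt_id (0 : ℝ)).mul_const (l ^ (p - 1))
    exact (h1.smul_const x).sub (h2.smul_const z)
  have hgrad : HasFDerivAt U (innerSL ℝ y₀) (γ 0) := by
    rw [hγ0]
    have := hd.hasGradientAt
    rw [hasGradientAt_iff_hasFDerivAt] at this
    exact this
  have hdU : HasDerivAt (fun t => U (γ t))
      (inner ℝ y₀ (((1 - 1 / p) * l ^ p) • x - l ^ (p - 1) • z)) 0 :=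
    hgrad.comp_hasDerivAt 0 hdγ
  have h2 : HasDerivAt (fun t : ℝ => t * l ^ (p - 1) * halfSq A y₀)
      (l ^ (p - 1) * halfSq A y₀) 0 := by
    simpa [mul_assoc] using (hasDerivAt_id (0 : ℝ)).mul_const (l ^ (p - 1) * halfSq A y₀)
  have hin : inner ℝ y₀ z = 2 * halfSq A y₀ := by
    rw [hz, ContinuousLinearMap.adjoint_inner_right, real_inner_self_eq_norm_sq, halfSq]; ring
  refine ⟨fun t => Real.exp (-(c t * (U (γ t) + t * l ^ (p - 1) * halfSq A y₀))), ?_, ?_, ?_⟩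
  · have hcont : Tendsto γ (𝓝[>] 0) (𝓝 x) := by
      have := hdγ.continuousAt.tendsto
      rw [hγ0] at this
      exact this.mono_left nhdsWithin_le_nhds
    filter_upwards [hcont.eventually hnear, self_mem_nhdsWithin] with t ht ht0
    have ht0' : (0 : ℝ) < t := ht0
    have hct : 0 < c t := by simp only [hc]; positivity
    have := D.rpow_le_env_lpSum hp A ht0'.le hl ((c t)⁻¹ • x) y₀
    rw [smul_smul, mul_inv_cancel₀ hct.ne', one_smul] at this
    refine le_trans (le_of_eq ?_) this
    change _ = (f (γ t) * _) ^ c t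
    rw [← Real.exp_log ht, ← Real.exp_add, ← Real.exp_mul]
    congr 1
    simp only [hU]
    ring
  · simp only [hc0, hγ0, hU]
    simp [Real.exp_log hx]
  · refine ((hdc.mul (hdU.add h2)).neg).exp.congr_deriv ?_
    simp only [Pi.add_apply, Pi.mul_apply, Pi.neg_apply, hc0, hγ0, hU]
    simp only [zero_mul, add_zero, one_mul, neg_neg, Real.exp_log hx]
    rw [inner_sub_right, inner_smul_right, inner_smul_right, hin, real_inner_comm, hη]
    ring

end DualData

theorem measurable_gradient (g : E n → ℝ) : Measurable (gradient g) :=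
  (InnerProductSpace.toDual ℝ (E n)).symm.continuous.measurable.comp (measurable_fderiv ℝ g)

theorem measurable_gradNegLog (f : E n → ℝ) : Measurable (gradNegLog f) :=
  measurable_gradient _

theorem continuous_halfSq (A : E n →L[ℝ] E n) : Continuous (halfSq A) := by
  unfold halfSq; fun_prop

/-- The sequence `1 / (j + 1)`. -/
def stepSeq (j : ℕ) : ℝ := 1 / ((j : ℝ) + 1)

theorem stepSeq_pos (j : ℕ) : 0 < stepSeq j := by unfold stepSeq; positivity

theorem tendsto_stepSeq : Tendsto stepSeq atTop (𝓝[>] 0) :=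
  tendsto_nhdsWithin_iff.2 ⟨tendsto_one_div_add_atTop_nhds_zero_nat,
    Eventually.of_forall stepSeq_pos⟩

theorem tendsto_quotient_of_hasDerivAt {ρ : ℝ → ℝ} {r : ℝ} (h : HasDerivAt ρ r 0) :
    Tendsto (fun t => (ρ t - ρ 0) / t) (𝓝[>] 0) (𝓝 r) := by
  have := (hasDerivAt_iff_tendsto_slope.1 h).mono_left
    (nhdsWithin_mono 0 (fun t (ht : 0 < t) => ht.ne'))
  refine this.congr fun t => ?_
  rw [slope_def_field, sub_zero]

/-- `(1/p) k^p h^{1-p}` is the supremum of its tangent lines. -/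
theorem density_le_of_forall {p k h r : ℝ} (hp : 1 ≤ p) (hk : 0 ≤ k) (hh : 0 ≤ h) (hr : 0 < r)
    {L : ℝ≥0∞}
    (hL : ∀ l : ℝ, 0 < l → ENNReal.ofReal (r * (l ^ (p - 1) * k - (1 - 1 / p) * l ^ p * h)) ≤ L) :
    ENNReal.ofReal (1 / p) * (ENNReal.ofReal k ^ p * (ENNReal.ofReal h ^ (1 - p)
      * ENNReal.ofReal r)) ≤ L := by
  have hp0 : 0 < p := by linarith
  rcases hk.eq_or_lt with rfl | hk
  · simp [hp0]
  rcases hh.eq_or_lt with rfl | hh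
  · rcases hp.eq_or_lt with rfl | hp1
    · have := hL 1 one_pos
      simpa [mul_comm r, ENNReal.ofReal_mul hk.le] using this
    · suffices L = ∞ by simp [this]
      refine ENNReal.eq_top_of_forall_nnreal_le fun N => ?_
      have hq : 0 < p - 1 := by linarith
      -- For h = 0 and p > 1 the tangent value r l^{p-1} k is unbounded in l; this l makes it N + 1.
      set l := ((((N : ℝ) + 1) / (r * k)) ^ (1 / (p - 1)) : ℝ) with hl
      have h2 := hL l (by positivity)
      have h3 : l ^ (p - 1) = ((N : ℝ) + 1) / (r * k) := by
        rw [hl, ← Real.rpow_mul (by positivity), one_div_mul_cancel hq.ne', Real.rpow_one]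
      rw [h3] at h2
      have h4 : r * (((N : ℝ) + 1) / (r * k) * k - (1 - 1 / p) * l ^ p * 0) = N + 1 := by
        field_simp; ring
      rw [h4] at h2
      refine le_trans ?_ h2
      rw [← ENNReal.ofReal_coe_nnreal]
      exact ENNReal.ofReal_le_ofReal (by linarith)
  -- l = k/h maximizes the tangent value.
  · have h1 := hL (k / h) (by positivity)
    refine le_trans (le_of_eq ?_) h1
    rw [ENNReal.ofReal_rpow_of_pos hk, ENNReal.ofReal_rpow_of_pos hh, ← ENNReal.ofReal_mul
      (by positivity), ← ENNReal.ofReal_mul (by positivity), ← ENNReal.ofReal_mul (by positivity)]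
    congr 1
    rw [Real.div_rpow hk.le hh.le, Real.div_rpow hk.le hh.le, Real.rpow_sub hk, Real.rpow_sub hh,
      Real.rpow_sub hh, Real.rpow_one, Real.rpow_one]
    field_simp
    ring

theorem measurable_variationDensity {f η k : E n → ℝ} (hf : Measurable f) (hη : Measurable η)
    (hk : Measurable k) (p : ℝ) : Measurable (variationDensity p f η k) := by
  have hg := measurable_gradNegLog f
  unfold variationDensity
  exact ((((hk.comp hg).ennreal_ofReal.pow_const p)).mul
    (((hη.comp hg).ennreal_ofReal.pow_const (1 - p)).mul hf.ennreal_ofReal)).const_mul _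

namespace DualData

variable {f : E n → ℝ} {S : Set (E n)} {η : E n → ℝ}

/-- The integral formula is a lower bound for the first variation. -/
theorem lintegral_variationDensity_le (D : DualData f S η) {p : ℝ} (hp : 1 ≤ p)
    (A : E n →L[ℝ] E n) {d : ℝ}
    (hd : Tendsto (fun t => ((∫ x, env S (lpSum p t η (halfSq A)) x) - ∫ x, f x) / t)
      (𝓝[>] 0) (𝓝 d)) :
    ∫⁻ x, variationDensity p f η (halfSq A) x ≤ ENNReal.ofReal d := by
  set F : ℝ → E n → ℝ := fun t => env S (lpSum p t η (halfSq A)) with hF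
  have hlim : Tendsto (fun j => ENNReal.ofReal (((∫ x, F (stepSeq j) x) - ∫ x, f x) / stepSeq j))
      atTop (𝓝 (ENNReal.ofReal d)) :=
    (ENNReal.continuous_ofReal.tendsto d).comp (hd.comp tendsto_stepSeq)
  have hint : ∀ j, ∫⁻ x, ENNReal.ofReal ((F (stepSeq j) x - f x) / stepSeq j)
      = ENNReal.ofReal (((∫ x, F (stepSeq j) x) - ∫ x, f x) / stepSeq j) := by
    intro j
    have hi := D.integrable_lpSum hp A (stepSeq_pos j).le
    rw [← integral_sub hi D.integrable_f, ← integral_div]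
    refine (ofReal_integral_eq_lintegral_ofReal ((hi.sub D.integrable_f).div_const _)
      (ae_of_all _ fun x => ?_)).symm
    exact div_nonneg (sub_nonneg.2 (D.le_env_lpSum hp A (stepSeq_pos j).le x)) (stepSeq_pos j).le
  -- Fatou along t = 1/(j+1): the difference quotients are nonnegative, and their lower limit
  -- dominates every tangent value, hence the density.
  calc ∫⁻ x, variationDensity p f η (halfSq A) x
      ≤ ∫⁻ x, liminf (fun j => ENNReal.ofReal ((F (stepSeq j) x - f x) / stepSeq j)) atTop := by
        refine lintegral_mono_ae ?_
        filter_upwards [D.grad] with x hx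
        rcases (D.f_nonneg x).eq_or_lt with h0 | h0
        · simp [variationDensity, ← h0]
        obtain ⟨hd, hnear, hS, hη⟩ := hx h0
        refine density_le_of_forall hp (halfSq_nonneg A _) (D.nonneg _) h0 fun l hl => ?_
        obtain ⟨ρ, hρ, hρ0, hρd⟩ := D.exists_hasDerivAt_le_env hp A hl h0 hd hnear hη
        have h1 : Tendsto (fun j => ENNReal.ofReal ((ρ (stepSeq j) - ρ 0) / stepSeq j)) atTop
            (𝓝 (ENNReal.ofReal _)) :=
          (ENNReal.continuous_ofReal.tendsto _).comp
            ((tendsto_quotient_of_hasDerivAt hρd).comp tendsto_stepSeq)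
        rw [← h1.liminf_eq]
        refine liminf_le_liminf ?_
        filter_upwards [tendsto_stepSeq.eventually hρ] with j hj
        rw [hρ0]
        have := stepSeq_pos j
        gcongr
    _ ≤ liminf (fun j => ∫⁻ x, ENNReal.ofReal ((F (stepSeq j) x - f x) / stepSeq j)) atTop := by
        refine lintegral_liminf_le fun j => ?_
        exact (((measurable_env D.nonempty _).sub D.measurable_f).div_const _).ennreal_ofReal
    _ = ENNReal.ofReal d := by
        simp_rw [hint]
        exact hlim.liminf_eq

end DualData

/-! ### The cut-off family and the upper bound for the first variation. -/

/-- The function `(η^p + t k^p)^{1/p}`, cut off at `η + t N ‖·‖`. -/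
def cutSum (p t N : ℝ) (η k : E n → ℝ) (y : E n) : ℝ := min (lpSum p t η k y) (η y + t * N * ‖y‖)

/-- η^p + t k^p is affine in t, and r ↦ r^{1/p} is concave. -/
theorem lpSum_concave {p s t : ℝ} (hp : 1 ≤ p) (hs : 0 ≤ s) (ht : 0 < t) (hst : s ≤ t)
    {η k : E n → ℝ} {y : E n} (hη : 0 ≤ η y) (hk : 0 ≤ k y) :
    (1 - s / t) * η y + s / t * lpSum p t η k y ≤ lpSum p s η k y := by
  have hp0 : 0 < p := by linarith
  have h1 : s / t ≤ 1 := (div_le_one ht).2 hst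
  have hc := (Real.concaveOn_rpow (p := 1 / p) (by positivity)
    ((div_le_one hp0).2 hp)).2 (mem_Ici.2 (show 0 ≤ η y ^ p by positivity))
    (mem_Ici.2 (show 0 ≤ η y ^ p + t * k y ^ p by positivity))
    (sub_nonneg.2 h1) (show 0 ≤ s / t by positivity) (by ring)
  simp only [smul_eq_mul] at hc
  rw [← Real.rpow_mul hη, mul_one_div_cancel hp0.ne', Real.rpow_one] at hc
  unfold lpSum
  refine hc.trans (le_of_eq ?_)
  congr 1
  field_simp
  ring

/-- The second term of the minimum is affine in t, so the cut-off preserves the concavity that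
Prékopa–Leindler requires. -/
theorem cutSum_concave {p s t N : ℝ} (hp : 1 ≤ p) (hs : 0 ≤ s) (ht : 0 < t) (hst : s ≤ t)
    {η k : E n → ℝ} {y : E n} (hη : 0 ≤ η y) (hk : 0 ≤ k y) :
    (1 - s / t) * η y + s / t * cutSum p t N η k y ≤ cutSum p s N η k y := by
  have h1 : 0 ≤ s / t := by positivity
  refine le_min ?_ ?_
  · refine le_trans ?_ (lpSum_concave hp hs ht hst hη hk)
    gcongr
    exact min_le_left _ _
  · have h2 : cutSum p t N η k y ≤ η y + t * N * ‖y‖ := min_le_right _ _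
    have h3 := mul_le_mul_of_nonneg_left h2 h1
    have h4 : s / t * (η y + t * N * ‖y‖) = s / t * η y + s * N * ‖y‖ := by field_simp
    linarith

namespace DualData

variable {f : E n → ℝ} {S : Set (E n)} {η : E n → ℝ}

theorem le_env_cutSum (D : DualData f S η) {p : ℝ} (hp : 1 ≤ p) (A : E n →L[ℝ] E n) {t N : ℝ}
    (ht : 0 ≤ t) (hN : 0 ≤ N) (x : E n) : f x ≤ env S (cutSum p t N η (halfSq A)) x := by
  rw [D.eq]
  refine env_mono D.nonempty (fun y _ => le_min ?_ ?_) x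
  · have h1 := D.nonneg y
    have h4 := halfSq_nonneg A y
    rw [← lpSum_zero (p := p) (k := halfSq A) hp h1]
    unfold lpSum
    gcongr
  · have : 0 ≤ t * N * ‖y‖ := by positivity
    linarith

theorem env_cutSum_le (D : DualData f S η) (p : ℝ) (A : E n →L[ℝ] E n) (t N : ℝ)
    (x : E n) : env S (cutSum p t N η (halfSq A)) x ≤ env S (lpSum p t η (halfSq A)) x :=
  env_mono D.nonempty (fun _ _ => min_le_left _ _) x

theorem integrable_cutSum (D : DualData f S η) {p : ℝ} (hp : 1 ≤ p) (A : E n →L[ℝ] E n) {t : ℝ}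
    (N : ℝ) (ht : 0 ≤ t) : Integrable (env S (cutSum p t N η (halfSq A))) := by
  refine (D.integrable_lpSum hp A ht).mono' (measurable_env D.nonempty _).aestronglyMeasurable
    (ae_of_all _ fun x => ?_)
  rw [Real.norm_of_nonneg (env_nonneg _ _ _)]
  exact D.env_cutSum_le p A t N x

/-- Where the cut-off is active and ‖x‖ ≤ tN, the exponent η + tN‖y‖ - ⟨x, y⟩ is nonnegative, while
the envelope never exceeds 1. The cut-off is therefore invisible on a ball that exhausts the space
as N → ∞. -/
theorem env_cutSum_eq (D : DualData f S η) {p : ℝ} (hp : 1 ≤ p) (A : E n →L[ℝ] E n) {t N : ℝ}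
    {x : E n} (hx : ‖x‖ ≤ t * N) :
    env S (cutSum p t N η (halfSq A)) x = env S (lpSum p t η (halfSq A)) x := by
  have hp0 : p ≠ 0 := by linarith
  refine le_antisymm (D.env_cutSum_le p A t N x) (le_env D.nonempty fun y hy => ?_)
  rcases min_choice (lpSum p t η (halfSq A) y) (η y + t * N * ‖y‖) with h | h
  · rw [cutSum, h]; exact env_le _ x hy
  · rw [cutSum, h]
    refine (env_le_one D.zero_mem ?_ x).trans (Real.one_le_exp ?_)
    · simp [lpSum, D.zero, halfSq, hp0]
    · have h1 := real_inner_le_norm x y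
      have h2 := mul_le_mul_of_nonneg_right hx (norm_nonneg y)
      linarith [D.nonneg y]

/-- The supremal convolution with a ball is dominated by the quadratic perturbation. -/
theorem env_add_norm_le (D : DualData f S η) {p : ℝ} (hp : 1 ≤ p) (A : E n →L[ℝ] E n)
    {t M e : ℝ} (ht : 0 ≤ t) (he : 0 ≤ e)
    (hMe : ∀ y : E n, M * ‖y‖ ≤ t * halfSq A y + e) (x : E n) :
    env S (fun y => η y + M * ‖y‖) x
      ≤ Real.exp e * env S (lpSum p t η (halfSq A)) ((1 + t) ^ (1 / p - 1) • x) := by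
  have hp0 : 0 < p := by linarith
  set c := (1 + t) ^ (1 / p - 1) with hc
  have hc0 : 0 < c := by positivity
  have hc1 : c ≤ 1 := Real.rpow_le_one_of_one_le_of_nonpos (by linarith)
    (by rw [sub_nonpos, div_le_one hp0]; exact hp)
  set X := Real.exp (-e) * env S (fun y => η y + M * ‖y‖) x with hX
  have hX0 : 0 ≤ X := mul_nonneg (by positivity) (env_nonneg _ _ _)
  have hX1 : X ≤ 1 := mul_le_one₀ (Real.exp_le_one_iff.2 (by linarith)) (env_nonneg _ _ _)
    (env_le_one D.zero_mem (by simp [D.zero]) x)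
  suffices X ≤ env S (lpSum p t η (halfSq A)) (c • x) by
    rw [hX] at this
    calc env S (fun y => η y + M * ‖y‖) x
        = Real.exp e * (Real.exp (-e) * env S (fun y => η y + M * ‖y‖) x) := by
          rw [← mul_assoc, ← Real.exp_add]; simp
      _ ≤ _ := by gcongr
  refine le_env D.nonempty fun y hy => ?_
  have h1 : c * (η y + t * halfSq A y) ≤ lpSum p t η (halfSq A) y := by
    have := weighted_sum_le_lp hp (D.nonneg y) (halfSq_nonneg A y) ht one_pos
    rwa [Real.one_rpow, Real.one_rpow, mul_one] at this
  -- X ≤ 1 and 0 < c ≤ 1, so the power only increases X.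
  calc X ≤ X ^ c := by
        rcases hX0.eq_or_lt with h | h
        · rw [← h, Real.zero_rpow hc0.ne']
        · exact (Real.rpow_one X).symm.le.trans (Real.rpow_le_rpow_of_exponent_ge h hX1 hc1)
    _ ≤ (Real.exp (-e) * Real.exp (η y + M * ‖y‖ - inner ℝ x y)) ^ c := by
        have : X ≤ Real.exp (-e) * Real.exp (η y + M * ‖y‖ - inner ℝ x y) := by
          rw [hX]; gcongr; exact env_le (fun y => η y + M * ‖y‖) x hy
        gcongr
    _ = Real.exp (c * (η y + M * ‖y‖ - e - inner ℝ x y)) := by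
        rw [← Real.exp_add, ← Real.exp_mul]; congr 1; ring
    _ ≤ _ := by
        refine Real.exp_le_exp.2 ?_
        rw [inner_smul_left]
        simp only [conj_trivial]
        have := mul_le_mul_of_nonneg_left (hMe y) hc0.le
        nlinarith

theorem le_env_lpSum_smul (D : DualData f S η) {p : ℝ} (hp : 1 ≤ p) (A : E n →L[ℝ] E n)
    {t : ℝ} (ht : 0 ≤ t) (x : E n) :
    f x ≤ env S (lpSum p t η (halfSq A)) ((1 + t) ^ (1 / p - 1) • x) := by
  have := D.env_add_norm_le hp A (M := 0) (e := 0) ht le_rfl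
    (fun y => by have := halfSq_nonneg A y; nlinarith [mul_nonneg ht this]) x
  simpa [← D.eq] using this

end DualData

/-- The right derivative at `0` of `t ↦ exp((h^p + t k^p)^{1/p} - h)`. -/
theorem exists_tendsto_exp_quotient {p k h r : ℝ} (hp : 1 ≤ p) (hk : 0 ≤ k) (hh : 0 ≤ h)
    (hr : 0 < r)
    (hfin : ENNReal.ofReal (1 / p) * (ENNReal.ofReal k ^ p * (ENNReal.ofReal h ^ (1 - p)
      * ENNReal.ofReal r)) ≠ ∞) :
    ∃ q : ℝ, 0 ≤ q ∧ ENNReal.ofReal (1 / p) * (ENNReal.ofReal k ^ p * (ENNReal.ofReal h ^ (1 - p)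
      * ENNReal.ofReal r)) = ENNReal.ofReal (r * q) ∧
      Tendsto (fun t => (Real.exp ((h ^ p + t * k ^ p) ^ (1 / p) - h) - 1) / t)
        (𝓝[>] 0) (𝓝 q) := by
  have hp0 : 0 < p := by linarith
  have hpp : (h ^ p) ^ (1 / p) = h := by
    rw [← Real.rpow_mul hh, mul_one_div_cancel hp0.ne', Real.rpow_one]
  rcases hk.eq_or_lt with rfl | hk
  · refine ⟨0, le_rfl, by simp [hp0], ?_⟩
    simp only [Real.zero_rpow hp0.ne', mul_zero, add_zero, hpp, sub_self, Real.exp_zero, zero_div]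
    exact tendsto_const_nhds
  have key : ∀ {g : ℝ → ℝ} {q : ℝ}, HasDerivAt g q 0 → g 0 = 0 →
      Tendsto (fun t => (Real.exp (g t) - 1) / t) (𝓝[>] 0) (𝓝 q) := by
    intro g q hg hg0
    have := tendsto_quotient_of_hasDerivAt hg.exp
    simpa [hg0] using this
  rcases hp.eq_or_lt with rfl | hp1
  · refine ⟨k, hk.le, by simp [ENNReal.ofReal_mul hr.le, mul_comm (ENNReal.ofReal k)], key ?_ (by simp)⟩
    have := (hasDerivAt_id (0 : ℝ)).mul_const k
    simpa using this
  -- If h = 0 < k and p > 1 the density is infinite, which `hfin` excludes; this is the only case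
  -- without a finite right derivative.
  rcases hh.eq_or_lt with rfl | hh
  · exfalso
    apply hfin
    rw [ENNReal.ofReal_zero, ENNReal.zero_rpow_of_neg (by linarith),
      ENNReal.top_mul (by simpa using hr), ENNReal.mul_top, ENNReal.mul_top]
    · simpa using hp0
    · rw [Ne, ENNReal.rpow_eq_zero_iff]
      simp [hk]
  · refine ⟨1 / p * (k ^ p * h ^ (1 - p)), by positivity, ?_, key ?_ ?_⟩
    · rw [ENNReal.ofReal_rpow_of_pos hk, ENNReal.ofReal_rpow_of_pos hh, ← ENNReal.ofReal_mul
        (by positivity), ← ENNReal.ofReal_mul (by positivity), ← ENNReal.ofReal_mul (by positivity)]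
      congr 1; ring
    · have h1 : HasDerivAt (fun t : ℝ => h ^ p + t * k ^ p) (k ^ p) 0 := by
        simpa using ((hasDerivAt_id (0 : ℝ)).mul_const (k ^ p)).const_add (h ^ p)
      have hne : h ^ p ≠ 0 := by positivity
      refine ((h1.rpow_const (p := 1 / p) (Or.inl (by simpa using hne))).sub_const h).congr_deriv ?_
      rw [zero_mul, add_zero, ← Real.rpow_mul hh.le]
      have : p * (1 / p - 1) = 1 - p := by field_simp
      rw [this]; ring
    · simp only [zero_mul, add_zero, hpp, sub_self]

/-- The exponential comparison factor `e^{ct} (1+Kt)^{n(1-1/p)}` has the expected first-order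
expansion against `J(K t)`. -/
theorem tendsto_comparison_quotient {J : ℝ → ℝ} {J₀ d : ℝ} {K : ℝ} (hK : 0 < K) (c p : ℝ) (n : ℕ)
    (hd : Tendsto (fun t => (J t - J₀) / t) (𝓝[>] 0) (𝓝 d)) :
    Tendsto (fun t => (Real.exp (c * t) * ((((1 + K * t) ^ (1 / p - 1)) ^ n)⁻¹ * J (K * t)) - J₀) / t)
      (𝓝[>] 0) (𝓝 (c * J₀ + K * (n * (1 - 1 / p) * J₀ + d))) := by
  set g : ℝ → ℝ := fun t => Real.exp (c * t) * (((1 + K * t) ^ (1 / p - 1)) ^ n)⁻¹ with hg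
  have hg0 : g 0 = 1 := by simp [hg]
  have hgd : HasDerivAt g (c + K * (n * (1 - 1 / p))) 0 := by
    have h1 : HasDerivAt (fun t : ℝ => Real.exp (c * t)) c 0 := by
      simpa using ((hasDerivAt_id (0 : ℝ)).const_mul c).exp
    have h2 : HasDerivAt (fun t : ℝ => 1 + K * t) K 0 := by
      simpa using ((hasDerivAt_id (0 : ℝ)).const_mul K).const_add 1
    have h3 := ((h2.rpow_const (p := 1 / p - 1) (Or.inl (by simp))).pow n).inv (by simp)
    refine (h1.mul h3).congr_deriv ?_
    simp
    ring
  have hq := tendsto_quotient_of_hasDerivAt hgd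
  have hgc : Tendsto g (𝓝[>] 0) (𝓝 1) := by
    have := hgd.continuousAt.tendsto
    rw [hg0] at this
    exact this.mono_left nhdsWithin_le_nhds
  have hKt : Tendsto (fun t : ℝ => K * t) (𝓝[>] 0) (𝓝[>] 0) := by
    refine tendsto_nhdsWithin_iff.2 ⟨?_, ?_⟩
    · have : Tendsto (fun t : ℝ => K * t) (𝓝 0) (𝓝 (K * 0)) := tendsto_id.const_mul K
      rw [mul_zero] at this
      exact this.mono_left nhdsWithin_le_nhds
    · filter_upwards [self_mem_nhdsWithin] with t ht
      exact mul_pos hK ht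
  have hl := (hq.mul_const J₀).add ((hgc.mul_const K).mul (hd.comp hKt))
  have e : (c + K * (n * (1 - 1 / p))) * J₀ + 1 * K * d
      = c * J₀ + K * (n * (1 - 1 / p) * J₀ + d) := by ring
  rw [e] at hl
  refine hl.congr' ?_
  filter_upwards [self_mem_nhdsWithin] with t ht
  have ht' : t ≠ 0 := (show (0 : ℝ) < t from ht).ne'
  simp only [Function.comp, hg0]
  simp only [hg]
  field_simp
  ring

namespace DualData

variable {f : E n → ℝ} {S : Set (E n)} {η : E n → ℝ}

/-- An upper bound for a limit of integrals needs a majorant. Here it is e^{c't} F_{Kt}(c(Kt)x),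
whose mass has a known first-order expansion because the first variation `d` is finite. Fatou's
lemma is applied to the nonnegative difference quotient Θ of the majorant and the cut-off function;
the error left over is proportional to K. -/
theorem slope_le (D : DualData f S η) {p : ℝ} (hp : 1 ≤ p) (A : E n →L[ℝ] E n) {κ : ℝ}
    (hA : ∀ y, ‖y‖ ≤ κ * ‖A y‖) {d : ℝ}
    (hd : Tendsto (fun t => ((∫ x, env S (lpSum p t η (halfSq A)) x) - ∫ x, f x) / t)
      (𝓝[>] 0) (𝓝 d)) {K N t₀ β : ℝ} (hK : 0 < K) (hN : 0 ≤ N) (ht₀ : 0 < t₀)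
    (hβ : ∀ s, 0 < s → s ≤ t₀ →
      β ≤ ((∫ x, env S (cutSum p s N η (halfSq A)) x) - ∫ x, f x) / s) :
    β ≤ (∫⁻ x, variationDensity p f η (halfSq A) x).toReal
      + K * (n * (1 - 1 / p) * (∫ x, f x) + d) := by
  -- Completing the square: Nκr ≤ K r²/2 + c' for r = ‖A y‖.
  set c' := N ^ 2 * κ ^ 2 / (2 * K) with hc'
  have hc'0 : 0 ≤ c' := by positivity
  have hp0 : 0 < p := by linarith
  set J₀ := ∫ x, f x with hJ₀
  set J : ℝ → ℝ := fun t => ∫ x, env S (lpSum p t η (halfSq A)) x with hJ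
  set I := ∫⁻ x, variationDensity p f η (halfSq A) x with hI
  have hIfin : I ≠ ∞ :=
    ((D.lintegral_variationDensity_le hp A hd).trans_lt ENNReal.ofReal_lt_top).ne
  set c : ℝ → ℝ := fun t => (1 + t) ^ (1 / p - 1) with hc
  set F : ℝ → E n → ℝ := fun t => env S (lpSum p t η (halfSq A)) with hF
  set G : ℝ → E n → ℝ := fun t => env S (cutSum p t N η (halfSq A)) with hG
  set X : ℝ → ℝ := fun t => (Real.exp (c' * t) * (((c (K * t)) ^ n)⁻¹ * J (K * t)) - J₀) / t with hX
  have hXlim : Tendsto X (𝓝[>] 0) (𝓝 (c' * J₀ + K * (n * (1 - 1 / p) * J₀ + d))) :=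
    tendsto_comparison_quotient hK c' p n hd
  set L := c' * J₀ + K * (n * (1 - 1 / p) * J₀ + d) with hL
  -- the dominating functions
  have hGle : ∀ t, 0 < t → ∀ x, G t x ≤ Real.exp (c' * t) * F (K * t) (c (K * t) • x) := by
    intro t ht x
    refine le_trans (env_mono D.nonempty (fun y _ => min_le_right _ _) x)
      (D.env_add_norm_le hp A (by positivity) (by positivity) (fun y => ?_) x)
    have h1 := hA y
    have h2 : N * ‖y‖ ≤ K * halfSq A y + c' := by
      have h3 : N * ‖y‖ ≤ N * (κ * ‖A y‖) := by gcongr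
      have h4 : K * halfSq A y + c' - N * (κ * ‖A y‖) = (K * ‖A y‖ - N * κ) ^ 2 / (2 * K) := by
        rw [hc', halfSq]; field_simp; ring
      have h5 : 0 ≤ (K * ‖A y‖ - N * κ) ^ 2 / (2 * K) := by positivity
      linarith
    have := mul_le_mul_of_nonneg_left h2 ht.le
    nlinarith
  have hcpos : ∀ t, 0 ≤ t → 0 < c t := fun t ht => by simp only [hc]; positivity
  have hFi : ∀ t, 0 < t → Integrable fun x => Real.exp (c' * t) * F (K * t) (c (K * t) • x) :=
    fun t ht => ((D.integrable_lpSum hp A (by positivity)).comp_smul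
      (hcpos (K * t) (by positivity)).ne').const_mul _
  have hGi : ∀ t, 0 < t → Integrable (G t) := fun t ht => D.integrable_cutSum hp A N ht.le
  set Θ : ℝ → E n → ℝ := fun t x =>
    (Real.exp (c' * t) * F (K * t) (c (K * t) • x) - G t x) / t with hΘ
  have hΘ0 : ∀ t, 0 < t → ∀ x, 0 ≤ Θ t x := fun t ht x =>
    div_nonneg (sub_nonneg.2 (hGle t ht x)) ht.le
  have hΘint : ∀ t, 0 < t → ∫ x, Θ t x = X t - ((∫ x, G t x) - J₀) / t := by
    intro t ht
    simp only [hΘ]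
    rw [integral_div, integral_sub (hFi t ht) (hGi t ht), integral_const_mul,
      Measure.integral_comp_smul, abs_of_nonneg (by
        have := hcpos (K * t) (by positivity); positivity)]
    simp only [hX, hJ, hF, finrank_euclideanSpace, Fintype.card_fin, smul_eq_mul]
    ring
  have hΘle : ∀ t, 0 < t → t ≤ t₀ → ∫ x, Θ t x ≤ X t - β := fun t ht htt => by
    rw [hΘint t ht]; linarith [hβ t ht htt]
  have hseq : ∀ᶠ j in atTop, stepSeq j ≤ t₀ := by
    have : ∀ᶠ t : ℝ in 𝓝[>] 0, t ≤ t₀ := by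
      filter_upwards [Ioc_mem_nhdsGT ht₀] with t ht using ht.2
    exact tendsto_stepSeq.eventually this
  have hLβ : 0 ≤ L - β := by
    refine ge_of_tendsto ((hXlim.comp tendsto_stepSeq).sub_const β) ?_
    filter_upwards [hseq] with j hj
    exact (integral_nonneg (hΘ0 _ (stepSeq_pos j))).trans (hΘle _ (stepSeq_pos j) hj)
  have hfatou : ∫⁻ x, liminf (fun j => ENNReal.ofReal (Θ (stepSeq j) x)) atTop
      ≤ ENNReal.ofReal (L - β) := by
    refine (lintegral_liminf_le fun j => ?_).trans ?_
    · exact ((((measurable_env D.nonempty _).comp (measurable_const_smul _)).const_mul _ |>.sub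
        (measurable_env D.nonempty _)).div_const _).ennreal_ofReal
    · have h1 : Tendsto (fun j => ENNReal.ofReal (X (stepSeq j) - β)) atTop
          (𝓝 (ENNReal.ofReal (L - β))) :=
        (ENNReal.continuous_ofReal.tendsto _).comp ((hXlim.comp tendsto_stepSeq).sub_const β)
      rw [← h1.liminf_eq]
      refine liminf_le_liminf ?_
      filter_upwards [hseq] with j hj
      have hΘi : Integrable (Θ (stepSeq j)) :=
        ((hFi _ (stepSeq_pos j)).sub (hGi _ (stepSeq_pos j))).div_const _
      rw [← ofReal_integral_eq_lintegral_ofReal hΘi (ae_of_all _ (hΘ0 _ (stepSeq_pos j)))]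
      exact ENNReal.ofReal_le_ofReal (hΘle _ (stepSeq_pos j) hj)
  have hmeasVD : Measurable (variationDensity p f η (halfSq A)) :=
    measurable_variationDensity D.measurable_f D.measurable (continuous_halfSq A).measurable p
  -- The majorant is at least e^{c't} f(x), and testing the cut-off envelope at the gradient of -log
  -- f bounds its quotient by one converging to the density.
  have hpt : ∀ᵐ x, ENNReal.ofReal (c' * f x)
      ≤ liminf (fun j => ENNReal.ofReal (Θ (stepSeq j) x)) atTop
        + variationDensity p f η (halfSq A) x := by
    filter_upwards [D.grad, ae_lt_top hmeasVD hIfin] with x hx hxfin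
    rcases (D.f_nonneg x).eq_or_lt with h0 | h0
    · simp [← h0]
    obtain ⟨-, -, hyS, hη⟩ := hx h0
    set y := gradNegLog f x with hy
    obtain ⟨q, hq0, hqe, hq⟩ := exists_tendsto_exp_quotient hp (halfSq_nonneg A y) (D.nonneg y) h0
      hxfin.ne
    have hlow : Tendsto (fun t => f x * ((Real.exp (c' * t) - 1) / t
        - (Real.exp (lpSum p t η (halfSq A) y - η y) - 1) / t)) (𝓝[>] 0) (𝓝 (f x * (c' - q))) := by
      refine Tendsto.const_mul _ (Tendsto.sub ?_ hq)
      have h1 : HasDerivAt (fun t : ℝ => Real.exp (c' * t)) c' 0 := by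
        simpa using ((hasDerivAt_id (0 : ℝ)).const_mul c').exp
      simpa using tendsto_quotient_of_hasDerivAt h1
    have hle : ∀ t, 0 < t → f x * ((Real.exp (c' * t) - 1) / t
        - (Real.exp (lpSum p t η (halfSq A) y - η y) - 1) / t) ≤ Θ t x := by
      intro t ht
      have h1 : f x ≤ F (K * t) (c (K * t) • x) := D.le_env_lpSum_smul hp A (by positivity) x
      have h2 : G t x ≤ Real.exp (lpSum p t η (halfSq A) y - η y) * f x := by
        refine (D.env_cutSum_le p A t N x).trans ((env_le _ x hyS).trans (le_of_eq ?_))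
        conv_rhs => rw [← Real.exp_log h0, ← Real.exp_add]
        congr 1
        linarith
      have h3 : Real.exp (c' * t) * f x ≤ Real.exp (c' * t) * F (K * t) (c (K * t) • x) := by gcongr
      simp only [hΘ]
      rw [← sub_div, ← mul_div_assoc]
      gcongr
      linarith
    have hlim := (ENNReal.continuous_ofReal.tendsto _).comp (hlow.comp tendsto_stepSeq)
    have h4 : ENNReal.ofReal (f x * (c' - q))
        ≤ liminf (fun j => ENNReal.ofReal (Θ (stepSeq j) x)) atTop := by
      rw [← hlim.liminf_eq]
      exact liminf_le_liminf (Eventually.of_forall fun j =>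
        ENNReal.ofReal_le_ofReal (hle _ (stepSeq_pos j)))
    calc ENNReal.ofReal (c' * f x) = ENNReal.ofReal (f x * (c' - q) + f x * q) := by
          congr 1; ring
      _ ≤ ENNReal.ofReal (f x * (c' - q)) + ENNReal.ofReal (f x * q) := ENNReal.ofReal_add_le
      _ ≤ _ := by
          refine add_le_add h4 (le_of_eq ?_)
          rw [← hqe]; rfl
  -- L contains the same term c' J₀, so it cancels; the growth of c' as K → 0 is therefore harmless.
  have hfinal : ENNReal.ofReal (c' * J₀) ≤ ENNReal.ofReal (L - β) + I := by
    calc ENNReal.ofReal (c' * J₀) = ∫⁻ x, ENNReal.ofReal (c' * f x) := by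
          rw [hJ₀, ← integral_const_mul]
          exact ofReal_integral_eq_lintegral_ofReal (D.integrable_f.const_mul _)
            (ae_of_all _ fun x => mul_nonneg hc'0 (D.f_nonneg x))
      _ ≤ ∫⁻ x, (liminf (fun j => ENNReal.ofReal (Θ (stepSeq j) x)) atTop
          + variationDensity p f η (halfSq A) x) := lintegral_mono_ae hpt
      _ = (∫⁻ x, liminf (fun j => ENNReal.ofReal (Θ (stepSeq j) x)) atTop) + I :=
          lintegral_add_right _ hmeasVD
      _ ≤ _ := by gcongr
  rw [← ENNReal.ofReal_toReal hIfin, ← ENNReal.ofReal_add hLβ ENNReal.toReal_nonneg,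
    ENNReal.ofReal_le_ofReal_iff (by positivity)] at hfinal
  rw [hL] at hfinal
  linarith

theorem integral_le_integral_cutSum (D : DualData f S η) {p : ℝ} (hp : 1 ≤ p) (A : E n →L[ℝ] E n)
    {t N : ℝ} (ht : 0 ≤ t) (hN : 0 ≤ N) :
    ∫ x, f x ≤ ∫ x, env S (cutSum p t N η (halfSq A)) x :=
  integral_mono D.integrable_f (D.integrable_cutSum hp A N ht) (D.le_env_cutSum hp A ht hN)

/-- Difference quotients of the logarithm of the total mass are dominated by earlier difference
quotients of the total mass. -/
theorem log_quotient_le (D : DualData f S η) {p : ℝ} (hp : 1 ≤ p) (A : E n →L[ℝ] E n)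
    {s t N : ℝ} (hs : 0 < s) (hst : s ≤ t) (hN : 0 ≤ N) :
    (Real.log (∫ x, env S (cutSum p t N η (halfSq A)) x) - Real.log (∫ x, f x)) / t * ∫ x, f x
      ≤ ((∫ x, env S (cutSum p s N η (halfSq A)) x) - ∫ x, f x) / s := by
  have ht : 0 < t := hs.trans_le hst
  set J₀ := ∫ x, f x with hJ₀
  set J : ℝ → ℝ := fun t => ∫ x, env S (cutSum p t N η (halfSq A)) x with hJ
  have hpos : 0 < J₀ := D.pos
  have hJpos : ∀ t, 0 ≤ t → 0 < J t := fun t ht =>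
    hpos.trans_le (D.integral_le_integral_cutSum hp A ht hN)
  -- Concavity of log J on the chord from 0 to t, from Prékopa–Leindler.
  have hconc : (1 - s / t) * Real.log J₀ + s / t * Real.log (J t) ≤ Real.log (J s) := by
    rcases hst.eq_or_lt with rfl | hst'
    · simp [hs.ne']
    have hH : ∀ y ∈ S, (1 - s / t) * η y + s / t * cutSum p t N η (halfSq A) y
        ≤ cutSum p s N η (halfSq A) y := fun y _ =>
      cutSum_concave hp hs.le ht hst (D.nonneg y) (halfSq_nonneg A y)
    have he : ∀ x, env S η x = f x := fun x => by rw [D.eq]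
    have hi0 : Integrable (env S η) := D.eq ▸ D.integrable_f
    have := log_integral_env_concave D.nonempty (sub_pos.2 ((div_lt_one ht).2 hst'))
      (div_pos hs ht) (by ring) hH hi0 (D.integrable_cutSum hp A N ht.le)
      (D.integrable_cutSum hp A N hs.le) (by simpa only [he] using hpos) (hJpos t ht.le)
    simpa only [he] using this
  have hlog : Real.log (J s) - Real.log J₀ ≤ (J s - J₀) / J₀ := by
    rw [← Real.log_div (hJpos s hs.le).ne' hpos.ne']
    refine (Real.log_le_sub_one_of_pos (div_pos (hJpos s hs.le) hpos)).trans (le_of_eq ?_)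
    field_simp
  have h1 : s * ((Real.log (J t) - Real.log J₀) / t) ≤ Real.log (J s) - Real.log J₀ := by
    have : s * ((Real.log (J t) - Real.log J₀) / t)
        = (1 - s / t) * Real.log J₀ + s / t * Real.log (J t) - Real.log J₀ := by ring
    linarith
  have h2 := h1.trans hlog
  rw [le_div_iff₀ hpos] at h2
  rw [le_div_iff₀ hs]
  linarith

/-- Exponential bound of the perturbed mass by the integral formula for the first variation. -/
theorem integral_lpSum_le (D : DualData f S η) {p : ℝ} (hp : 1 ≤ p) (A : E n →L[ℝ] E n) {κ : ℝ}
    (hA : ∀ y, ‖y‖ ≤ κ * ‖A y‖) {d : ℝ}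
    (hd : Tendsto (fun t => ((∫ x, env S (lpSum p t η (halfSq A)) x) - ∫ x, f x) / t)
      (𝓝[>] 0) (𝓝 d)) {t : ℝ} (ht : 0 < t) :
    ∫ x, env S (lpSum p t η (halfSq A)) x ≤ (∫ x, f x)
      * Real.exp (t * ((∫⁻ x, variationDensity p f η (halfSq A) x).toReal / ∫ x, f x)) := by
  set J₀ := ∫ x, f x with hJ₀
  set I := (∫⁻ x, variationDensity p f η (halfSq A) x).toReal with hI
  have hpos : 0 < J₀ := D.pos
  have hcut : ∀ N : ℕ, ∫ x, env S (cutSum p t N η (halfSq A)) x ≤ J₀ * Real.exp (t * (I / J₀)) := by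
    intro N
    set J := ∫ x, env S (cutSum p t N η (halfSq A)) x with hJ
    have hN : (0 : ℝ) ≤ N := Nat.cast_nonneg N
    have hJpos : 0 < J := hpos.trans_le (D.integral_le_integral_cutSum hp A ht.le hN)
    set β := (Real.log J - Real.log J₀) / t * J₀ with hβ
    have h1 : ∀ K : ℝ, 0 < K → β ≤ I + K * (n * (1 - 1 / p) * J₀ + d) := fun K hK =>
      D.slope_le hp A hA hd hK hN ht fun s hs hst => D.log_quotient_le hp A hs hst hN
    -- β does not depend on K, so the error term disappears as K → 0⁺.
    have h2 : β ≤ I := by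
      have hl : Tendsto (fun K : ℝ => I + K * (n * (1 - 1 / p) * J₀ + d)) (𝓝[>] 0) (𝓝 I) := by
        have : Tendsto (fun K : ℝ => I + K * (n * (1 - 1 / p) * J₀ + d)) (𝓝 0)
            (𝓝 (I + 0 * (n * (1 - 1 / p) * J₀ + d))) := (tendsto_id.mul_const _).const_add I
        rw [zero_mul, add_zero] at this
        exact this.mono_left nhdsWithin_le_nhds
      refine ge_of_tendsto hl ?_
      filter_upwards [self_mem_nhdsWithin] with K hK using h1 K hK
    have h3 : Real.log J ≤ Real.log J₀ + t * (I / J₀) := by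
      rw [hβ, ← le_div_iff₀ hpos, div_le_iff₀ ht] at h2
      linarith
    calc J = Real.exp (Real.log J) := (Real.exp_log hJpos).symm
      _ ≤ Real.exp (Real.log J₀ + t * (I / J₀)) := Real.exp_le_exp.2 h3
      _ = _ := by rw [Real.exp_add, Real.exp_log hpos]
  have hlim : Tendsto (fun N : ℕ => ∫ x, env S (cutSum p t N η (halfSq A)) x) atTop
      (𝓝 (∫ x, env S (lpSum p t η (halfSq A)) x)) := by
    refine tendsto_integral_of_dominated_convergence _
      (fun N => (measurable_env D.nonempty _).aestronglyMeasurable)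
      (D.integrable_lpSum hp A ht.le) (fun N => ae_of_all _ fun x => ?_) (ae_of_all _ fun x => ?_)
    · rw [Real.norm_of_nonneg (env_nonneg _ _ _)]
      exact D.env_cutSum_le p A t N x
    · refine tendsto_const_nhds.congr' ?_
      filter_upwards [eventually_ge_atTop ⌈‖x‖ / t⌉₊] with N hN
      refine (D.env_cutSum_eq hp A ?_).symm
      rw [mul_comm, ← div_le_iff₀ ht]
      exact (Nat.le_ceil _).trans (by exact_mod_cast hN)
  exact le_of_tendsto' hlim hcut

/-- The integral formula for the first variation of the total mass along a Gaussian function. -/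
theorem lintegral_variationDensity_eq (D : DualData f S η) {p : ℝ} (hp : 1 ≤ p)
    (A : E n →L[ℝ] E n) {κ : ℝ} (hA : ∀ y, ‖y‖ ≤ κ * ‖A y‖) {d : ℝ}
    (hd : Tendsto (fun t => ((∫ x, env S (lpSum p t η (halfSq A)) x) - ∫ x, f x) / t)
      (𝓝[>] 0) (𝓝 d)) :
    ∫⁻ x, variationDensity p f η (halfSq A) x = ENNReal.ofReal d := by
  have hle := D.lintegral_variationDensity_le hp A hd
  refine le_antisymm hle ?_
  set I := ∫⁻ x, variationDensity p f η (halfSq A) x with hI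
  have hIfin : I ≠ ∞ := (hle.trans_lt ENNReal.ofReal_lt_top).ne
  have hpos : 0 < ∫ x, f x := D.pos
  rw [← ENNReal.ofReal_toReal hIfin]
  refine ENNReal.ofReal_le_ofReal ?_
  set J₀ := ∫ x, f x with hJ₀
  have h1 : HasDerivAt (fun t : ℝ => J₀ * Real.exp (t * (I.toReal / J₀))) I.toReal 0 := by
    have := (((hasDerivAt_id (0 : ℝ)).mul_const (I.toReal / J₀)).exp).const_mul J₀
    refine this.congr_deriv ?_
    simp
    field_simp
  refine le_of_tendsto_of_tendsto hd (tendsto_quotient_of_hasDerivAt h1) ?_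
  filter_upwards [self_mem_nhdsWithin] with t ht
  have ht' : (0 : ℝ) < t := ht
  have := D.integral_lpSum_le hp A hA hd ht'
  simp only [zero_mul, Real.exp_zero, mul_one]
  gcongr

end DualData

/-! ### Rank-one stretches and nondegeneracy of the gradients. -/

/-- The operator `y ↦ y + m ⟨v, y⟩ v`. -/
def stretch (v : E n) (m : ℝ) : E n →L[ℝ] E n :=
  ContinuousLinearMap.id ℝ (E n) + m • (innerSL ℝ v).smulRight v

theorem stretch_apply (v : E n) (m : ℝ) (y : E n) :
    stretch v m y = y + (m * inner ℝ v y) • v := by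
  simp [stretch, smul_smul]

theorem norm_stretch_sq (v : E n) (m : ℝ) (y : E n) :
    ‖stretch v m y‖ ^ 2 = ‖y‖ ^ 2 + (2 * m + m ^ 2 * ‖v‖ ^ 2) * inner ℝ v y ^ 2 := by
  rw [stretch_apply, norm_add_sq_real, norm_smul, inner_smul_right, mul_pow, Real.norm_eq_abs,
    sq_abs, real_inner_comm]
  ring

theorem norm_le_norm_stretch (v : E n) {m : ℝ} (hm : 0 ≤ m) (y : E n) :
    ‖y‖ ≤ ‖stretch v m y‖ := by
  refine (sq_le_sq₀ (norm_nonneg _) (norm_nonneg _)).1 ?_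
  rw [norm_stretch_sq]
  have : 0 ≤ (2 * m + m ^ 2 * ‖v‖ ^ 2) * inner ℝ v y ^ 2 := by positivity
  linarith

theorem adjoint_stretch (v : E n) (m : ℝ) : (stretch v m).adjoint = stretch v m := by
  symm
  rw [ContinuousLinearMap.eq_adjoint_iff]
  intro x y
  rw [stretch_apply, stretch_apply, inner_add_left, inner_add_right, inner_smul_left,
    inner_smul_right, real_inner_comm v x]
  simp only [conj_trivial]
  ring

theorem stretch_self (v : E n) (m : ℝ) : stretch v m v = (1 + m * ‖v‖ ^ 2) • v := by
  rw [stretch_apply, real_inner_self_eq_norm_sq, add_smul, one_smul]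

namespace DualData

variable {f : E n → ℝ} {S : Set (E n)} {η : E n → ℝ}

/-- If all first variations along Gaussian functions are finite, then the gradients of `-log f` are
not contained in a hyperplane. -/
theorem not_ae_inner_gradNegLog_eq_zero (D : DualData f S η) {p : ℝ} (hp : 1 ≤ p)
    (hd : ∀ A : E n →L[ℝ] E n, (∃ κ, ∀ y, ‖y‖ ≤ κ * ‖A y‖) → ∃ d,
      Tendsto (fun t => ((∫ x, env S (lpSum p t η (halfSq A)) x) - ∫ x, f x) / t) (𝓝[>] 0) (𝓝 d))
    {v : E n} (hv : v ≠ 0) : ¬ ∀ᵐ x, 0 < f x → inner ℝ v (gradNegLog f x) = 0 := by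
  intro hzero
  have hp0 : 0 < p := by linarith
  set A : ℕ → E n →L[ℝ] E n := fun m => stretch v m with hA
  have hAm : ∀ m y, ‖y‖ ≤ 1 * ‖A m y‖ := fun m y => by
    rw [one_mul]; exact norm_le_norm_stretch v (Nat.cast_nonneg m) y
  set I : ℕ → ℝ≥0∞ := fun m => ∫⁻ x, variationDensity p f η (halfSq (A m)) x with hI
  -- Gradients orthogonal to v do not see the stretch along v, so the exponential bound at t = 1 is
  -- uniform in m.
  have hI0 : ∀ m, I m = I 0 := by
    intro m
    refine lintegral_congr_ae ?_
    filter_upwards [hzero] with x hx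
    rcases (D.f_nonneg x).eq_or_lt with h0 | h0
    · simp [variationDensity, ← h0]
    have : halfSq (A m) (gradNegLog f x) = halfSq (A 0) (gradNegLog f x) := by
      simp only [halfSq, hA, norm_stretch_sq, hx h0]
      ring
    simp only [variationDensity, this]
  set B := (∫ x, f x) * Real.exp (1 * ((I 0).toReal / ∫ x, f x)) with hB
  have hbound : ∀ m, ∫ x, env S (lpSum p 1 η (halfSq (A m))) x ≤ B := by
    intro m
    obtain ⟨d, hdm⟩ := hd (A m) ⟨1, hAm m⟩
    have := D.integral_lpSum_le hp (A m) (hAm m) hdm one_pos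
    rw [hB, ← hI0 m]
    exact this
  set c : ℝ := (1 + 1 * (1 : ℝ) ^ p) ^ (1 / p - 1) with hc
  have hc0 : 0 < c := by positivity
  set F : ℕ → E n → ℝ := fun m x => env S (lpSum p 1 η (halfSq (A m))) (c • x) with hF
  have hFmeas : ∀ m, Measurable (F m) := fun m =>
    (measurable_env D.nonempty _).comp (measurable_const_smul c)
  set Z : E n → ℝ≥0∞ := fun x => liminf (fun m => ENNReal.ofReal (F m x)) atTop with hZ
  have hZmeas : Measurable Z := Measurable.liminf fun m => (hFmeas m).ennreal_ofReal
  have hZfin : ∫⁻ x, Z x ≠ ∞ := by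
    have h1 : ∫⁻ x, Z x ≤ ENNReal.ofReal ((c ^ n)⁻¹ * B) := by
      refine (lintegral_liminf_le fun m => (hFmeas m).ennreal_ofReal).trans ?_
      refine liminf_le_of_le (by isBoundedDefault) fun b hb => ?_
      obtain ⟨m, hm⟩ := hb.exists
      refine hm.trans ?_
      have hint : Integrable (F m) := (D.integrable_lpSum hp (A m) zero_le_one).comp_smul hc0.ne'
      rw [← ofReal_integral_eq_lintegral_ofReal hint (ae_of_all _ fun x => env_nonneg _ _ _)]
      refine ENNReal.ofReal_le_ofReal ?_
      simp only [hF]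
      rw [Measure.integral_comp_smul, abs_of_nonneg (by positivity), finrank_euclideanSpace,
        Fintype.card_fin, smul_eq_mul]
      gcongr
      exact hbound m
    exact (h1.trans_lt ENNReal.ofReal_lt_top).ne
  -- As A v = r v, the tangent point N r⁻² v makes the translation exactly N v at the cost (N‖v‖)²/2
  -- · r⁻², which tends to 0 as m → ∞.
  have hZlow : ∀ (N : ℕ) x, ENNReal.ofReal (f x ^ c) ≤ Z (x + (N : ℝ) • v) := by
    intro N x
    set r : ℕ → ℝ := fun m => 1 + m * ‖v‖ ^ 2 with hr
    have hr0 : ∀ m, 0 < r m := fun m => by simp only [hr]; positivity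
    have hrlim : Tendsto r atTop atTop := by
      refine tendsto_atTop_add_const_left _ _ ?_
      exact tendsto_natCast_atTop_atTop.atTop_mul_const (by positivity)
    have hlow : ∀ m, (f x * Real.exp (-((N * ‖v‖) ^ 2 / 2 * (r m)⁻¹ ^ 2))) ^ c
        ≤ F m (x + (N : ℝ) • v) := by
      intro m
      have h1 := D.rpow_le_env_lpSum hp (A m) (t := 1) (l := 1) zero_le_one one_pos
        (x + (N : ℝ) • v) ((N * (r m)⁻¹ ^ 2) • v)
      have h2 : A m ((N * (r m)⁻¹ ^ 2) • v) = (N * (r m)⁻¹) • v := by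
        have := hr0 m
        rw [map_smul, hA]
        simp only [stretch_self]
        rw [smul_smul]
        congr 1
        change _ * r m = _
        field_simp
      have h3 : (A m).adjoint ((N * (r m)⁻¹) • v) = (N : ℝ) • v := by
        have := hr0 m
        rw [hA]
        simp only [adjoint_stretch]
        rw [map_smul, stretch_self, smul_smul]
        congr 1
        change _ * r m = _
        field_simp
      have h4 : halfSq (A m) ((N * (r m)⁻¹ ^ 2) • v) = (N * ‖v‖) ^ 2 / 2 * (r m)⁻¹ ^ 2 := by
        have := hr0 m
        rw [halfSq, h2, norm_smul, Real.norm_of_nonneg (by positivity)]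
        ring
      rw [h2, h3, h4] at h1
      simpa only [Real.one_rpow, one_mul, mul_one, one_smul, add_sub_cancel_right, hF, hc] using h1
    have hlim : Tendsto (fun m => ENNReal.ofReal
        ((f x * Real.exp (-((N * ‖v‖) ^ 2 / 2 * (r m)⁻¹ ^ 2))) ^ c)) atTop
        (𝓝 (ENNReal.ofReal (f x ^ c))) := by
      refine (ENNReal.continuous_ofReal.tendsto _).comp ?_
      have h1 : Tendsto (fun m => f x * Real.exp (-((N * ‖v‖) ^ 2 / 2 * (r m)⁻¹ ^ 2))) atTop
          (𝓝 (f x * Real.exp (-((N * ‖v‖) ^ 2 / 2 * 0 ^ 2)))) :=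
        ((Real.continuous_exp.tendsto _).comp
          (((hrlim.inv_tendsto_atTop.pow 2).const_mul _).neg)).const_mul _
      have h2 := h1.rpow_const (p := c) (Or.inr hc0.le)
      simpa using h2
    rw [← hlim.liminf_eq]
    exact liminf_le_liminf (Eventually.of_forall fun m => ENNReal.ofReal_le_ofReal (hlow m))
  -- The integral over the ball is at most that of the integrable Z over the ball moved by N v,
  -- which tends to 0.
  have hball : ∀ R : ℕ, ∫⁻ x in Metric.ball (0 : E n) R, ENNReal.ofReal (f x ^ c) = 0 := by
    intro R
    have hle : ∀ N : ℕ, ∫⁻ x in Metric.ball (0 : E n) R, ENNReal.ofReal (f x ^ c)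
        ≤ ∫⁻ x, (Metric.ball ((N : ℝ) • v) R).indicator Z x := by
      intro N
      rw [← lintegral_indicator Metric.isOpen_ball.measurableSet,
        ← lintegral_add_right_eq_self ((Metric.ball ((N : ℝ) • v) (R : ℝ)).indicator Z)
          ((N : ℝ) • v)]
      refine lintegral_mono fun x => ?_
      by_cases hx : x ∈ Metric.ball (0 : E n) R
      · rw [indicator_of_mem hx, indicator_of_mem (by simpa using hx)]
        exact hZlow N x
      · rw [indicator_of_notMem hx]; exact zero_le
    have hlim : Tendsto (fun N : ℕ => ∫⁻ x, (Metric.ball ((N : ℝ) • v) R).indicator Z x) atTop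
        (𝓝 (∫⁻ _ : E n, 0)) := by
      refine tendsto_lintegral_of_dominated_convergence Z
        (fun N => hZmeas.indicator Metric.isOpen_ball.measurableSet)
        (fun N => ae_of_all _ fun x => indicator_le_self _ _ x) hZfin (ae_of_all _ fun x => ?_)
      refine tendsto_const_nhds.congr' ?_
      have hvpos : 0 < ‖v‖ := norm_pos_iff.2 hv
      filter_upwards [eventually_ge_atTop ⌈(R + ‖x‖) / ‖v‖⌉₊] with N hN
      rw [indicator_of_notMem]
      rw [Metric.mem_ball, dist_eq_norm, not_lt]
      have h1 : (R + ‖x‖) / ‖v‖ ≤ N := (Nat.le_ceil _).trans (by exact_mod_cast hN)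
      rw [div_le_iff₀ hvpos] at h1
      have h2 : ‖(N : ℝ) • v‖ = N * ‖v‖ := by rw [norm_smul, Real.norm_of_nonneg (by positivity)]
      have h3 := norm_sub_norm_le ((N : ℝ) • v) x
      rw [norm_sub_rev] at h3
      linarith
    rw [lintegral_zero] at hlim
    exact le_antisymm (ge_of_tendsto' hlim hle) (zero_le)
  have hfz : ∀ᵐ x, f x = 0 := by
    have hall : ∫⁻ x, ENNReal.ofReal (f x ^ c) = 0 := by
      have hun : ⋃ R : ℕ, Metric.ball (0 : E n) R = univ := Metric.iUnion_ball_nat 0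
      rw [← setLIntegral_univ, ← hun]
      refine le_antisymm ((lintegral_iUnion_le _ _).trans ?_) (zero_le)
      simp [hball]
    rw [lintegral_eq_zero_iff (by
      have := D.measurable_f
      fun_prop)] at hall
    filter_upwards [hall] with x hx
    have h1 : f x ^ c ≤ 0 := by simpa using hx
    by_contra hne
    have : 0 < f x := lt_of_le_of_ne (D.f_nonneg x) (Ne.symm hne)
    exact absurd h1 (not_le.2 (by positivity))
  have := D.pos
  rw [integral_congr_ae hfz] at this
  simp at this

end DualData

/-! ### Extended-real Fenchel conjugates, Gaussians and Asplund combinations. -/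

theorem coe_sub_le_coe_iff {v : EReal} (hv : v ≠ ⊥) (a c : ℝ) :
    (a : EReal) - v ≤ (c : EReal) ↔ (v ≠ ⊤ → a - v.toReal ≤ c) := by
  induction v with
  | bot => exact absurd rfl hv
  | top => simp
  | coe v =>
    simp only [ne_eq, EReal.coe_ne_top, not_false_eq_true, EReal.toReal_coe, forall_const]
    exact_mod_cast Iff.rfl

theorem fenchel_le_coe_iff {H : E n → EReal} (hH : ∀ y, H y ≠ ⊥) (x : E n) (c : ℝ) :
    fenchel H x ≤ c ↔ ∀ y, H y ≠ ⊤ → inner ℝ x y - (H y).toReal ≤ c := by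
  rw [fenchel, iSup_le_iff]
  refine forall_congr' fun y => ?_
  rw [coe_sub_le_coe_iff (hH y), real_inner_comm]

theorem coe_le_fenchel {H : E n → EReal} (hH : ∀ y, H y ≠ ⊥) (x : E n) {y : E n} (hy : H y ≠ ⊤) :
    ((inner ℝ x y - (H y).toReal : ℝ) : EReal) ≤ fenchel H x := by
  refine le_trans (le_of_eq ?_) (le_iSup (fun y => ((inner ℝ y x : ℝ) : EReal) - H y) y)
  conv_rhs => rw [← EReal.coe_toReal hy (hH y)]
  rw [real_inner_comm, EReal.coe_sub]

theorem fenchel_nonneg {H : E n → EReal} (h0 : H 0 = 0) (x : E n) : 0 ≤ fenchel H x := by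
  refine le_trans (le_of_eq ?_) (le_iSup (fun y => ((inner ℝ y x : ℝ) : EReal) - H y) 0)
  simp [h0]

theorem fenchel_zero {H : E n → EReal} (hH : ∀ x, 0 ≤ H x) (h0 : H 0 = 0) : fenchel H 0 = 0 := by
  refine le_antisymm ?_ (fenchel_nonneg h0 0)
  refine iSup_le fun y => ?_
  simpa using hH y

theorem expNeg_nonneg (u : E n → EReal) (x : E n) : 0 ≤ expNeg u x := ENNReal.toReal_nonneg

theorem exp_neg_le_expNeg {u : E n → EReal} {x : E n} (hx : u x ≠ ⊥) {c : ℝ} (h : u x ≤ c) :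
    Real.exp (-c) ≤ expNeg u x := by
  unfold expNeg
  generalize u x = v at hx h
  induction v with
  | bot => exact absurd rfl hx
  | top => simp at h
  | coe v =>
    rw [← EReal.coe_neg, EReal.exp_coe, ENNReal.toReal_ofReal (by positivity)]
    exact Real.exp_le_exp.2 (neg_le_neg (by exact_mod_cast h))

theorem expNeg_le_exp_neg {u : E n → EReal} {x : E n} {c : ℝ} (h : (c : EReal) ≤ u x) :
    expNeg u x ≤ Real.exp (-c) := by
  unfold expNeg
  generalize u x = v at h
  induction v with
  | bot => simp at h
  | top => simp; positivity
  | coe v =>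
    rw [← EReal.coe_neg, EReal.exp_coe, ENNReal.toReal_ofReal (by positivity)]
    exact Real.exp_le_exp.2 (neg_le_neg (by exact_mod_cast h))

theorem negLog_expNeg {u : E n → EReal} (hu : ∀ x, u x ≠ ⊥) : negLog (expNeg u) = u := by
  funext x
  have h : EReal.exp (-u x) ≠ ∞ := by simp [hu x]
  rw [negLog, expNeg, ENNReal.ofReal_toReal h, EReal.log_exp, neg_neg]

theorem toReal_negLog {f : E n → ℝ} (hf : ∀ x, 0 ≤ f x) (x : E n) :
    (negLog f x).toReal = -Real.log (f x) := by
  rw [negLog, ENNReal.log_ofReal]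
  split_ifs with h
  · simp [le_antisymm h (hf x)]
  · simp

theorem negLog_ne_top_iff {f : E n → ℝ} (x : E n) : negLog f x ≠ ⊤ ↔ 0 < f x := by
  rw [negLog, ENNReal.log_ofReal]
  split_ifs with h
  · simp [h]
  · simpa [← EReal.coe_neg] using h

/-- The conjugate of a nonnegative function, exponentiated, as an infimum over its domain. -/
theorem expNeg_fenchel {H : E n → EReal} (hH : ∀ y, 0 ≤ H y) (h0 : H 0 = 0) :
    expNeg (fenchel H) = env {y | H y ≠ ⊤} fun y => (H y).toReal := by
  have hbot : ∀ y, H y ≠ ⊥ := fun y h => by simpa [h] using hH y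
  have hfb : ∀ x, fenchel H x ≠ ⊥ := fun x h => by simpa [h] using fenchel_nonneg h0 x
  have hne : ({y | H y ≠ ⊤} : Set (E n)).Nonempty := ⟨0, by simp [h0]⟩
  funext x
  refine le_antisymm (le_env hne fun y hy => ?_) ?_
  · rw [← neg_sub]
    exact expNeg_le_exp_neg (coe_le_fenchel hbot x hy)
  · set e := env {y | H y ≠ ⊤} (fun y => (H y).toReal) x with he
    rcases (show 0 ≤ e from env_nonneg _ _ x).eq_or_lt with h | h
    · rw [← h]; exact expNeg_nonneg _ _
    · have hle : fenchel H x ≤ ((-Real.log e : ℝ) : EReal) := by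
        rw [fenchel_le_coe_iff hbot]
        intro y hy
        have := env_le (S := {y | H y ≠ ⊤}) (fun y => (H y).toReal) x hy
        have := (Real.log_le_log h this).trans_eq (Real.log_exp _)
        linarith
      have := exp_neg_le_expNeg (hfb x) hle
      rwa [neg_neg, Real.exp_log h] at this

theorem lowerSemicontinuous_fenchel (H : E n → EReal) : LowerSemicontinuous (fenchel H) := by
  refine lowerSemicontinuous_iSup fun y => Continuous.lowerSemicontinuous ?_
  generalize H y = v
  induction v with
  | bot => simpa using continuous_const
  | top => simpa using continuous_const
  | coe v =>
    simp_rw [← EReal.coe_sub]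
    exact continuous_coe_real_ereal.comp (by fun_prop)

/-- Fenchel conjugates of nondegenerate quadratic forms. -/
theorem fenchel_halfSq {B C : E n →L[ℝ] E n} (hBC : ∀ x y, inner ℝ x y = inner ℝ (B x) (C y))
    (hB : Function.Surjective B) (y : E n) :
    fenchel (fun x => ((halfSq B x : ℝ) : EReal)) y = (halfSq C y : ℝ) := by
  refine le_antisymm ?_ ?_
  · rw [fenchel_le_coe_iff (fun _ => EReal.coe_ne_bot _)]
    intro x _
    rw [EReal.toReal_coe, real_inner_comm, hBC]
    unfold halfSq
    nlinarith [norm_sub_sq_real (B x) (C y), sq_nonneg ‖B x - C y‖]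
  -- The supremum is attained where B x = C y, the equality case of the square completed above.
  · obtain ⟨x, hx⟩ := hB (C y)
    refine le_trans (le_of_eq ?_) (coe_le_fenchel (H := fun x => ((halfSq B x : ℝ) : EReal))
      (fun _ => EReal.coe_ne_bot _) y (EReal.coe_ne_top (halfSq B x)))
    congr 1
    rw [EReal.toReal_coe, real_inner_comm, hBC, hx, real_inner_self_eq_norm_sq]
    unfold halfSq
    rw [hx]
    ring

/-- The operator `φ^{-T}`. -/
def invAdjoint (φ : E n ≃L[ℝ] E n) : E n →L[ℝ] E n := (φ.symm : E n →L[ℝ] E n).adjoint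

theorem inner_eq_inner_invAdjoint (φ : E n ≃L[ℝ] E n) (x y : E n) :
    inner ℝ x y = inner ℝ (φ x) (invAdjoint φ y) := by
  rw [invAdjoint, ContinuousLinearMap.adjoint_inner_right]
  simp

theorem adjoint_invAdjoint_apply (φ : E n ≃L[ℝ] E n) (y : E n) :
    invAdjoint φ ((φ : E n →L[ℝ] E n).adjoint y) = y := by
  refine ext_inner_left ℝ fun x => ?_
  rw [invAdjoint, ContinuousLinearMap.adjoint_inner_right, ContinuousLinearMap.adjoint_inner_right]
  simp

theorem invAdjoint_surjective (φ : E n ≃L[ℝ] E n) : Function.Surjective (invAdjoint φ) :=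
  fun y => ⟨_, adjoint_invAdjoint_apply φ y⟩

theorem norm_le_mul_norm_invAdjoint (φ : E n ≃L[ℝ] E n) :
    ∃ κ, ∀ y, ‖y‖ ≤ κ * ‖invAdjoint φ y‖ := by
  refine ⟨‖(φ : E n →L[ℝ] E n).adjoint‖, fun y => ?_⟩
  have h : (φ : E n →L[ℝ] E n).adjoint (invAdjoint φ y) = y := by
    refine ext_inner_left ℝ fun x => ?_
    rw [ContinuousLinearMap.adjoint_inner_right]
    exact (inner_eq_inner_invAdjoint φ x y).symm
  calc ‖y‖ = ‖(φ : E n →L[ℝ] E n).adjoint (invAdjoint φ y)‖ := by rw [h]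
    _ ≤ _ := ContinuousLinearMap.le_opNorm _ _

theorem gaussian_eq_expNeg (φ : E n ≃L[ℝ] E n) :
    gaussian φ = expNeg fun x => ((halfSq (φ : E n →L[ℝ] E n) x : ℝ) : EReal) := by
  funext x
  rw [expNeg, ← EReal.coe_neg, EReal.exp_coe, ENNReal.toReal_ofReal (by positivity)]
  rfl

theorem supportFn_gaussian (φ : E n ≃L[ℝ] E n) (y : E n) :
    supportFn (gaussian φ) y = (halfSq (invAdjoint φ) y : ℝ) := by
  rw [supportFn, gaussian_eq_expNeg, negLog_expNeg fun _ => EReal.coe_ne_bot _]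
  exact fenchel_halfSq (fun x y => inner_eq_inner_invAdjoint φ x y) φ.surjective y

theorem supportFn_polar_gaussian (φ : E n ≃L[ℝ] E n) (y : E n) :
    supportFn (polar (gaussian φ)) y = (halfSq (φ : E n →L[ℝ] E n) y : ℝ) := by
  have h : supportFn (gaussian φ) = fun y => ((halfSq (invAdjoint φ) y : ℝ) : EReal) :=
    funext (supportFn_gaussian φ)
  rw [polar, h, supportFn, negLog_expNeg fun _ => EReal.coe_ne_bot _]
  refine fenchel_halfSq (fun x y => ?_) (invAdjoint_surjective φ) y
  rw [real_inner_comm, inner_eq_inner_invAdjoint φ, real_inner_comm]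
  rfl

/-- The `L_p` Asplund combination with a Gaussian function, as an envelope. -/
theorem lpAsplund_gaussian {u : E n → EReal} (hu : IsL0 u) {p : ℝ} (hp : 1 ≤ p)
    (φ : E n ≃L[ℝ] E n) (t : ℝ) (ht : 0 ≤ t) :
    lpAsplund p 1 (expNeg u) t (gaussian φ) = env {y | fenchel u y ≠ ⊤}
      (lpSum p t (fun y => (fenchel u y).toReal) (halfSq (invAdjoint φ))) := by
  have hp0 : 0 < p := by linarith
  have hsupp : supportFn (expNeg u) = fenchel u := by rw [supportFn, negLog_expNeg hu.ne_bot]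
  have hnn : ∀ y, 0 ≤ fenchel u y := fenchel_nonneg hu.zero
  have hfin : ∀ y, fenchel u y ≠ ⊤ →
      (ENNReal.ofReal 1 * (fenchel u y).toENNReal ^ p
        + ENNReal.ofReal t * (supportFn (gaussian φ) y).toENNReal ^ p) ^ (1 / p)
      = ENNReal.ofReal (lpSum p t (fun y => (fenchel u y).toReal) (halfSq (invAdjoint φ)) y) := by
    intro y hy
    have h1 : 0 ≤ (fenchel u y).toReal := EReal.toReal_nonneg (hnn y)
    have h2 := halfSq_nonneg (invAdjoint φ) y
    rw [supportFn_gaussian, EReal.real_coe_toENNReal, EReal.toENNReal_of_ne_top hy,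
      ENNReal.ofReal_rpow_of_nonneg h1 hp0.le, ENNReal.ofReal_rpow_of_nonneg h2 hp0.le,
      ENNReal.ofReal_one, one_mul, ← ENNReal.ofReal_mul ht, ← ENNReal.ofReal_add (by positivity)
      (by positivity), ENNReal.ofReal_rpow_of_nonneg (by positivity) (by positivity)]
    rfl
  rw [lpAsplund, hsupp, expNeg_fenchel (fun y => EReal.coe_ennreal_nonneg _)]
  · have hset : {y : E n | (((ENNReal.ofReal 1 * (fenchel u y).toENNReal ^ p
        + ENNReal.ofReal t * (supportFn (gaussian φ) y).toENNReal ^ p) ^ (1 / p) : ℝ≥0∞) : EReal)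
          ≠ ⊤} = {y | fenchel u y ≠ ⊤} := by
      ext y
      simp only [mem_ofPred_eq, ne_eq, EReal.coe_ennreal_eq_top_iff, not_iff_not]
      constructor
      · intro h
        by_contra hy
        rw [hfin y hy] at h
        exact ENNReal.ofReal_ne_top h
      · intro h
        rw [h, EReal.toENNReal_top, ENNReal.top_rpow_of_pos hp0, ENNReal.ofReal_one, one_mul,
          top_add, ENNReal.top_rpow_of_pos (by positivity)]
    rw [hset]
    funext x
    have : ∀ y ∈ {y : E n | fenchel u y ≠ ⊤},
        ((((ENNReal.ofReal 1 * (fenchel u y).toENNReal ^ p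
        + ENNReal.ofReal t * (supportFn (gaussian φ) y).toENNReal ^ p) ^ (1 / p) : ℝ≥0∞) :
          EReal)).toReal
        = lpSum p t (fun y => (fenchel u y).toReal) (halfSq (invAdjoint φ)) y := by
      intro y hy
      rw [hfin y hy, EReal.toReal_coe_ennreal, ENNReal.toReal_ofReal]
      have h1 : 0 ≤ (fenchel u y).toReal := EReal.toReal_nonneg (hnn y)
      have h2 := halfSq_nonneg (invAdjoint φ) y
      unfold lpSum
      positivity
    unfold env
    refine iInf_congr fun y => ?_
    exact congrArg (fun r => Real.exp (r - inner ℝ x (y : E n))) (this y y.2)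
  · have h0 : fenchel u 0 = 0 := fenchel_zero hu.nonneg hu.zero
    have h1 : supportFn (gaussian φ) (0 : E n) = 0 := by
      rw [supportFn_gaussian]; simp [halfSq]
    rw [h0, h1]
    simp [hp0]

/-! ### Convex regularity and the dual data of class 𝓐₀. -/

/-- A real-valued convex function on a set is differentiable at almost every interior point. -/
theorem ae_differentiableAt_of_convexOn {C : Set (E n)} {g : E n → ℝ} (hg : ConvexOn ℝ C g) :
    ∀ᵐ x, x ∈ C → x ∈ interior C ∧ DifferentiableAt ℝ g x := by
  -- The boundary of a convex set is null; in the interior convex functions are locally Lipschitz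
  -- and Rademacher's theorem applies locally.
  have h1 : ∀ᵐ x, x ∉ frontier C :=
    measure_eq_zero_iff_ae_notMem.1 (hg.1.addHaar_frontier volume)
  have h2 : ∀ᵐ x, x ∉ {x | x ∈ interior C ∧ ¬ DifferentiableAt ℝ g x} := by
    refine measure_eq_zero_iff_ae_notMem.1 (measure_null_of_locally_null _ fun x hx => ?_)
    obtain ⟨K, t, ht, hK⟩ := hg.locallyLipschitzOn_interior hx.1
    rw [isOpen_interior.nhdsWithin_eq hx.1] at ht
    refine ⟨interior t ∩ {x | x ∈ interior C ∧ ¬ DifferentiableAt ℝ g x},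
      Filter.inter_mem (mem_nhdsWithin_of_mem_nhds (interior_mem_nhds.2 ht))
        self_mem_nhdsWithin, ?_⟩
    rw [measure_eq_zero_iff_ae_notMem]
    filter_upwards [hK.ae_differentiableWithinAt_of_mem] with z hz hmem
    exact hmem.2.2 ((hz (interior_subset hmem.1)).differentiableAt (mem_interior_iff_mem_nhds.1 hmem.1))
  filter_upwards [h1, h2] with x hx1 hx2 hxC
  have hint : x ∈ interior C := by
    by_contra h
    exact hx1 ⟨subset_closure hxC, h⟩
  refine ⟨hint, ?_⟩
  by_contra h
  exact hx2 ⟨hint, h⟩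

/-- The gradient inequality for convex functions. -/
theorem add_inner_gradient_le {C : Set (E n)} {g : E n → ℝ} (hg : ConvexOn ℝ C g) {x z : E n}
    (hx : x ∈ C) (hz : z ∈ C) (hd : DifferentiableAt ℝ g x) :
    g x + inner ℝ (z - x) (gradient g x) ≤ g z := by
  set γ : ℝ → E n := fun t => x + t • (z - x) with hγ
  have hγd : HasDerivAt γ (z - x) 0 := by
    exact (((hasDerivAt_id (0 : ℝ)).smul_const (z - x)).const_add x).congr_deriv (one_smul _ _)
  have hgrad : HasFDerivAt g (innerSL ℝ (gradient g x)) (γ 0) := by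
    have h0 : γ 0 = x := by simp [hγ]
    rw [h0]
    have := hd.hasGradientAt
    rw [hasGradientAt_iff_hasFDerivAt] at this
    exact this
  have hcomp : HasDerivAt (fun t => g (γ t)) (inner ℝ (gradient g x) (z - x)) 0 :=
    hgrad.comp_hasDerivAt 0 hγd
  have hlim := tendsto_quotient_of_hasDerivAt hcomp
  rw [real_inner_comm]
  suffices inner ℝ (gradient g x) (z - x) ≤ g z - g x by linarith
  refine le_of_tendsto hlim ?_
  filter_upwards [Ioc_mem_nhdsGT (zero_lt_one' ℝ)] with t ht
  have hc := hg.2 hx hz (sub_nonneg.2 ht.2) ht.1.le (by ring)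
  have he : (1 - t) • x + t • z = γ t := by simp only [hγ]; module
  rw [he] at hc
  have h0 : γ 0 = x := by simp [hγ]
  simp only [h0]
  rw [div_le_iff₀ ht.1]
  simp only [smul_eq_mul] at hc
  linarith

/-- The dual data of a function of class `𝓐₀` whose support has interior points. -/
theorem IsL0.dualData {u : E n → EReal} (hu : IsL0 u)
    (hsupp : (interior (Function.support (expNeg u))).Nonempty) :
    DualData (expNeg u) {y | fenchel u y ≠ ⊤} fun y => (fenchel u y).toReal := by
  set S : Set (E n) := {y | fenchel u y ≠ ⊤} with hS
  set η : E n → ℝ := fun y => (fenchel u y).toReal with hη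
  set f := expNeg u with hf
  have hnn : ∀ y, 0 ≤ fenchel u y := fenchel_nonneg hu.zero
  have hbot : ∀ y, fenchel u y ≠ ⊥ := fun y h => by simpa [h] using hnn y
  have h0 : fenchel u 0 = 0 := fenchel_zero hu.nonneg hu.zero
  have hzero_mem : (0 : E n) ∈ S := by simp [hS, h0]
  have heq : f = env S η := by
    rw [hf]
    conv_lhs => rw [← hu.biconj]
    exact expNeg_fenchel hnn h0
  have hneg : negLog f = u := negLog_expNeg hu.ne_bot
  have hfnn : ∀ x, 0 ≤ f x := expNeg_nonneg u
  have hpos_iff : ∀ x, 0 < f x ↔ u x ≠ ⊤ := fun x => by rw [← negLog_ne_top_iff, hneg]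
  have htoReal : ∀ x, (u x).toReal = -Real.log (f x) := fun x => by
    rw [← toReal_negLog hfnn, hneg]
  have hball : ∃ δ > 0, ∃ M, ∀ y : E n, ‖y‖ ≤ δ → y ∈ S ∧ η y ≤ M := by
    have h1 : ∀ᶠ x in Bornology.cobounded (E n), 1 ≤ u x := by
      filter_upwards [hu.coercive.eventually (lt_mem_nhds (EReal.coe_lt_top 1))] with x hx
      exact_mod_cast hx.le
    obtain ⟨r, hr⟩ : ∃ r : ℝ, ∀ x : E n, r ≤ ‖x‖ → 1 ≤ u x := by
      rw [← comap_norm_atTop, eventually_comap] at h1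
      obtain ⟨r, hr⟩ := eventually_atTop.1 h1
      exact ⟨r, fun x hx => hr _ hx x rfl⟩
    set R := max r 1 with hR
    have hR1 : 1 ≤ R := le_max_right _ _
    -- Coercivity gives u ≥ 1 outside a ball; convexity along rays, with u(0) = 0, upgrades this to
    -- linear growth. Dually, u^* ≤ 1 on the ball of radius 1/R.
    have hgrow : ∀ x, u x ≠ ⊤ → ‖x‖ / R - 1 ≤ (u x).toReal := by
      intro x hx
      have hux : u x = ((u x).toReal : ℝ) := (EReal.coe_toReal hx (hu.ne_bot x)).symm
      rcases le_or_gt ‖x‖ R with h | h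
      · have : 0 ≤ (u x).toReal := EReal.toReal_nonneg (hu.nonneg x)
        have h2 : ‖x‖ / R ≤ 1 := (div_le_one (by linarith)).2 h
        linarith
      · have hx0 : 0 < ‖x‖ := by linarith
        have hc := hu.convex 0 x (R / ‖x‖) (by positivity) ((div_lt_one hx0).2 h)
        have h2 : 1 ≤ u ((1 - R / ‖x‖) • (0 : E n) + (R / ‖x‖) • x) := by
          apply hr
          rw [smul_zero, zero_add, norm_smul, Real.norm_of_nonneg (by positivity),
            div_mul_cancel₀ _ hx0.ne']
          exact le_max_left _ _
        have h3 := h2.trans hc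
        rw [hu.zero, mul_zero, zero_add, hux, ← EReal.coe_mul] at h3
        have h4 : 1 ≤ R / ‖x‖ * (u x).toReal := by exact_mod_cast h3
        have h5 : ‖x‖ / R ≤ (u x).toReal := by
          rw [div_le_iff₀ (by linarith)]
          rw [div_mul_eq_mul_div, le_div_iff₀ hx0] at h4
          linarith
        linarith
    refine ⟨1 / R, by positivity, 1, fun y hy => ?_⟩
    have hle : fenchel u y ≤ ((1 : ℝ) : EReal) := by
      rw [fenchel_le_coe_iff hu.ne_bot]
      intro x hx
      have h2 := hgrow x hx
      have h3 := real_inner_le_norm y x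
      have h4 : ‖y‖ * ‖x‖ ≤ 1 / R * ‖x‖ := by gcongr
      have h5 : 1 / R * ‖x‖ = ‖x‖ / R := by ring
      linarith
    have hmem : y ∈ S := (hle.trans_lt (EReal.coe_lt_top 1)).ne
    refine ⟨hmem, ?_⟩
    rw [← EReal.coe_toReal hmem (hbot y)] at hle
    exact_mod_cast hle
  have hconv : ConvexOn ℝ {x | 0 < f x} fun x => -Real.log (f x) := by
    have key : ∀ x y : E n, ∀ a b : ℝ, 0 ≤ a → 0 ≤ b → a + b = 1 →
        f x ^ a * f y ^ b ≤ f (a • x + b • y) := by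
      intro x y a b ha hb hab
      rw [heq]
      exact env_rpow_mul_env_rpow_le ⟨0, hzero_mem⟩ ha hb
        (fun w _ => by rw [← add_mul, hab, one_mul]) x y
    refine ⟨fun x hx y hy a b ha hb hab => ?_, fun x hx y hy a b ha hb hab => ?_⟩
    · have hx' : 0 < f x := hx
      have hy' : 0 < f y := hy
      exact lt_of_lt_of_le (by positivity) (key x y a b ha hb hab)
    · have hx' : 0 < f x := hx
      have hy' : 0 < f y := hy
      have := Real.log_le_log (by positivity) (key x y a b ha hb hab)
      rw [Real.log_mul (by positivity) (by positivity), Real.log_rpow hx', Real.log_rpow hy']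
        at this
      simp only [smul_eq_mul]
      linarith
  refine
    { zero_mem := hzero_mem
      zero := by simp [hη, h0]
      nonneg := fun y => EReal.toReal_nonneg (hnn y)
      eq := heq
      ball := hball
      grad := ?_
      measurable := (lowerSemicontinuous_fenchel u).measurable.ereal_toReal
      pos := ?_ }
  · filter_upwards [ae_differentiableAt_of_convexOn hconv] with x hx hfx
    obtain ⟨hint, hd⟩ := hx hfx
    -- Equality in Fenchel–Young at a point of differentiability: the gradient inequality gives ≤,
    -- testing the supremum at x gives ≥.
    have hval : fenchel u (gradNegLog f x)
        = ((inner ℝ x (gradNegLog f x) + Real.log (f x) : ℝ) : EReal) := by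
      refine le_antisymm ?_ ?_
      · rw [fenchel_le_coe_iff hu.ne_bot]
        intro z hz
        have h1 := add_inner_gradient_le hconv hfx ((hpos_iff z).2 hz) hd
        rw [inner_sub_left] at h1
        rw [htoReal, real_inner_comm]
        change _ + (inner ℝ z (gradNegLog f x) - inner ℝ x (gradNegLog f x)) ≤ _ at h1
        linarith
      · refine le_trans (le_of_eq ?_) (coe_le_fenchel hu.ne_bot _ ((hpos_iff x).1 hfx))
        rw [htoReal, real_inner_comm, sub_neg_eq_add]
    refine ⟨hd, mem_interior_iff_mem_nhds.1 hint, ?_, ?_⟩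
    · rw [hS, mem_ofPred_eq, hval]; exact EReal.coe_ne_top _
    · simp only [hη]
      rw [hval, EReal.toReal_coe]
  · obtain ⟨δ, hδ, M, hM⟩ := hball
    have hi : Integrable f := by
      rw [heq]
      exact integrable_env ⟨0, hzero_mem⟩ hδ hM
    rw [integral_pos_iff_support_of_nonneg hfnn hi]
    exact (isOpen_interior.measure_pos volume hsupp).trans_le (measure_mono interior_subset)

/-! ### Determinants, and the constraint in terms of φ^{-T}. -/

/-- The inequality of arithmetic and geometric means for the eigenvalues of `P† P`. -/
theorem card_le_sum_norm_sq {P : E n →L[ℝ] E n} (hP : 1 ≤ |P.det|) :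
    (n : ℝ) ≤ ∑ i, ‖P (EuclideanSpace.basisFun (Fin n) ℝ i)‖ ^ 2 ∧
      (∑ i, ‖P (EuclideanSpace.basisFun (Fin n) ℝ i)‖ ^ 2 ≤ n → ∀ x, ‖P x‖ = ‖x‖) := by
  set L : E n →ₗ[ℝ] E n := P.toLinearMap with hL
  set T : E n →ₗ[ℝ] E n := L.adjoint ∘ₗ L with hT
  have hpos : T.IsPositive := L.isPositive_adjoint_comp_self
  have hn : Module.finrank ℝ (E n) = n := finrank_euclideanSpace_fin
  set ev := hpos.isSymmetric.eigenvalues hn with hev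
  have hinner : ∀ x, inner ℝ x (T x) = ‖P x‖ ^ 2 := fun x => by
    rw [hT, LinearMap.comp_apply, LinearMap.adjoint_inner_right, real_inner_self_eq_norm_sq]
    rfl
  have htrace : ∑ i, ‖P (EuclideanSpace.basisFun (Fin n) ℝ i)‖ ^ 2 = ∑ i, ev i := by
    have := hpos.isSymmetric.trace_eq_sum_eigenvalues hn
    rw [T.trace_eq_sum_inner (EuclideanSpace.basisFun (Fin n) ℝ)] at this
    exact (Finset.sum_congr rfl fun i _ => (hinner _).symm).trans this
  have hprod : 1 ≤ ∏ i, ev i := by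
    have h1 : T.det = ∏ i, ev i := hpos.isSymmetric.det_eq_prod_eigenvalues hn
    have h2 : L.normDet ^ 2 = T.det := L.normDet_sq
    rw [← h1, ← h2, L.normDet_eq_abs_det]
    exact one_le_pow₀ hP
  have hev0 : ∀ i, 0 < ev i := fun i => by
    refine (hpos.nonneg_eigenvalues hn i).lt_of_ne' fun h => ?_
    rw [Finset.prod_eq_zero (Finset.mem_univ i) h] at hprod
    linarith
  have hlog : 0 ≤ ∑ i, Real.log (ev i) := by
    rw [← Real.log_prod fun i _ => (hev0 i).ne']
    exact Real.log_nonneg hprod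
  -- Summing λ - 1 - log λ ≥ 0 gives the inequality. In the equality case every summand vanishes,
  -- and strictness off λ = 1 forces P†P to be the identity.
  have hle : ∀ i ∈ Finset.univ, 0 ≤ ev i - 1 - Real.log (ev i) := fun i _ => by
    linarith [Real.log_le_sub_one_of_pos (hev0 i)]
  have hsum : ∑ i, (ev i - 1 - Real.log (ev i)) = ∑ i, ev i - n - ∑ i, Real.log (ev i) := by
    simp [Finset.sum_sub_distrib]
  rw [htrace]
  refine ⟨by linarith [Finset.sum_nonneg hle], fun h x => ?_⟩
  have hzero := (Finset.sum_eq_zero_iff_of_nonneg hle).1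
    (le_antisymm (by linarith) (Finset.sum_nonneg hle))
  have hone : ∀ i, ev i = 1 := fun i => by
    by_contra hi
    linarith [Real.log_lt_sub_one_of_pos (hev0 i) hi, hzero i (Finset.mem_univ i)]
  have hid : T = LinearMap.id := by
    refine (hpos.isSymmetric.eigenvectorBasis hn).toBasis.ext fun i => ?_
    have := hpos.isSymmetric.apply_eigenvectorBasis hn i
    rw [show hpos.isSymmetric.eigenvalues hn i = 1 from hone i] at this
    simpa using this
  have := hinner x
  rw [hid, LinearMap.id_apply, real_inner_self_eq_norm_sq] at this
  exact ((sq_eq_sq₀ (norm_nonneg _) (norm_nonneg _)).1 this).symm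

theorem det_stretch (v : E n) (m : ℝ) : (stretch v m).det = 1 + m * ‖v‖ ^ 2 := by
  have : ((stretch v m : E n →L[ℝ] E n) : E n →ₗ[ℝ] E n)
      = LinearMap.transvection (innerₗ (E n) v) (m • v) := by
    ext1 y
    simp [stretch_apply, LinearMap.transvection.apply, smul_smul, mul_comm]
  rw [ContinuousLinearMap.det, this, LinearMap.transvection.det]
  simp

theorem det_ne_zero (φ : E n ≃L[ℝ] E n) : (φ : E n →L[ℝ] E n).det ≠ 0 :=
  (LinearEquiv.isUnit_det' φ.toLinearEquiv).ne_zero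

theorem det_comp (A B : E n →L[ℝ] E n) : (A ∘L B).det = A.det * B.det :=
  LinearMap.det_comp (A : E n →ₗ[ℝ] E n) B

theorem det_smul (r : ℝ) (A : E n →L[ℝ] E n) : (r • A).det = r ^ n * A.det := by
  have := LinearMap.det_smul r (A : E n →ₗ[ℝ] E n)
  rwa [finrank_euclideanSpace_fin] at this

theorem det_mul_det_symm (φ : E n ≃L[ℝ] E n) :
    (φ : E n →L[ℝ] E n).det * (φ.symm : E n →L[ℝ] E n).det = 1 := by
  rw [← det_comp, ContinuousLinearEquiv.coe_comp_coe_symm]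
  exact LinearMap.det_id

theorem det_adjoint {A : E n →L[ℝ] E n} (hA : A.det ≠ 0) : A.adjoint.det = A.det := by
  have h1 := A.normDet_sq
  rw [det_comp] at h1
  have h2 : (A : E n →ₗ[ℝ] E n).normDet = |A.det| := LinearMap.normDet_eq_abs_det _
  rw [h2, sq_abs] at h1
  refine mul_right_cancel₀ hA (Eq.trans ?_ (sq _))
  exact_mod_cast h1.symm

theorem det_mul_det_invAdjoint (φ : E n ≃L[ℝ] E n) :
    (φ : E n →L[ℝ] E n).det * (invAdjoint φ).det = 1 := by
  rw [invAdjoint, det_adjoint (det_ne_zero φ.symm), det_mul_det_symm]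

theorem det_invAdjoint (φ : E n ≃L[ℝ] E n) :
    (invAdjoint φ).det = ((φ : E n →L[ℝ] E n).det)⁻¹ :=
  eq_inv_of_mul_eq_one_right (det_mul_det_invAdjoint φ)

/-- This lets the minimization run over all operators with |det| ≥ 1, a closed subset of a vector
space. -/
theorem exists_invAdjoint_eq {A : E n →L[ℝ] E n} (hA : A.det ≠ 0) : ∃ φ, invAdjoint φ = A := by
  have hadj : IsUnit (LinearMap.det (A.adjoint : E n →ₗ[ℝ] E n)) := by
    have : A.adjoint.det ≠ 0 := by rwa [det_adjoint hA]
    exact this.isUnit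
  refine ⟨(LinearEquiv.ofIsUnitDet (v := (EuclideanSpace.basisFun (Fin n) ℝ).toBasis)
    (v' := (EuclideanSpace.basisFun (Fin n) ℝ).toBasis) (f := (A.adjoint : E n →ₗ[ℝ] E n))
      (by simpa using hadj)).toContinuousLinearEquiv.symm, ?_⟩
  rw [invAdjoint]
  conv_rhs => rw [← A.adjoint_adjoint]
  congr 1

theorem gaussConst_pos (n : ℕ) : 0 < gaussConst n := by
  unfold gaussConst
  positivity

theorem totalMass_gaussian (φ : E n ≃L[ℝ] E n) :
    totalMass (gaussian φ) = gaussConst n / |(φ : E n →L[ℝ] E n).det| := by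
  have hdet : LinearMap.det ((φ : E n →L[ℝ] E n) : E n →ₗ[ℝ] E n) ≠ 0 := det_ne_zero φ
  have hmap := Measure.map_linearMap_addHaar_eq_smul_addHaar (volume : Measure (E n)) hdet
  have hint : ∫ x : E n, Real.exp (-(‖x‖ ^ 2 / 2)) = gaussConst n := by
    have := GaussianFourier.integral_rexp_neg_mul_sq_norm (V := E n) (b := 1 / 2) (by norm_num)
    rw [finrank_euclideanSpace_fin] at this
    rw [gaussConst, show 2 * Real.pi = Real.pi / (1 / 2) by ring, ← this]
    congr 1 with x
    ring_nf
  have h1 : totalMass (gaussian φ) = ∫ y, Real.exp (-(‖y‖ ^ 2 / 2)) ∂(Measure.map φ volume) :=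
    (φ.toHomeomorph.measurableEmbedding.integral_map
      fun y => Real.exp (-(‖y‖ ^ 2 / 2))).symm
  have h2 : Measure.map φ volume = Measure.map ((φ : E n →L[ℝ] E n) : E n →ₗ[ℝ] E n) volume := rfl
  rw [h1, h2, hmap, integral_smul_measure, hint, ENNReal.toReal_ofReal (abs_nonneg _), smul_eq_mul,
    abs_inv, div_eq_inv_mul]

theorem one_le_totalMass_gaussian_iff (φ : E n ≃L[ℝ] E n) :
    1 ≤ totalMass (gaussian φ) / gaussConst n ↔ 1 ≤ |(invAdjoint φ).det| := by
  rw [totalMass_gaussian, det_invAdjoint, abs_inv, div_right_comm,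
    div_self (gaussConst_pos n).ne', one_div]

theorem totalMass_gaussian_eq_iff (φ : E n ≃L[ℝ] E n) :
    totalMass (gaussian φ) = gaussConst n ↔ |(invAdjoint φ).det| = 1 := by
  have h := abs_pos.2 (det_ne_zero φ)
  rw [totalMass_gaussian, det_invAdjoint, abs_inv, div_eq_iff h.ne', inv_eq_one]
  exact ⟨fun h' => mul_left_cancel₀ (gaussConst_pos n).ne' (by rw [← h', mul_one]),
    fun h' => by rw [h', mul_one]⟩

/-! ### The surface area measure and the integral formula. -/

theorem gradient_toReal_negLog {f : E n → ℝ} (hf : ∀ x, 0 ≤ f x) :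
    (gradient fun z => (negLog f z).toReal) = gradNegLog f := by
  have : (fun z => (negLog f z).toReal) = fun z => -Real.log (f z) := funext (toReal_negLog hf)
  rw [this]
  rfl

theorem surfaceMeasure_eq {f : E n → ℝ} (hf : ∀ x, 0 ≤ f x) (p : ℝ) :
    surfaceMeasure p f = ((volume.restrict {x | 0 < f x}).withDensity fun x =>
      (supportFn f (gradNegLog f x)).toENNReal ^ (1 - p) * ENNReal.ofReal (f x)).map
        (gradNegLog f) := by
  have : {x : E n | negLog f x ≠ ⊤} = {x | 0 < f x} := by ext x; exact negLog_ne_top_iff x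
  rw [surfaceMeasure, gradient_toReal_negLog hf, this]

theorem measurable_surfaceDensity {f : E n → ℝ} (hf : Measurable f) (p : ℝ) :
    Measurable fun x => (supportFn f (gradNegLog f x)).toENNReal ^ (1 - p) * ENNReal.ofReal (f x) :=
  (((lowerSemicontinuous_fenchel (negLog f)).measurable.comp
    (measurable_gradNegLog f)).ereal_toENNReal.pow_const _).mul hf.ennreal_ofReal

theorem ae_toENNReal_supportFn {u : E n → EReal} (hu : IsL0 u)
    (hsupp : (interior (Function.support (expNeg u))).Nonempty) : ∀ᵐ x, 0 < expNeg u x →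
    (supportFn (expNeg u) (gradNegLog (expNeg u) x)).toENNReal
      = ENNReal.ofReal (fenchel u (gradNegLog (expNeg u) x)).toReal := by
  filter_upwards [(hu.dualData hsupp).grad] with x hx h0
  rw [supportFn, negLog_expNeg hu.ne_bot]
  exact EReal.toENNReal_of_ne_top (hx h0).2.2.1

/-- Change of variables under the push-forward; the factor p undoes the 1/p built into
`variationDensity`. -/
theorem lintegral_surfaceMeasure {u : E n → EReal} (hu : IsL0 u)
    (hsupp : (interior (Function.support (expNeg u))).Nonempty) {p : ℝ}
    (hp : 1 ≤ p) (A : E n →L[ℝ] E n) :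
    ∫⁻ y, ENNReal.ofReal (halfSq A y) ^ p ∂(surfaceMeasure p (expNeg u))
      = ENNReal.ofReal p * ∫⁻ x, variationDensity p (expNeg u) (fun y => (fenchel u y).toReal)
        (halfSq A) x := by
  have hp0 : 0 < p := by linarith
  have D := hu.dualData hsupp
  have hk : Measurable fun y => ENNReal.ofReal (halfSq A y) ^ p :=
    (continuous_halfSq A).measurable.ennreal_ofReal.pow_const p
  have hcomp : Measurable fun x => ENNReal.ofReal (halfSq A (gradNegLog (expNeg u) x)) ^ p :=
    hk.comp (measurable_gradNegLog _)
  rw [surfaceMeasure_eq D.f_nonneg, lintegral_map hk (measurable_gradNegLog _),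
    lintegral_withDensity_eq_lintegral_mul _ (measurable_surfaceDensity D.measurable_f p) hcomp,
    ← lintegral_indicator (measurableSet_lt measurable_const D.measurable_f),
    ← lintegral_const_mul' _ _ ENNReal.ofReal_ne_top]
  refine lintegral_congr_ae ?_
  filter_upwards [ae_toENNReal_supportFn hu hsupp] with x hx
  rcases (D.f_nonneg x).eq_or_lt with h0 | h0
  · rw [indicator_of_notMem (by simp [← h0])]
    simp [variationDensity, ← h0]
  · rw [indicator_of_mem (by exact h0)]
    simp only [Pi.mul_apply, hx h0, variationDensity]
    rw [← mul_assoc (ENNReal.ofReal p), ← ENNReal.ofReal_mul hp0.le, mul_one_div_cancel hp0.ne',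
      ENNReal.ofReal_one, one_mul, mul_comm]

theorem tendsto_quotient_of_tendsto_variationQuotient {u : E n → EReal} (hu : IsL0 u) {p : ℝ}
    (hp : 1 ≤ p) {φ : E n ≃L[ℝ] E n} {d : ℝ}
    (hd : Tendsto (variationQuotient p (expNeg u) (gaussian φ)) (𝓝[>] 0) (𝓝 d)) :
    Tendsto (fun t => ((∫ x, env {y | fenchel u y ≠ ⊤}
      (lpSum p t (fun y => (fenchel u y).toReal) (halfSq (invAdjoint φ))) x)
        - ∫ x, expNeg u x) / t) (𝓝[>] 0) (𝓝 d) := by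
  refine hd.congr' ?_
  filter_upwards [self_mem_nhdsWithin] with t ht
  rw [variationQuotient, lpAsplund_gaussian hu hp φ t (le_of_lt ht)]
  rfl

/-- Integral formula for the first variation along a Gaussian function. -/
theorem lintegral_surfaceMeasure_eq {u : E n → EReal} (hu : IsL0 u)
    (hsupp : (interior (Function.support (expNeg u))).Nonempty) {p : ℝ}
    (hp : 1 ≤ p) {φ : E n ≃L[ℝ] E n}
    (hφ : HasFirstVariation p (expNeg u) (gaussian φ)) :
    ∫⁻ y, ENNReal.ofReal (halfSq (invAdjoint φ) y) ^ p ∂(surfaceMeasure p (expNeg u))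
        = ENNReal.ofReal (p * deltaJ p (expNeg u) (gaussian φ)) ∧
      0 ≤ deltaJ p (expNeg u) (gaussian φ) := by
  have hp0 : 0 < p := by linarith
  have D := hu.dualData hsupp
  obtain ⟨d, hd⟩ := hφ
  obtain ⟨κ, hκ⟩ := norm_le_mul_norm_invAdjoint φ
  have hdelta : deltaJ p (expNeg u) (gaussian φ) = d := hd.limUnder_eq
  have hd' := tendsto_quotient_of_tendsto_variationQuotient hu hp hd
  rw [lintegral_surfaceMeasure hu hsupp hp, D.lintegral_variationDensity_eq hp _ hκ hd', hdelta,
    ENNReal.ofReal_mul hp0.le]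
  -- Nonnegativity is needed because `ENNReal.ofReal` would send a negative variation to 0.
  refine ⟨rfl, ge_of_tendsto hd' ?_⟩
  filter_upwards [self_mem_nhdsWithin] with t ht
  have ht' : (0 : ℝ) < t := ht
  refine div_nonneg (sub_nonneg.2 (integral_mono D.integrable_f (D.integrable_lpSum hp _ ht'.le)
    fun x => D.le_env_lpSum hp _ ht'.le x)) ht'.le

/-- The surface area measure is not concentrated on a hyperplane. -/
theorem not_ae_inner_eq_zero {u : E n → EReal} (hu : IsL0 u)
    (hsupp : (interior (Function.support (expNeg u))).Nonempty) {p : ℝ}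
    (hp : 1 ≤ p) (hvar : ∀ φ : E n ≃L[ℝ] E n, HasFirstVariation p (expNeg u) (gaussian φ)) {v : E n}
    (hv : v ≠ 0) : ¬ ∀ᵐ y ∂(surfaceMeasure p (expNeg u)), inner ℝ v y = 0 := by
  have D := hu.dualData hsupp
  intro hzero
  refine D.not_ae_inner_gradNegLog_eq_zero hp ?_ hv ?_
  · rintro A ⟨κ, hκ⟩
    have hinj : Function.Injective A := by
      rw [injective_iff_map_eq_zero]
      intro y hy
      have := hκ y
      rw [hy, norm_zero, mul_zero] at this
      exact norm_le_zero_iff.1 this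
    obtain ⟨φ, hφA⟩ := exists_invAdjoint_eq (A := A) fun h =>
      (LinearMap.bot_lt_ker_of_det_eq_zero h).ne' (LinearMap.ker_eq_bot.2 hinj)
    obtain ⟨d, hd⟩ := hvar φ
    refine ⟨d, ?_⟩
    have := tendsto_quotient_of_tendsto_variationQuotient hu hp hd
    rwa [hφA] at this
  · rw [surfaceMeasure_eq D.f_nonneg, ae_map_iff (measurable_gradNegLog _).aemeasurable
      (measurableSet_eq_fun (by fun_prop) measurable_const),
      ae_withDensity_iff (measurable_surfaceDensity D.measurable_f p),
      ae_restrict_iff' (measurableSet_lt measurable_const D.measurable_f)] at hzero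
    filter_upwards [hzero, ae_toENNReal_supportFn hu hsupp] with x hx hx2 h0
    refine hx h0 ?_
    rw [hx2 h0]
    -- A finite base with exponent 1 - p ≤ 0 never gives 0, so the weight is nonzero wherever f is,
    -- and the hyperplane condition pulls back to Lebesgue measure.
    refine mul_ne_zero ?_ (by simpa using h0)
    rw [Ne, ENNReal.rpow_eq_zero_iff]
    simp only [ENNReal.ofReal_ne_top, false_and, or_false, not_and, not_lt]
    intro _
    linarith

/-! ### Minimizing the quadratic moment under a determinant constraint. -/

/-- The `p`-th moment of the quadratic form `‖A y‖² / 2`. -/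
def quadMoment (p : ℝ) (μ : Measure (E n)) (A : E n →L[ℝ] E n) : ℝ := ∫ y, halfSq A y ^ p ∂μ

theorem mul_rpow_sub_one {a p : ℝ} (ha : 0 ≤ a) (hp : 1 ≤ p) : a * a ^ (p - 1) = a ^ p := by
  have := Real.rpow_one_add' ha (y := p - 1) (by linarith)
  rw [← this, add_sub_cancel]

theorem halfSq_le (A : E n →L[ℝ] E n) (y : E n) : halfSq A y ≤ ‖A‖ ^ 2 / 2 * ‖y‖ ^ 2 := by
  have := pow_le_pow_left₀ (norm_nonneg _) (A.le_opNorm y) 2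
  unfold halfSq
  nlinarith

theorem halfSq_smul (r : ℝ) (A : E n →L[ℝ] E n) (y : E n) :
    halfSq (r • A) y = r ^ 2 * halfSq A y := by
  simp only [halfSq, smul_apply, norm_smul, mul_pow, Real.norm_eq_abs, sq_abs]
  ring

/-- Bernoulli's inequality at b/a. At a = 0 and p = 1 the convention 0^0 = 1 gives the right value.
-/
theorem tangent_le_rpow {a b p : ℝ} (ha : 0 ≤ a) (hb : 0 ≤ b) (hp : 1 ≤ p) :
    a ^ p + p * (b * a ^ (p - 1) - a ^ p) ≤ b ^ p := by
  rcases ha.eq_or_lt with rfl | ha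
  · rcases hp.eq_or_lt with rfl | hp
    · simp
    · rw [Real.zero_rpow (by linarith), Real.zero_rpow (by linarith)]
      simpa using Real.rpow_nonneg hb p
  · have h := one_add_mul_self_le_rpow_one_add (s := b / a - 1)
      (by have := div_nonneg hb ha.le; linarith) hp
    rw [add_sub_cancel, Real.div_rpow hb ha.le, le_div_iff₀ (Real.rpow_pos_of_pos ha p)] at h
    have h2 := mul_rpow_sub_one ha.le hp
    refine le_trans (le_of_eq ?_) h
    rw [← h2]
    field_simp

section Moments

variable {p : ℝ} {μ : Measure (E n)}

theorem integrable_rpow_of_le (hp : 1 ≤ p) (hμ : Integrable (fun y => (‖y‖ ^ 2) ^ p) μ)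
    {q : E n → ℝ} (hq : Measurable q) (h0 : ∀ y, 0 ≤ q y) {C : ℝ} (hC : ∀ y, q y ≤ C * ‖y‖ ^ 2) :
    Integrable (fun y => q y ^ p) μ := by
  refine (hμ.const_mul (|C| ^ p)).mono' (hq.pow_const p).aestronglyMeasurable
    (Eventually.of_forall fun y => ?_)
  rw [Real.norm_of_nonneg (Real.rpow_nonneg (h0 y) p),
    ← Real.mul_rpow (abs_nonneg _) (sq_nonneg _)]
  exact Real.rpow_le_rpow (h0 y)
    ((hC y).trans (mul_le_mul_of_nonneg_right (le_abs_self C) (sq_nonneg _))) (by linarith)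

theorem integrable_mul_rpow_of_le (hp : 1 ≤ p) (hμ : Integrable (fun y => (‖y‖ ^ 2) ^ p) μ)
    {q r : E n → ℝ} (hq : Measurable q) (hr : Measurable r) (hr0 : ∀ y, 0 ≤ r y) {C K : ℝ}
    (hC : ∀ y, |q y| ≤ C * ‖y‖ ^ 2) (hK : ∀ y, r y ≤ K * ‖y‖ ^ 2) :
    Integrable (fun y => q y * r y ^ (p - 1)) μ := by
  refine (hμ.const_mul (|C| * |K| ^ (p - 1))).mono'
    (hq.mul (hr.pow_const _)).aestronglyMeasurable (Eventually.of_forall fun y => ?_)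
  rw [norm_mul, Real.norm_eq_abs, Real.norm_of_nonneg (Real.rpow_nonneg (hr0 y) _),
    ← mul_rpow_sub_one (sq_nonneg ‖y‖) hp, mul_mul_mul_comm,
    ← Real.mul_rpow (abs_nonneg _) (sq_nonneg _)]
  have h1 := (hC y).trans (mul_le_mul_of_nonneg_right (le_abs_self C) (sq_nonneg _))
  have h2 := (hK y).trans (mul_le_mul_of_nonneg_right (le_abs_self K) (sq_nonneg _))
  exact mul_le_mul h1 (Real.rpow_le_rpow (hr0 y) h2 (by linarith))
    (Real.rpow_nonneg (hr0 y) _) (by positivity)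

theorem integrable_halfSq_rpow (hp : 1 ≤ p) (hμ : Integrable (fun y => (‖y‖ ^ 2) ^ p) μ)
    (A : E n →L[ℝ] E n) : Integrable (fun y => halfSq A y ^ p) μ :=
  integrable_rpow_of_le hp hμ (continuous_halfSq A).measurable (halfSq_nonneg A) (halfSq_le A)

theorem inner_sq_le (x z : E n) : inner ℝ x z ^ 2 ≤ ‖z‖ ^ 2 * ‖x‖ ^ 2 := by
  rw [← mul_pow, mul_comm ‖z‖]
  exact sq_le_sq' (by linarith [neg_abs_le (inner ℝ x z : ℝ), abs_real_inner_le_norm x z])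
    (real_inner_le_norm x z)

theorem integrable_inner_sq_mul (hp : 1 ≤ p) (hμ : Integrable (fun y => (‖y‖ ^ 2) ^ p) μ)
    (A : E n →L[ℝ] E n) (z : E n) :
    Integrable (fun y => inner ℝ y z ^ 2 * halfSq A y ^ (p - 1)) μ :=
  integrable_mul_rpow_of_le hp hμ (by fun_prop) (continuous_halfSq A).measurable
    (halfSq_nonneg A) (C := ‖z‖ ^ 2)
    (fun y => (abs_of_nonneg (sq_nonneg _)).trans_le (inner_sq_le y z)) (halfSq_le A)

theorem quadMoment_nonneg (A : E n →L[ℝ] E n) : 0 ≤ quadMoment p μ A :=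
  integral_nonneg fun y => Real.rpow_nonneg (halfSq_nonneg A y) p

theorem quadMoment_smul {r : ℝ} (hr : 0 ≤ r) (A : E n →L[ℝ] E n) :
    quadMoment p μ (r • A) = r ^ (2 * p) * quadMoment p μ A := by
  simp only [quadMoment]
  rw [← integral_const_mul]
  congr 1 with y
  rw [halfSq_smul, Real.mul_rpow (sq_nonneg r) (halfSq_nonneg A y), Real.rpow_mul hr,
    Real.rpow_two]

theorem continuous_quadMoment (hp : 1 ≤ p) (hμ : Integrable (fun y => (‖y‖ ^ 2) ^ p) μ) :
    Continuous (quadMoment p μ) := by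
  rw [continuous_iff_continuousAt]
  intro A
  refine continuousAt_of_dominated
    (bound := fun y => ((‖A‖ + 1) ^ 2 / 2 * ‖y‖ ^ 2) ^ p) ?_ ?_ ?_ ?_
  · exact Eventually.of_forall fun B =>
      ((continuous_halfSq B).measurable.pow_const p).aestronglyMeasurable
  · filter_upwards [Metric.ball_mem_nhds A one_pos] with B hB
    refine Eventually.of_forall fun y => ?_
    have hB' : ‖B‖ ≤ ‖A‖ + 1 := by
      have h1 := norm_le_norm_add_norm_sub' B A
      have h2 : ‖B - A‖ < 1 := by simpa [dist_eq_norm] using hB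
      linarith
    rw [Real.norm_of_nonneg (Real.rpow_nonneg (halfSq_nonneg B y) p)]
    refine Real.rpow_le_rpow (halfSq_nonneg B y) ((halfSq_le B y).trans ?_) (by linarith)
    gcongr
  · exact integrable_rpow_of_le hp hμ (by fun_prop) (fun y => by positivity) fun y => le_rfl
  · refine Eventually.of_forall fun y => ContinuousAt.rpow_const ?_ (Or.inr (by linarith))
    unfold halfSq
    fun_prop

/-- A vanishing moment forces A y = 0 almost everywhere, so the measure lives on the hyperplane
orthogonal to any nonzero A†w. -/
theorem quadMoment_pos (hp : 1 ≤ p) (hμ : Integrable (fun y => (‖y‖ ^ 2) ^ p) μ)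
    (hnd : ∀ v : E n, v ≠ 0 → ¬ ∀ᵐ y ∂μ, inner ℝ v y = 0) {A : E n →L[ℝ] E n} (hA : A ≠ 0) :
    0 < quadMoment p μ A := by
  refine (quadMoment_nonneg A).lt_of_ne' fun h => ?_
  rw [quadMoment, integral_eq_zero_iff_of_nonneg
    (fun y => Real.rpow_nonneg (halfSq_nonneg A y) p) (integrable_halfSq_rpow hp hμ A)] at h
  have hA' : A.adjoint ≠ 0 := fun h' => hA (by rw [← A.adjoint_adjoint, h', map_zero])
  obtain ⟨w, hw⟩ : ∃ w, A.adjoint w ≠ 0 := by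
    by_contra! h'
    exact hA' (ContinuousLinearMap.ext h')
  refine hnd _ hw ?_
  filter_upwards [h] with y hy
  have hy' : halfSq A y = 0 :=
    (Real.rpow_eq_zero (halfSq_nonneg A y) (by linarith)).1 hy
  have : A y = 0 := by
    rw [← norm_eq_zero]
    unfold halfSq at hy'
    nlinarith
  rw [ContinuousLinearMap.adjoint_inner_left, this, inner_zero_right]

/-- The constant is the minimum over the compact unit sphere of operators; homogeneity does the
rest. The bound supplies the coercivity used for existence. -/
theorem exists_mul_rpow_le_quadMoment (hn : 1 ≤ n) (hp : 1 ≤ p)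
    (hμ : Integrable (fun y => (‖y‖ ^ 2) ^ p) μ)
    (hnd : ∀ v : E n, v ≠ 0 → ¬ ∀ᵐ y ∂μ, inner ℝ v y = 0) :
    ∃ c > 0, ∀ A : E n →L[ℝ] E n, c * ‖A‖ ^ (2 * p) ≤ quadMoment p μ A := by
  have : Nonempty (Fin n) := ⟨⟨0, hn⟩⟩
  have : Nontrivial (E n →L[ℝ] E n) := inferInstance
  have : ProperSpace (E n →L[ℝ] E n) := FiniteDimensional.proper ℝ _
  obtain ⟨A₀, hA₀, hmin⟩ := (isCompact_sphere (0 : E n →L[ℝ] E n) 1).exists_isMinOn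
    (NormedSpace.sphere_nonempty.2 zero_le_one) (continuous_quadMoment hp hμ).continuousOn
  have hA₀' : A₀ ≠ 0 := by
    rintro rfl
    simp at hA₀
  refine ⟨_, quadMoment_pos hp hμ hnd hA₀', fun A => ?_⟩
  by_cases hA : A = 0
  · rw [hA, norm_zero, Real.zero_rpow (by linarith), mul_zero]
    exact quadMoment_nonneg _
  · have hA' : ‖A‖ ≠ 0 := norm_ne_zero_iff.2 hA
    have h1 : (‖A‖⁻¹ • A) ∈ Metric.sphere (0 : E n →L[ℝ] E n) 1 := by
      simp [norm_smul, hA']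
    have h2 : A = ‖A‖ • (‖A‖⁻¹ • A) := by rw [smul_smul, mul_inv_cancel₀ hA', one_smul]
    conv_rhs => rw [h2, quadMoment_smul (norm_nonneg A), mul_comm]
    exact mul_le_mul_of_nonneg_right (hmin h1) (by positivity)

/-- Existence of a minimizer under the volume constraint. -/
theorem exists_isMinOn_quadMoment (hn : 1 ≤ n) (hp : 1 ≤ p)
    (hμ : Integrable (fun y => (‖y‖ ^ 2) ^ p) μ)
    (hnd : ∀ v : E n, v ≠ 0 → ¬ ∀ᵐ y ∂μ, inner ℝ v y = 0) :
    ∃ A : E n →L[ℝ] E n, 1 ≤ |A.det| ∧ IsMinOn (quadMoment p μ) {B | 1 ≤ |B.det|} A := by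
  have : ProperSpace (E n →L[ℝ] E n) := FiniteDimensional.proper ℝ _
  obtain ⟨c, hc, hle⟩ := exists_mul_rpow_le_quadMoment hn hp hμ hnd
  have hclosed : IsClosed {B : E n →L[ℝ] E n | 1 ≤ |B.det|} :=
    isClosed_le continuous_const ContinuousLinearMap.continuous_det.abs
  have hid : ContinuousLinearMap.id ℝ (E n) ∈ {B : E n →L[ℝ] E n | 1 ≤ |B.det|} := by
    have : (ContinuousLinearMap.id ℝ (E n)).det = 1 := LinearMap.det_id
    simp [this]
  have htend : Tendsto (quadMoment p μ) (cocompact (E n →L[ℝ] E n)) atTop := by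
    refine tendsto_atTop_mono hle (Tendsto.const_mul_atTop hc ?_)
    exact (tendsto_rpow_atTop (by linarith)).comp tendsto_norm_cocompact_atTop
  obtain ⟨A, hA, hmin⟩ := (continuous_quadMoment hp hμ).continuousOn.exists_isMinOn' hclosed hid
    ((htend.eventually_ge_atTop _).filter_mono inf_le_left)
  exact ⟨A, hA, hmin⟩

/-- Scaling A by r = |det A|^{-1/n} stays feasible and multiplies the positive moment by r^{2p};
minimality forces r ≥ 1. -/
theorem abs_det_eq_one_of_isMinOn (hn : 1 ≤ n) (hp : 1 ≤ p)
    (hμ : Integrable (fun y => (‖y‖ ^ 2) ^ p) μ)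
    (hnd : ∀ v : E n, v ≠ 0 → ¬ ∀ᵐ y ∂μ, inner ℝ v y = 0) {A : E n →L[ℝ] E n}
    (hA : 1 ≤ |A.det|) (hmin : IsMinOn (quadMoment p μ) {B | 1 ≤ |B.det|} A) : |A.det| = 1 := by
  have hA0 : A ≠ 0 := by
    rintro rfl
    have : (0 : E n →L[ℝ] E n).det = 0 := by
      refine (LinearMap.det_zero (A := ℝ) (M := E n)).trans ?_
      rw [finrank_euclideanSpace_fin, zero_pow (by omega)]
    rw [this, abs_zero] at hA
    linarith
  have hpos := quadMoment_pos hp hμ hnd hA0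
  have hd : 0 < |A.det| := by linarith
  have hn0 : (n : ℝ) ≠ 0 := by exact_mod_cast (by omega : n ≠ 0)
  set r := |A.det| ^ (-(1 / (n : ℝ))) with hr
  have hr0 : 0 ≤ r := by positivity
  have hrn : r ^ n = |A.det|⁻¹ := by
    rw [hr, ← Real.rpow_natCast, ← Real.rpow_mul hd.le, neg_mul, one_div_mul_cancel hn0,
      Real.rpow_neg_one]
  have hfeas : (r • A) ∈ {B : E n →L[ℝ] E n | 1 ≤ |B.det|} := by
    rw [mem_ofPred_eq, det_smul, hrn, abs_mul, abs_inv, abs_abs, inv_mul_cancel₀ hd.ne']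
  have h1 : quadMoment p μ A ≤ r ^ (2 * p) * quadMoment p μ A := by
    rw [← quadMoment_smul hr0]
    exact hmin hfeas
  have h2 : 1 ≤ r ^ (2 * p) := le_of_mul_le_mul_right (by rwa [one_mul]) hpos
  have h3 : 1 ≤ r := by
    by_contra! h
    linarith [Real.rpow_lt_one hr0 h (show 0 < 2 * p by linarith)]
  have h4 : 1 ≤ |A.det|⁻¹ := hrn ▸ one_le_pow₀ h3
  exact le_antisymm ((one_le_inv₀ hd).1 h4) hA

end Moments

theorem halfSq_stretch_comp (w : E n) (c : ℝ) (A : E n →L[ℝ] E n) (y : E n) :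
    halfSq (stretch w c ∘L A) y = halfSq A y + (c + c ^ 2 * ‖w‖ ^ 2 / 2) * inner ℝ w (A y) ^ 2 := by
  simp only [halfSq, ContinuousLinearMap.comp_apply, norm_stretch_sq]
  ring

section Moments

variable {p : ℝ} {μ : Measure (E n)}

/-- Differentiation under the integral, with the (2p)-th moment as majorant. Symmetric rank-one
directions suffice, as the target equation is between quadratic forms. -/
theorem hasDerivAt_quadMoment_stretch (hp : 1 ≤ p)
    (hμ : Integrable (fun y => (‖y‖ ^ 2) ^ p) μ) (A : E n →L[ℝ] E n) (w : E n) :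
    HasDerivAt (fun c => quadMoment p μ (stretch w c ∘L A))
      (p * ∫ y, inner ℝ y (A.adjoint w) ^ 2 * halfSq A y ^ (p - 1) ∂μ) 0 := by
  have hin : ∀ y, inner ℝ w (A y) = inner ℝ y (A.adjoint w) := fun y => by
    rw [ContinuousLinearMap.adjoint_inner_right, real_inner_comm]
  set z := A.adjoint w with hz
  set K := ‖A‖ ^ 2 / 2 + (1 + ‖w‖ ^ 2) * ‖z‖ ^ 2 with hK
  have hle : ∀ y, ∀ c ∈ Metric.ball (0 : ℝ) 1, halfSq (stretch w c ∘L A) y ≤ K * ‖y‖ ^ 2 := by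
    intro y c hc
    rw [mem_ball_zero_iff, Real.norm_eq_abs, abs_lt] at hc
    rw [halfSq_stretch_comp, hin, hK, add_mul (‖A‖ ^ 2 / 2), mul_assoc (1 + _)]
    refine add_le_add (halfSq_le A y) (mul_le_mul ?_ (inner_sq_le y z) (sq_nonneg _) (by positivity))
    have hc2 : c ^ 2 ≤ 1 := by nlinarith
    linarith [mul_le_mul_of_nonneg_right hc2 (sq_nonneg ‖w‖), sq_nonneg ‖w‖]
  have key := hasDerivAt_integral_of_dominated_loc_of_deriv_le (μ := μ) (x₀ := (0 : ℝ))
    (s := Metric.ball 0 1) (F := fun c y => halfSq (stretch w c ∘L A) y ^ p)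
    (F' := fun c y => ((1 + c * ‖w‖ ^ 2) * inner ℝ y z ^ 2) * p
      * halfSq (stretch w c ∘L A) y ^ (p - 1))
    (bound := fun y => ((1 + ‖w‖ ^ 2) * inner ℝ y z ^ 2) * p * (K * ‖y‖ ^ 2) ^ (p - 1))
    (Metric.ball_mem_nhds 0 one_pos) ?_ ?_ ?_ ?_ ?_ ?_
  · refine key.2.congr_deriv ?_
    rw [← integral_const_mul]
    congr 1 with y
    rw [halfSq_stretch_comp]
    simp only [zero_mul, add_zero, one_mul, ne_eq, OfNat.ofNat_ne_zero, not_false_eq_true, zero_pow,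
      zero_div]
    ring
  · exact Eventually.of_forall fun c =>
      ((continuous_halfSq _).measurable.pow_const p).aestronglyMeasurable
  · exact integrable_halfSq_rpow hp hμ _
  · have h1 : Measurable fun y => (1 + 0 * ‖w‖ ^ 2) * inner ℝ y z ^ 2 * p := by fun_prop
    exact (h1.mul ((continuous_halfSq _).measurable.pow_const _)).aestronglyMeasurable
  · refine Eventually.of_forall fun y c hc => ?_
    have h2 := hle y c hc
    rw [mem_ball_zero_iff, Real.norm_eq_abs] at hc
    have h1 : |1 + c * ‖w‖ ^ 2| ≤ 1 + ‖w‖ ^ 2 := by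
      refine (abs_add_le _ _).trans ?_
      rw [abs_one, abs_mul, abs_of_nonneg (sq_nonneg ‖w‖)]
      nlinarith [sq_nonneg ‖w‖]
    rw [norm_mul, norm_mul, norm_mul, Real.norm_eq_abs, Real.norm_of_nonneg (sq_nonneg _),
      Real.norm_of_nonneg (by linarith : 0 ≤ p),
      Real.norm_of_nonneg (Real.rpow_nonneg (halfSq_nonneg _ y) _)]
    have h3 := Real.rpow_le_rpow (halfSq_nonneg _ y) h2 (by linarith : 0 ≤ p - 1)
    have h4 := Real.rpow_nonneg (halfSq_nonneg (stretch w c ∘L A) y) (p - 1)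
    gcongr
  · refine integrable_mul_rpow_of_le hp hμ (by fun_prop) (by fun_prop) (fun y => by positivity)
      (C := (1 + ‖w‖ ^ 2) * p * ‖z‖ ^ 2) (fun y => ?_) fun y => le_rfl
    rw [abs_of_nonneg (by positivity)]
    have := mul_le_mul_of_nonneg_left (inner_sq_le y z)
      (by positivity : 0 ≤ (1 + ‖w‖ ^ 2) * p)
    linarith
  · refine Eventually.of_forall fun y c _ => ?_
    have h1 : HasDerivAt (fun c => halfSq (stretch w c ∘L A) y)
        ((1 + c * ‖w‖ ^ 2) * inner ℝ y z ^ 2) c := by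
      simp only [halfSq_stretch_comp, hin]
      have h2 : HasDerivAt (fun c : ℝ => c + c ^ 2 * ‖w‖ ^ 2 / 2) (1 + c * ‖w‖ ^ 2) c := by
        refine ((hasDerivAt_id c).add
          (((hasDerivAt_pow 2 c).mul_const (‖w‖ ^ 2)).div_const 2)).congr_deriv ?_
        push_cast
        ring
      exact (h2.mul_const _).const_add _
    exact h1.rpow_const (Or.inr hp)

/-- The Euler–Lagrange equation of the constrained minimization problem. -/
theorem integral_inner_sq_eq_of_isMinOn (hn : 1 ≤ n) (hp : 1 ≤ p)
    (hμ : Integrable (fun y => (‖y‖ ^ 2) ^ p) μ) {A : E n →L[ℝ] E n} (hA : |A.det| = 1)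
    (hmin : IsMinOn (quadMoment p μ) {B | 1 ≤ |B.det|} A) (w : E n) :
    ∫ y, inner ℝ y (A.adjoint w) ^ 2 * halfSq A y ^ (p - 1) ∂μ
      = 2 / n * ‖w‖ ^ 2 * quadMoment p μ A := by
  have hn0 : (n : ℝ) ≠ 0 := by exact_mod_cast (by omega : n ≠ 0)
  have hst : stretch w 0 ∘L A = A := by ext1 y; simp [stretch_apply]
  have hd : HasDerivAt (fun c : ℝ => (1 + c * ‖w‖ ^ 2) ^ (2 * p / n)) (2 * p / n * ‖w‖ ^ 2) 0 := by
    have h1 : HasDerivAt (fun c : ℝ => 1 + c * ‖w‖ ^ 2) (‖w‖ ^ 2) 0 := by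
      simpa using ((hasDerivAt_id (0 : ℝ)).mul_const (‖w‖ ^ 2)).const_add 1
    refine (h1.rpow_const (p := 2 * p / n) (Or.inl (by simp))).congr_deriv ?_
    simp
    ring
  have hD := (hasDerivAt_quadMoment_stretch hp hμ A w).sub (hd.mul_const (quadMoment p μ A))
  -- Homogeneity removes the constraint: dividing by the n-th root of the determinant s makes every
  -- nearby stretch feasible, so this difference is nonnegative and vanishes at c = 0.
  have hloc : IsLocalMin ((fun c => quadMoment p μ (stretch w c ∘L A))
      - fun c : ℝ => (1 + c * ‖w‖ ^ 2) ^ (2 * p / n) * quadMoment p μ A) 0 := by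
    have hev : ∀ᶠ c : ℝ in 𝓝 0, 0 < 1 + c * ‖w‖ ^ 2 := by
      have : ContinuousAt (fun c : ℝ => 1 + c * ‖w‖ ^ 2) 0 := by fun_prop
      exact this.eventually_const_lt (by simp)
    filter_upwards [hev] with c hc
    simp only [Pi.sub_apply, hst, zero_mul, add_zero, Real.one_rpow, one_mul, sub_self]
    rw [sub_nonneg]
    set s := 1 + c * ‖w‖ ^ 2 with hs
    set r := s ^ (-(1 / (n : ℝ))) with hr
    have hr0 : 0 < r := Real.rpow_pos_of_pos hc _
    have hrn : r ^ n = s⁻¹ := by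
      rw [hr, ← Real.rpow_natCast, ← Real.rpow_mul hc.le, neg_mul, one_div_mul_cancel hn0,
        Real.rpow_neg_one]
    have hfeas : (r • (stretch w c ∘L A)) ∈ {B : E n →L[ℝ] E n | 1 ≤ |B.det|} := by
      rw [mem_ofPred_eq, det_smul, hrn, det_comp, det_stretch, ← hs, inv_mul_cancel_left₀ hc.ne',
        hA]
    have h1 : quadMoment p μ A ≤ r ^ (2 * p) * quadMoment p μ (stretch w c ∘L A) := by
      rw [← quadMoment_smul hr0.le]
      exact hmin hfeas
    have h2 : s ^ (2 * p / n) * r ^ (2 * p) = 1 := by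
      rw [hr, ← Real.rpow_mul hc.le, ← Real.rpow_add hc]
      rw [show 2 * p / n + -(1 / (n : ℝ)) * (2 * p) = 0 by ring, Real.rpow_zero]
    calc s ^ (2 * p / n) * quadMoment p μ A
        ≤ s ^ (2 * p / n) * (r ^ (2 * p) * quadMoment p μ (stretch w c ∘L A)) :=
          mul_le_mul_of_nonneg_left h1 (Real.rpow_nonneg hc.le _)
      _ = quadMoment p μ (stretch w c ∘L A) := by rw [← mul_assoc, h2, one_mul]
  have h0 := hloc.hasDerivAt_eq_zero hD
  have hp0 : p ≠ 0 := by linarith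
  refine mul_left_cancel₀ hp0 ?_
  rw [sub_eq_zero.1 h0]
  ring

/-- Parseval, arranged so that the Euler–Lagrange equation can be applied with z = ψ^{-1}e_i. -/
theorem halfSq_invAdjoint_eq_sum (ψ : E n ≃L[ℝ] E n) (y : E n) :
    halfSq (invAdjoint ψ) y
      = ∑ i, inner ℝ y (ψ.symm (EuclideanSpace.basisFun (Fin n) ℝ i)) ^ 2 / 2 := by
  have := (EuclideanSpace.basisFun (Fin n) ℝ).sum_sq_inner_right (invAdjoint ψ y)
  rw [halfSq, ← this, Finset.sum_div]
  refine Finset.sum_congr rfl fun i _ => ?_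
  rw [invAdjoint, ContinuousLinearMap.adjoint_inner_right, real_inner_comm]
  rfl

/-- The Euler–Lagrange equation is sufficient, and the minimizer is unique up to isometries. -/
theorem quadMoment_le_of_integral_inner_sq_eq (hn : 1 ≤ n) (hp : 1 ≤ p)
    (hμ : Integrable (fun y => (‖y‖ ^ 2) ^ p) μ) {φ ψ : E n ≃L[ℝ] E n}
    (hpos : 0 < quadMoment p μ (invAdjoint φ))
    (hφ : |(invAdjoint φ).det| = 1) (hψ : 1 ≤ |(invAdjoint ψ).det|)
    (heq : ∀ z, ∫ y, inner ℝ y z ^ 2 * halfSq (invAdjoint φ) y ^ (p - 1) ∂μ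
      = 2 / n * ‖φ z‖ ^ 2 * quadMoment p μ (invAdjoint φ)) :
    quadMoment p μ (invAdjoint φ) ≤ quadMoment p μ (invAdjoint ψ) ∧
      (quadMoment p μ (invAdjoint ψ) ≤ quadMoment p μ (invAdjoint φ) → ∀ x, ‖φ x‖ = ‖ψ x‖) := by
  set A := invAdjoint φ with hA
  set B := invAdjoint ψ with hB
  set P : E n →L[ℝ] E n := (φ : E n →L[ℝ] E n) ∘L (ψ.symm : E n →L[ℝ] E n) with hP
  set b := EuclideanSpace.basisFun (Fin n) ℝ
  have hn0 : (0 : ℝ) < n := by exact_mod_cast hn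
  have hdet : 1 ≤ |P.det| := by
    have h1 : (ψ.symm : E n →L[ℝ] E n).det = B.det := (det_adjoint (det_ne_zero ψ.symm)).symm
    have h2 := congrArg abs (det_mul_det_invAdjoint φ)
    rw [abs_mul, ← hA, hφ, mul_one, abs_one] at h2
    rwa [hP, det_comp, h1, abs_mul, h2, one_mul]
  obtain ⟨hsum, hiso⟩ := card_le_sum_norm_sq hdet
  set s := ∑ i, ‖P (b i)‖ ^ 2 with hs
  have hint : Integrable (fun y => halfSq B y * halfSq A y ^ (p - 1)) μ :=
    integrable_mul_rpow_of_le hp hμ (continuous_halfSq B).measurable (continuous_halfSq A).measurable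
      (halfSq_nonneg A) (fun y => (abs_of_nonneg (halfSq_nonneg B y)).trans_le (halfSq_le B y))
      (halfSq_le A)
  -- Summing the Euler–Lagrange equation over z = ψ^{-1}e_i produces s, the squared Hilbert–Schmidt
  -- norm of P = φψ^{-1}; the arithmetic–geometric mean inequality gives s ≥ n.
  have hmixed : ∫ y, halfSq B y * halfSq A y ^ (p - 1) ∂μ = s / n * quadMoment p μ A := by
    have h1 : ∀ y, halfSq B y * halfSq A y ^ (p - 1)
        = ∑ i, 1 / 2 * (inner ℝ y (ψ.symm (b i)) ^ 2 * halfSq A y ^ (p - 1)) := fun y => by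
      rw [hB, halfSq_invAdjoint_eq_sum, Finset.sum_mul]
      exact Finset.sum_congr rfl fun i _ => by ring
    simp_rw [h1]
    rw [integral_finsetSum _ fun i _ => (integrable_inner_sq_mul hp hμ A _).const_mul _]
    simp_rw [integral_const_mul, heq]
    rw [hs, Finset.sum_div, Finset.sum_mul]
    refine Finset.sum_congr rfl fun i _ => ?_
    rw [hP, ContinuousLinearMap.comp_apply]
    simp only [ContinuousLinearEquiv.coe_coe]
    ring
  have hA' := integrable_halfSq_rpow hp hμ A
  have htangent : quadMoment p μ A + p * (s / n * quadMoment p μ A - quadMoment p μ A)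
      ≤ quadMoment p μ B := by
    rw [← hmixed]
    simp only [quadMoment]
    have hdiff : Integrable (fun y => p * (halfSq B y * halfSq A y ^ (p - 1) - halfSq A y ^ p)) μ :=
      (hint.sub hA').const_mul p
    rw [← integral_sub hint hA', ← integral_const_mul, ← integral_add hA' hdiff]
    exact integral_mono (hA'.add hdiff) (integrable_halfSq_rpow hp hμ B)
      fun y => tangent_le_rpow (halfSq_nonneg A y) (halfSq_nonneg B y) hp
  have hfac : quadMoment p μ A + p * (s / n * quadMoment p μ A - quadMoment p μ A)
      = quadMoment p μ A + p * quadMoment p μ A * (s / n - 1) := by ring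
  rw [hfac] at htangent
  have hpp : 0 < p * quadMoment p μ A := mul_pos (by linarith) hpos
  refine ⟨?_, fun h x => ?_⟩
  · have : 0 ≤ s / n - 1 := by rw [sub_nonneg, one_le_div hn0]; exact hsum
    nlinarith [mul_nonneg hpp.le this]
  · have h1 : p * quadMoment p μ A * (s / n - 1) ≤ 0 := by linarith
    have h2 : s / n - 1 ≤ 0 := by
      by_contra! h2
      linarith [mul_pos hpp h2]
    have h3 : s ≤ n := by rwa [sub_nonpos, div_le_one hn0] at h2
    have := hiso h3 (ψ x)
    rwa [hP, ContinuousLinearMap.comp_apply, ContinuousLinearEquiv.coe_coe,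
      ContinuousLinearEquiv.coe_coe, ψ.symm_apply_apply] at this

end Moments

/-! ### Solutions of the dual problem. -/

theorem gaussian_eq_of_norm_eq {φ ψ : E n ≃L[ℝ] E n} (h : ∀ x, ‖φ x‖ = ‖ψ x‖) :
    gaussian φ = gaussian ψ := by
  funext x
  rw [gaussian, gaussian, h]

theorem invAdjoint_ne_zero (hn : 1 ≤ n) (φ : E n ≃L[ℝ] E n) : invAdjoint φ ≠ 0 := by
  have : Nonempty (Fin n) := ⟨⟨0, hn⟩⟩
  obtain ⟨x, hx⟩ := exists_ne (0 : E n)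
  intro h
  have := adjoint_invAdjoint_apply φ x
  rw [h, zero_apply] at this
  exact hx this.symm

section Solution

variable {u : E n → EReal} {p : ℝ}

theorem quadMoment_surfaceMeasure (hu : IsL0 u)
    (hsupp : (interior (Function.support (expNeg u))).Nonempty) (hp : 1 ≤ p) {φ : E n ≃L[ℝ] E n}
    (hφ : HasFirstVariation p (expNeg u) (gaussian φ)) :
    quadMoment p (surfaceMeasure p (expNeg u)) (invAdjoint φ)
      = p * deltaJ p (expNeg u) (gaussian φ) := by
  have hp0 : 0 ≤ p := by linarith
  obtain ⟨h1, h2⟩ := lintegral_surfaceMeasure_eq hu hsupp hp hφ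
  rw [quadMoment, integral_eq_lintegral_of_nonneg_ae
    (Eventually.of_forall fun y => Real.rpow_nonneg (halfSq_nonneg _ y) p)
    ((continuous_halfSq _).measurable.pow_const p).aestronglyMeasurable]
  simp_rw [← ENNReal.ofReal_rpow_of_nonneg (halfSq_nonneg _ _) hp0]
  rw [h1, ENNReal.toReal_ofReal (mul_nonneg hp0 h2)]

/-- The finite first variation along the standard Gaussian is, by the integral formula, a finite
moment of order 2p. -/
theorem integrable_norm_sq_rpow_surfaceMeasure (hu : IsL0 u)
    (hsupp : (interior (Function.support (expNeg u))).Nonempty) (hp : 1 ≤ p)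
    (hvar : HasFirstVariation p (expNeg u) (gaussian (ContinuousLinearEquiv.refl ℝ (E n)))) :
    Integrable (fun y => (‖y‖ ^ 2) ^ p) (surfaceMeasure p (expNeg u)) := by
  have hp0 : 0 ≤ p := by linarith
  have h1 := (lintegral_surfaceMeasure_eq hu hsupp hp hvar).1
  set A := invAdjoint (ContinuousLinearEquiv.refl ℝ (E n)) with hA
  have hAy : ∀ y, ‖y‖ ^ 2 = 2 * halfSq A y := fun y => by
    have : A y = y := ext_inner_left ℝ fun x =>
      (inner_eq_inner_invAdjoint (ContinuousLinearEquiv.refl ℝ (E n)) x y).symm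
    rw [halfSq, this]
    ring
  have h2 : Integrable (fun y => halfSq A y ^ p) (surfaceMeasure p (expNeg u)) := by
    refine ⟨((continuous_halfSq _).measurable.pow_const p).aestronglyMeasurable, ?_⟩
    rw [hasFiniteIntegral_iff_ofReal
      (Eventually.of_forall fun y => Real.rpow_nonneg (halfSq_nonneg _ y) p)]
    simp_rw [← ENNReal.ofReal_rpow_of_nonneg (halfSq_nonneg _ _) hp0]
    rw [h1]
    exact ENNReal.ofReal_lt_top
  simp_rw [hAy, Real.mul_rpow zero_le_two (halfSq_nonneg A _)]
  exact h2.const_mul _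

/-- Dividing by the positive J(f^⋄) and taking the 1/p-th power preserve the order of nonnegative
numbers. -/
theorem normDeltaJ_le_iff (hu : IsL0 u)
    (hsupp : (interior (Function.support (expNeg u))).Nonempty) (hp : 1 ≤ p)
    (hdiamond : 0 < diamondMass (expNeg u))
    (hvar : ∀ φ : E n ≃L[ℝ] E n, HasFirstVariation p (expNeg u) (gaussian φ))
    (φ ψ : E n ≃L[ℝ] E n) :
    normDeltaJ p (expNeg u) (gaussian φ) ≤ normDeltaJ p (expNeg u) (gaussian ψ) ↔
      quadMoment p (surfaceMeasure p (expNeg u)) (invAdjoint φ)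
        ≤ quadMoment p (surfaceMeasure p (expNeg u)) (invAdjoint ψ) := by
  have hp0 : 0 < 1 / p := by positivity
  rw [normDeltaJ, normDeltaJ, ← quadMoment_surfaceMeasure hu hsupp hp (hvar φ),
    ← quadMoment_surfaceMeasure hu hsupp hp (hvar ψ),
    Real.rpow_le_rpow_iff (div_nonneg (quadMoment_nonneg _) hdiamond.le)
      (div_nonneg (quadMoment_nonneg _) hdiamond.le) hp0, div_le_div_iff_of_pos_right hdiamond]

theorem solvesDual_gaussian_iff (hu : IsL0 u)
    (hsupp : (interior (Function.support (expNeg u))).Nonempty) (hp : 1 ≤ p)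
    (hdiamond : 0 < diamondMass (expNeg u))
    (hvar : ∀ φ : E n ≃L[ℝ] E n, HasFirstVariation p (expNeg u) (gaussian φ))
    (φ : E n ≃L[ℝ] E n) :
    SolvesDual p (expNeg u) (gaussian φ) ↔ 1 ≤ |(invAdjoint φ).det| ∧
      IsMinOn (quadMoment p (surfaceMeasure p (expNeg u))) {B | 1 ≤ |B.det|} (invAdjoint φ) := by
  rw [SolvesDual, one_le_totalMass_gaussian_iff]
  simp only [one_le_totalMass_gaussian_iff, normDeltaJ_le_iff hu hsupp hp hdiamond hvar]
  refine ⟨fun ⟨_, h1, h2⟩ => ⟨h1, fun B hB => ?_⟩, fun ⟨h1, h2⟩ => ⟨⟨φ, rfl⟩, h1, fun ψ hψ => h2 hψ⟩⟩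
  have hB' : 1 ≤ |B.det| := hB
  obtain ⟨ψ, rfl⟩ := exists_invAdjoint_eq (A := B) fun h => by
    rw [h, abs_zero] at hB'
    linarith
  exact h2 ψ hB

/-- Characterization of the solutions by the Euler–Lagrange equation. -/
theorem solvesDual_gaussian_iff_integral (hn : 1 ≤ n) (hu : IsL0 u)
    (hsupp : (interior (Function.support (expNeg u))).Nonempty) (hp : 1 ≤ p)
    (hdiamond : 0 < diamondMass (expNeg u))
    (hvar : ∀ φ : E n ≃L[ℝ] E n, HasFirstVariation p (expNeg u) (gaussian φ))
    (φ : E n ≃L[ℝ] E n) :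
    SolvesDual p (expNeg u) (gaussian φ) ↔ |(invAdjoint φ).det| = 1 ∧
      ∀ z, ∫ y, inner ℝ y z ^ 2 * halfSq (invAdjoint φ) y ^ (p - 1) ∂(surfaceMeasure p (expNeg u))
        = 2 / n * ‖φ z‖ ^ 2
          * quadMoment p (surfaceMeasure p (expNeg u)) (invAdjoint φ) := by
  have hμ := integrable_norm_sq_rpow_surfaceMeasure hu hsupp hp (hvar _)
  have hnd : ∀ v : E n, v ≠ 0 → ¬ ∀ᵐ y ∂(surfaceMeasure p (expNeg u)), inner ℝ v y = 0 :=
    fun v hv => not_ae_inner_eq_zero hu hsupp hp hvar hv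
  rw [solvesDual_gaussian_iff hu hsupp hp hdiamond hvar]
  constructor
  · rintro ⟨h1, h2⟩
    have h3 := abs_det_eq_one_of_isMinOn hn hp hμ hnd h1 h2
    refine ⟨h3, fun z => ?_⟩
    have := integral_inner_sq_eq_of_isMinOn hn hp hμ h3 h2 (φ z)
    rwa [show (invAdjoint φ).adjoint (φ z) = z by simp [invAdjoint]] at this
  · rintro ⟨h1, h2⟩
    refine ⟨h1.ge, fun B hB => ?_⟩
    have hB' : 1 ≤ |B.det| := hB
    obtain ⟨ψ, rfl⟩ := exists_invAdjoint_eq (A := B) fun h => by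
      rw [h, abs_zero] at hB'
      linarith
    exact (quadMoment_le_of_integral_inner_sq_eq hn hp hμ
      (quadMoment_pos hp hμ hnd (invAdjoint_ne_zero hn φ)) h1 hB' h2).1

/-- The equation for φ with the minimality of ψ is the equality case of the sufficiency argument, so
φ and ψ induce the same norm. -/
theorem gaussian_eq_of_solvesDual (hn : 1 ≤ n) (hu : IsL0 u)
    (hsupp : (interior (Function.support (expNeg u))).Nonempty) (hp : 1 ≤ p)
    (hdiamond : 0 < diamondMass (expNeg u))
    (hvar : ∀ φ : E n ≃L[ℝ] E n, HasFirstVariation p (expNeg u) (gaussian φ))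
    {φ ψ : E n ≃L[ℝ] E n} (hφ : SolvesDual p (expNeg u) (gaussian φ))
    (hψ : SolvesDual p (expNeg u) (gaussian ψ)) : gaussian φ = gaussian ψ := by
  have hμ := integrable_norm_sq_rpow_surfaceMeasure hu hsupp hp (hvar _)
  have hnd : ∀ v : E n, v ≠ 0 → ¬ ∀ᵐ y ∂(surfaceMeasure p (expNeg u)), inner ℝ v y = 0 :=
    fun v hv => not_ae_inner_eq_zero hu hsupp hp hvar hv
  obtain ⟨h1, h2⟩ := (solvesDual_gaussian_iff_integral hn hu hsupp hp hdiamond hvar φ).1 hφ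
  obtain ⟨h3, h4⟩ := (solvesDual_gaussian_iff hu hsupp hp hdiamond hvar ψ).1 hψ
  exact gaussian_eq_of_norm_eq ((quadMoment_le_of_integral_inner_sq_eq hn hp hμ
    (quadMoment_pos hp hμ hnd (invAdjoint_ne_zero hn φ)) h1 h3 h2).2 (h4 h1.ge))

end Solution

end LogConcave

end

theorem theorem3p7 (n : ℕ) (hn : 1 ≤ n) (p : ℝ) (hp : 1 ≤ p)
    (f : LogConcave.E n → ℝ) (hf : f ∈ LogConcave.classA0 n)
    (hsupp : (interior (Function.support f)).Nonempty)
    (hdiamond : 0 < LogConcave.diamondMass f)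
    (hvar : ∀ φ : LogConcave.E n ≃L[ℝ] LogConcave.E n,
      LogConcave.HasFirstVariation p f (LogConcave.gaussian φ)) :
    (∃! g : LogConcave.E n → ℝ, LogConcave.SolvesDual p f g) ∧
    ∀ φ : LogConcave.E n ≃L[ℝ] LogConcave.E n,
      LogConcave.SolvesDual p f (LogConcave.gaussian φ) ↔
        (LogConcave.totalMass (LogConcave.gaussian φ) = LogConcave.gaussConst n ∧
          ∀ y : LogConcave.E n,
            LogConcave.deltaJ p f (LogConcave.gaussian φ)
                * (LogConcave.supportFn (LogConcave.polar (LogConcave.gaussian φ)) y).toReal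
              = (n : ℝ) / (4 * p)
                * ∫ x, |(inner ℝ x y : ℝ)| ^ 2
                    * (LogConcave.supportFn (LogConcave.gaussian φ) x).toReal ^ (p - 1)
                    ∂(LogConcave.surfaceMeasure p f)) := by
  open LogConcave in
  obtain ⟨u, hu, rfl⟩ := hf
  refine ⟨?_, fun φ => ?_⟩
  · obtain ⟨A, hA, hmin⟩ := exists_isMinOn_quadMoment hn hp
      (integrable_norm_sq_rpow_surfaceMeasure hu hsupp hp (hvar _))
      fun v hv => not_ae_inner_eq_zero hu hsupp hp hvar hv
    obtain ⟨φ, rfl⟩ := exists_invAdjoint_eq (A := A) fun h => by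
      rw [h, abs_zero] at hA
      linarith
    have hφ := (solvesDual_gaussian_iff hu hsupp hp hdiamond hvar φ).2 ⟨hA, hmin⟩
    refine ⟨gaussian φ, hφ, fun g hg => ?_⟩
    obtain ⟨ψ, rfl⟩ := hg.1
    exact gaussian_eq_of_solvesDual hn hu hsupp hp hdiamond hvar hg hφ
  · rw [solvesDual_gaussian_iff_integral hn hu hsupp hp hdiamond hvar, totalMass_gaussian_eq_iff]
    refine and_congr_right fun _ => forall_congr' fun z => ?_
    have hp0 : p ≠ 0 := by linarith
    have hn0 : (n : ℝ) ≠ 0 := by exact_mod_cast (by omega : n ≠ 0)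
    -- The moment is p δJ_p and the polar's support function is ‖φ z‖²/2, so the constant 2/n of the
    -- Euler–Lagrange equation becomes n/(4p).
    rw [quadMoment_surfaceMeasure hu hsupp hp (hvar φ), supportFn_polar_gaussian,
      EReal.toReal_coe]
    simp_rw [supportFn_gaussian, EReal.toReal_coe, sq_abs]
    generalize ∫ y, inner ℝ y z ^ 2 * halfSq (invAdjoint φ) y ^ (p - 1)
      ∂(surfaceMeasure p (expNeg u)) = I
    rw [halfSq, ContinuousLinearEquiv.coe_coe]
    generalize deltaJ p (expNeg u) (gaussian φ) = d
    constructor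
    · rintro rfl
      field_simp
      ring
    · intro h
      field_simp at h ⊢
      linarith
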